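/- **Setting.** Let $d\ge 1$, let $E$ be a Polish space, and let $\xi=(\xi_t)_{t\ge 0}$ be a time-homogeneous Markov process with state space $E^{\mathbb Z^d}$, realized on a space of trajectories closed under time and space shifts. Let $Y=(Y_n)_{n\ge 1}$ be an i.i.d. sequence of random elements, independent of $\xi$. Write $\mathbb P_\eta$ for the law of $(\xi,Y)$ when $\xi_0=\eta$, and put $\theta_t(\xi,Y)=((\xi_{t+s})_{s\ge 0},(Y_{\lfloor t\rfloor+n})_{n\ge 1})$ for $t\ge 0$ and $\theta_x(\xi,Y)=((\theta_x\xi_t)_{t\ge 0},Y)$ for $x\in\mathbb Z^d$, where $(\theta_x\eta)(y)=\eta(x+y)$. Assume that $\xi$ is translation-invariant (the law of $\theta_x\xi$ under $\mathbb P_\eta$ is the law of $\xi$ under $\mathbb P_{\theta_x\eta}$) and has a translation-invariant equilibrium distribution $\mu$; for a probability measure $\rho$ on $E^{\mathbb Z^d}$ put $\mathbb P_\rho=\int\rho(d\eta)\,\mathbb P_\eta$. Let $\|\cdot\|$ be the $L^1$ norm. Let $\mathscr Y_n=\sigma(Y_1,\dots,Y_n)$, $\mathscr Y_\infty=\sigma(Y_1,Y_2,\dots)$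 and $\mathscr F_t=\sigma(\xi_{[0,t]})\vee\mathscr Y_{\lceil t\rceil}$. For $m>0$, $R\in\mathbb N_0$ and $t\in[0,\infty]$ let $\mathscr C_{R,t}(m)$ be the $\sigma$-algebra generated by the states $\xi_s(x)$ with $s\le t$, $s<\infty$ and $\|x\|\le ms+R$. The starting point $W_0\in\mathbb Z^d$ depends on $(\xi,Y)$ only through $\xi_0$: given $(\xi,Y)$ it has law $\mathbb P_{\xi_0}(W_0\in\cdot)$. Let $\bar\mu$ be the law of $\theta_{W_0}\xi_0$ under $\mathbb P_\mu$. Let $Z=(Z_t)_{t\ge0}$ be an $\mathscr F$-adapted $\mathbb Z^d$-valued process that is $\mathbb P_{\bar\mu}$-a.s. càdlàg with $Z_0=0$, and let $W_t=W_0+\theta_{W_0}Z_t$ for all $t\ge 0$. **Structural assumptions.** * (A1) For all $n\in\mathbb N$, $(Z_{t+n}-Z_n)_{t\ge0}=\theta_{Z_n}\theta_nZ$, $\mathbb P_{\bar\mu}$-a.s. * (A2) For $m>0$ let $\mathcal D_m=\{\|Z_t\|\le mt\ \forall t\ge0\}$. There is $R\in\mathbb N_0$ such that, for all $m>0$, $\mathcal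 D_m$ and $(1_{\mathcal D_m}Z_t)_{t\ge0}$ are measurable with respect to $\mathscr C_{R,\infty}(m)\vee\mathscr Y_\infty$. * (A3) For all $n\in\mathbb N$ and $x\in\mathbb Z^d$, $\mathbb P_{\bar\mu}(Z_n-Z_{n-}=x\mid\xi_{[0,n]},Z_{[0,n)})=\mathbb P_{\theta_{Z_{n-}}\xi_n}(W_0=x)$, $\mathbb P_{\bar\mu}$-a.s. **Regeneration-inducing events.** For some $m\in(0,\infty)$ and $R$ as in (A2) there are events $\Gamma_L\in\mathscr C_{R,L}(m)\vee\mathscr Y_L$, $L\in\mathbb N$, such that the following hold. * (H1) For every $L\in\mathbb N$, $\mathbb P_{\bar\mu}$-a.s. on $\Gamma_L$, $Z_t=0$ for all $t\in[0,L]$. * (H2) For $L$ large enough there is $\gamma_L>0$ such that $\mathbb P_\eta(\Gamma_L)\ge\gamma_L$ for $\bar\mu$-a.e. $\eta$. * (H3) Let $\mathcal S=\inf\{t>0:\|Z_t\|>mt\}$, with $\inf\emptyset=\infty$. There are $a\in(1,\infty)$, $\kappa_L\in(0,1]$ and $\psi_L\in[0,\infty)$ such that, for $L$ large enough and $\bar\mu$-a.e.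 $\eta$, $\mathbb P_\eta(\theta_L\mathcal S=\infty\mid\Gamma_L)\ge\kappa_L$ and $\mathbb E_\eta[1_{\{\theta_L\mathcal S<\infty\}}(\theta_L\mathcal S)^a\mid\Gamma_L]\le\psi_L^a$. * (H4) There are $\Phi_L\ge0$ with $\lim_{L\to\infty}\kappa_L^{-1}\Phi_L=0$ such that, for $L$ large enough and $\bar\mu$-a.e. $\eta$, $|\mathbb E_\eta(\theta_Lf\mid\Gamma_L)-\mathbb E_{\bar\mu}(\theta_Lf\mid\Gamma_L)|\le\Phi_L\|f\|_\infty$ for all bounded $f\ge0$ measurable with respect to $\mathscr C_{R,\infty}(m)$, where $\|f\|_\infty=\sup|f|$. **Theorem.** Under these assumptions there is $w\in\mathbb R^d$ such that $\lim_{t\to\infty}t^{-1}W_t=w$, $\mathbb P_\mu$-a.s. -/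

import Mathlib

open MeasureTheory ProbabilityTheory Filter Topology
open scoped NNReal ENNReal

noncomputable section

namespace RWDRE

/-- The lattice `ℤ^d`. -/
abbrev Site (d : ℕ) := Fin d → ℤ

/-- Configurations, i.e. elements of `E^{ℤ^d}`, with the product topology and σ-algebra. -/
abbrev Config (d : ℕ) (E : Type*) := Site d → E

/-- The `L¹` norm on `ℤ^d`. -/
def l1norm {d : ℕ} (x : Site d) : ℝ := ∑ i, |(x i : ℝ)|

/-- The space shift of a configuration: `(θ_x η)(y) = η (x + y)`. -/
def shiftConfig {d : ℕ} {E : Type*} (x : Site d) (η : Config d E) : Config d E :=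
  fun y => η (x + y)

/-- A space of admissible trajectories of the environment (for instance all trajectories, or the
càdlàg ones): any set of maps `[0,∞) → E^{ℤ^d}` that is closed under time and space shifts. -/
structure PathSpace (d : ℕ) (E : Type*) where
  carrier : Set (ℝ≥0 → Config d E)
  timeShift_mem : ∀ ξ ∈ carrier, ∀ t : ℝ≥0, (fun s => ξ (t + s)) ∈ carrier
  spaceShift_mem : ∀ ξ ∈ carrier, ∀ x : Site d, (fun s => shiftConfig x (ξ s)) ∈ carrier

variable {d : ℕ} {E S : Type*}

/-- Trajectories, with the σ-algebra generated by the coordinates `ξ_t(x)`. -/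
abbrev PathSpace.Path (D : PathSpace d E) := {ξ : ℝ≥0 → Config d E // ξ ∈ D.carrier}

/-- The canonical space of pairs `(ξ, Y)`. The sequence `Y = (Y_1, Y_2, …)` is indexed from `0`:
the entry `Y k` plays the role of `Y_{k+1}`. -/
abbrev PathSpace.Sample (D : PathSpace d E) (S : Type*) := D.Path × (ℕ → S)

/-- `θ_t` on environment trajectories. -/
def pathTimeShift {D : PathSpace d E} (t : ℝ≥0) (ξ : D.Path) : D.Path :=
  ⟨fun s => ξ.1 (t + s), D.timeShift_mem ξ.1 ξ.2 t⟩

/-- `θ_x` on environment trajectories. -/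
def pathSpaceShift {D : PathSpace d E} (x : Site d) (ξ : D.Path) : D.Path :=
  ⟨fun s => shiftConfig x (ξ.1 s), D.spaceShift_mem ξ.1 ξ.2 x⟩

/-- `θ_t (ξ, Y) = ((ξ_{t+s})_{s ≥ 0}, (Y_{⌊t⌋+n})_{n ≥ 1})`. -/
def timeShift {D : PathSpace d E} (t : ℝ≥0) (ω : D.Sample S) : D.Sample S :=
  (pathTimeShift t ω.1, fun k => ω.2 (⌊t⌋₊ + k))

/-- `θ_x (ξ, Y) = ((θ_x ξ_t)_{t ≥ 0}, Y)`. -/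
def spaceShift {D : PathSpace d E} (x : Site d) (ω : D.Sample S) : D.Sample S :=
  (pathSpaceShift x ω.1, ω.2)

section Environment

variable [MeasurableSpace E] {D : PathSpace d E}

/-- `σ(ξ_u : u ≤ t)` on the space of trajectories. -/
abbrev pathSigma (D : PathSpace d E) (t : ℝ≥0) : MeasurableSpace D.Path :=
  ⨆ (u : ℝ≥0) (_ : u ≤ t), MeasurableSpace.comap (fun ξ : D.Path => ξ.1 u) inferInstance

/-- The family of laws `η ↦ K η` is a time-homogeneous Markov process: under `K η` the process
starts from `η`, and for all `t`, given `σ(ξ_u : u ≤ t)`, the trajectory after time `t` has law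
`K ξ_t`. -/
structure IsMarkovFamily (K : Kernel (Config d E) D.Path) : Prop where
  start : ∀ η, ∀ᵐ ξ ∂(K η), ξ.1 0 = η
  markov : ∀ (η : Config d E) (t : ℝ≥0) (A : Set D.Path), MeasurableSet A →
    ∀ B : Set D.Path, MeasurableSet[pathSigma D t] B →
      K η (B ∩ pathTimeShift t ⁻¹' A) = ∫⁻ ξ in B, K (ξ.1 t) A ∂(K η)

/-- `θ_x ξ` has under `K η` the same law as `ξ` under `K (θ_x η)`. -/
def IsTranslationInvariantFamily (K : Kernel (Config d E) D.Path) : Prop :=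
  ∀ (x : Site d) (η : Config d E), (K η).map (pathSpaceShift x) = K (shiftConfig x η)

/-- `μ` is a translation-invariant equilibrium: it is invariant under space shifts, and `ξ_t` has
law `μ` for all `t` when `ξ_0` has law `μ`. -/
structure IsTranslationInvariantEquilibrium (K : Kernel (Config d E) D.Path)
    (μ : Measure (Config d E)) : Prop where
  translation : ∀ x : Site d, μ.map (shiftConfig x) = μ
  equilibrium : ∀ t : ℝ≥0, (μ.bind K).map (fun ξ : D.Path => ξ.1 t) = μ

end Environment

section Laws

variable [MeasurableSpace E] [MeasurableSpace S] {D : PathSpace d E}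

lemma measurable_initial : Measurable (fun ω : D.Sample S => ω.1.1 0) :=
  (measurable_pi_apply 0).comp (measurable_subtype_coe.comp measurable_fst)

/-- The law `ℙ_η` of `(ξ, Y)`: `ξ` has law `K η`, and `Y` is an independent i.i.d. sequence with
marginal law `ν`. -/
def lawFrom (K : Kernel (Config d E) D.Path) (ν : Measure S) [IsProbabilityMeasure ν]
    (η : Config d E) : Measure (D.Sample S) :=
  (K η).prod (Measure.infinitePi fun _ : ℕ => ν)

/-- The law `ℙ_μ = ∫ μ(dη) ℙ_η` of `(ξ, Y)`. -/
def lawMix (K : Kernel (Config d E) D.Path) (ν : Measure S) [IsProbabilityMeasure ν]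
    (μ : Measure (Config d E)) : Measure (D.Sample S) :=
  μ.bind (lawFrom K ν)

/-- The joint law under `ℙ_μ` of `((ξ, Y), W_0)`: given `(ξ, Y)`, the starting point `W_0` is
drawn from `q ξ_0`. In particular `q η {x} = ℙ_η(W_0 = x)`. -/
def lawWithStart (K : Kernel (Config d E) D.Path) (ν : Measure S) [IsProbabilityMeasure ν]
    (q : Kernel (Config d E) (Site d)) (μ : Measure (Config d E)) :
    Measure (D.Sample S × Site d) :=
  (lawMix K ν μ).compProd (q.comap (fun ω : D.Sample S => ω.1.1 0) measurable_initial)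

/-- `μ̄`, the law of `θ_{W_0} ξ_0` under `ℙ_μ`. -/
def muBar (K : Kernel (Config d E) D.Path) (ν : Measure S) [IsProbabilityMeasure ν]
    (q : Kernel (Config d E) (Site d)) (μ : Measure (Config d E)) : Measure (Config d E) :=
  (lawWithStart K ν q μ).map (fun p => shiftConfig p.2 (p.1.1.1 0))

end Laws

section SigmaAlgebras

variable [MeasurableSpace E] [MeasurableSpace S]

/-- `σ(ξ_u : u ≤ t)`. -/
abbrev envSigma (D : PathSpace d E) (S : Type*) (t : ℝ≥0) : MeasurableSpace (D.Sample S) :=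
  ⨆ (u : ℝ≥0) (_ : u ≤ t), MeasurableSpace.comap (fun ω : D.Sample S => ω.1.1 u) inferInstance

/-- `𝒴_n = σ(Y_1, …, Y_n)`. -/
abbrev noiseSigma (D : PathSpace d E) (S : Type*) [MeasurableSpace S] (n : ℕ) :
    MeasurableSpace (D.Sample S) :=
  ⨆ (k : ℕ) (_ : k < n), MeasurableSpace.comap (fun ω : D.Sample S => ω.2 k) inferInstance

/-- `𝒴_∞`. -/
abbrev noiseSigmaInf (D : PathSpace d E) (S : Type*) [MeasurableSpace S] :
    MeasurableSpace (D.Sample S) :=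
  ⨆ k : ℕ, MeasurableSpace.comap (fun ω : D.Sample S => ω.2 k) inferInstance

/-- `ℱ_t = σ(ξ_{[0,t]}) ∨ 𝒴_{⌈t⌉}` (for `t = 0` this is `σ(ξ_0)`). -/
abbrev histSigma (D : PathSpace d E) (S : Type*) [MeasurableSpace S] (t : ℝ≥0) :
    MeasurableSpace (D.Sample S) :=
  envSigma D S t ⊔ noiseSigma D S ⌈t⌉₊

/-- The `R`-enlarged `m`-cone `C_R(m)`. -/
def cone (d : ℕ) (R : ℕ) (m : ℝ) : Set (Site d × ℝ≥0) :=
  {p | l1norm p.1 ≤ m * (p.2 : ℝ) + R}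

/-- `𝒞_{R,t}(m)`: generated by the states of `ξ` up to time `t` inside the cone. -/
abbrev coneSigma (D : PathSpace d E) (S : Type*) (R : ℕ) (m : ℝ) (t : ℝ≥0) :
    MeasurableSpace (D.Sample S) :=
  ⨆ (x : Site d) (u : ℝ≥0) (_ : (x, u) ∈ cone d R m ∧ u ≤ t),
    MeasurableSpace.comap (fun ω : D.Sample S => ω.1.1 u x) inferInstance

/-- `𝒞_{R,∞}(m)`: generated by the states of `ξ` inside the cone. -/
abbrev coneSigmaInf (D : PathSpace d E) (S : Type*) (R : ℕ) (m : ℝ) :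
    MeasurableSpace (D.Sample S) :=
  ⨆ (x : Site d) (u : ℝ≥0) (_ : (x, u) ∈ cone d R m),
    MeasurableSpace.comap (fun ω : D.Sample S => ω.1.1 u x) inferInstance

end SigmaAlgebras

/-- Right-continuous with left limits. -/
def IsCadlag (z : ℝ≥0 → Site d) : Prop :=
  ∀ t, ContinuousWithinAt z (Set.Ici t) t ∧ ∃ l, Tendsto z (𝓝[<] t) (𝓝 l)

/-- `Z_{t-}`, the left limit. -/
def leftVal {D : PathSpace d E} (Z : ℝ≥0 → D.Sample S → Site d) (t : ℝ≥0) (ω : D.Sample S) :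
    Site d :=
  Function.leftLim (fun s => Z s ω) t

/-- `W_t = W_0 + θ_{W_0} Z_t`, a function of `((ξ, Y), W_0)`. -/
def walk {D : PathSpace d E} (Z : ℝ≥0 → D.Sample S → Site d) (t : ℝ≥0) (p : D.Sample S × Site d) :
    Site d :=
  p.2 + Z t (spaceShift p.2 p.1)

/-- `𝒟_m = {‖Z_t‖ ≤ m t for all t ≥ 0}`. -/
def coneEvent {D : PathSpace d E} (Z : ℝ≥0 → D.Sample S → Site d) (m : ℝ) : Set (D.Sample S) :=
  {ω | ∀ t : ℝ≥0, l1norm (Z t ω) ≤ m * (t : ℝ)}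

/-- `𝒮 = inf {t > 0 : ‖Z_t‖ > m t}`, with `inf ∅ = ∞`. -/
def exitTime {D : PathSpace d E} (Z : ℝ≥0 → D.Sample S → Site d) (m : ℝ) (ω : D.Sample S) : ℝ≥0∞ :=
  ⨅ (t : ℝ≥0) (_ : 0 < t ∧ m * (t : ℝ) < l1norm (Z t ω)), (t : ℝ≥0∞)

section Assumptions

variable [MeasurableSpace E] [MeasurableSpace S] {D : PathSpace d E}

/-- `Z` is a càdlàg `ℱ`-adapted process with `Z_0 = 0` a.s. under `Pbar = ℙ_μ̄`. -/
structure IsWalkFunctional (Pbar : Measure (D.Sample S)) (Z : ℝ≥0 → D.Sample S → Site d) :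
    Prop where
  adapted : ∀ t, Measurable[histSigma D S t] (Z t)
  cadlag : ∀ᵐ ω ∂Pbar, IsCadlag (fun t => Z t ω)
  zero : ∀ᵐ ω ∂Pbar, Z 0 ω = 0

/-- Additivity. -/
def A1 (Pbar : Measure (D.Sample S)) (Z : ℝ≥0 → D.Sample S → Site d) : Prop :=
  ∀ n : ℕ, 1 ≤ n → ∀ᵐ ω ∂Pbar, ∀ t : ℝ≥0,
    Z (t + n) ω - Z n ω = Z t (spaceShift (Z n ω) (timeShift (n : ℝ≥0) ω))

/-- Locality, with range `R`. -/
def A2 (Z : ℝ≥0 → D.Sample S → Site d) (R : ℕ) : Prop :=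
  ∀ m : ℝ, 0 < m →
    MeasurableSet[coneSigmaInf D S R m ⊔ noiseSigmaInf D S] (coneEvent Z m) ∧
    ∀ t : ℝ≥0, Measurable[coneSigmaInf D S R m ⊔ noiseSigmaInf D S]
      ((coneEvent Z m).indicator (Z t))

/-- `σ(ξ_{[0,n]}, Z_{[0,n)})`. -/
abbrev preJumpSigma (Z : ℝ≥0 → D.Sample S → Site d) (n : ℕ) : MeasurableSpace (D.Sample S) :=
  envSigma D S (n : ℝ≥0) ⊔
    ⨆ (s : ℝ≥0) (_ : s < (n : ℝ≥0)), MeasurableSpace.comap (Z s) inferInstance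

/-- Homogeneity of jumps. -/
def A3 (Pbar : Measure (D.Sample S)) (q : Kernel (Config d E) (Site d))
    (Z : ℝ≥0 → D.Sample S → Site d) : Prop :=
  ∀ n : ℕ, 1 ≤ n → ∀ x : Site d,
    Pbar[{ω | Z n ω - leftVal Z n ω = x}.indicator (fun _ => (1 : ℝ)) | preJumpSigma Z n]
      =ᵐ[Pbar] fun ω => (q (shiftConfig (leftVal Z n ω) (ω.1.1 n))).real {x}

/-- The events `Γ_L`, `L ≥ 1`, are observable inside the cone up to time `L`. -/
def IsLocalEvents (Γ : ℕ → Set (D.Sample S)) (R : ℕ) (m : ℝ) : Prop :=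
  ∀ L : ℕ, 1 ≤ L → MeasurableSet[coneSigma D S R m (L : ℝ≥0) ⊔ noiseSigma D S L] (Γ L)

/-- Determinacy. -/
def H1 (Pbar : Measure (D.Sample S)) (Z : ℝ≥0 → D.Sample S → Site d)
    (Γ : ℕ → Set (D.Sample S)) : Prop :=
  ∀ L : ℕ, 1 ≤ L → ∀ᵐ ω ∂Pbar, ω ∈ Γ L → ∀ t : ℝ≥0, t ≤ L → Z t ω = 0

/-- Non-degeneracy; `P η` stands for `ℙ_η`. -/
def H2 (P : Config d E → Measure (D.Sample S)) (mubar : Measure (Config d E))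
    (Γ : ℕ → Set (D.Sample S)) : Prop :=
  ∀ᶠ L : ℕ in atTop, ∃ γ : ℝ, 0 < γ ∧ ∀ᵐ η ∂mubar, γ ≤ (P η).real (Γ L)

/-- Cone constraints, with constants `a`, `κ_L`, `ψ_L`. -/
structure H3 (P : Config d E → Measure (D.Sample S)) (mubar : Measure (Config d E))
    (Z : ℝ≥0 → D.Sample S → Site d) (Γ : ℕ → Set (D.Sample S)) (m a : ℝ) (κ ψ : ℕ → ℝ) :
    Prop where
  one_lt : 1 < a
  kappa_mem : ∀ L : ℕ, 1 ≤ L → 0 < κ L ∧ κ L ≤ 1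
  psi_nonneg : ∀ L : ℕ, 1 ≤ L → 0 ≤ ψ L
  stay : ∀ᶠ L : ℕ in atTop, ∀ᵐ η ∂mubar,
    κ L ≤ (cond (P η) (Γ L)).real {ω | exitTime Z m (timeShift (L : ℝ≥0) ω) = ∞}
  moment : ∀ᶠ L : ℕ in atTop, ∀ᵐ η ∂mubar,
    ∫⁻ ω, {ω' | exitTime Z m (timeShift (L : ℝ≥0) ω') < ∞}.indicator
        (fun ω' => exitTime Z m (timeShift (L : ℝ≥0) ω') ^ a) ω ∂(cond (P η) (Γ L))
      ≤ ENNReal.ofReal (ψ L ^ a)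

/-- Conditional cone-mixing, with constants `Φ_L` that are small compared to `κ_L`. -/
structure H4 (P : Config d E → Measure (D.Sample S)) (mubar : Measure (Config d E))
    (Pbar : Measure (D.Sample S)) (Γ : ℕ → Set (D.Sample S)) (R : ℕ) (m : ℝ) (κ Φ : ℕ → ℝ) :
    Prop where
  phi_nonneg : ∀ L : ℕ, 1 ≤ L → 0 ≤ Φ L
  phi_small : Tendsto (fun L => (κ L)⁻¹ * Φ L) atTop (𝓝 0)
  mixing : ∀ᶠ L : ℕ in atTop, ∀ᵐ η ∂mubar, ∀ f : D.Sample S → ℝ,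
    Measurable[coneSigmaInf D S R m] f → (∀ ω, 0 ≤ f ω) → BddAbove (Set.range f) →
      |∫ ω, f (timeShift (L : ℝ≥0) ω) ∂(cond (P η) (Γ L))
          - ∫ ω, f (timeShift (L : ℝ≥0) ω) ∂(cond Pbar (Γ L))| ≤ Φ L * ⨆ ω, f ω

end Assumptions

end RWDRE

end

open RWDRE

/-! Fix `L` and observe the environment from the walk at the times `n * L`. The trial started at
such a time succeeds if `Γ L` occurs and, from `L` time units later on, the walk stays in the cone.
Success involves the whole future, but cones nest: if the trial at `n * L` succeeds, then the
initial one succeeds exactly when it has not failed by that time (`RegularSample.glue`). Hence, for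
`k₀ ≤ n`, "the initial trial succeeds and the next success at or after `k₀` is at `n`" is a history
event at `n` intersected with the success of trial `n` (`mem_nextEvent_iff`). By the Markov
property, the future at that moment has the law of the current state conditioned on success
(`lintegral_renew_le`, `integral_mul_renew_eq_zero`).

These renewals are neither independent nor identically distributed, because the conditioned law
still depends on the state. Cone mixing controls this dependence: on success, the truncated
displacement up to the next success is a function of the environment in the cone and of the noise
after time `L`. So its conditional mean varies by at most `16 * m * Φ / κ` over the admissible
states (`abs_mean_reward_sub_le`). Subtracting the conditional means leaves orthogonal increments,
which obey a law of large numbers (`birkhoffSum_centered`, `ae_birkhoffSum_near`).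

A cycle lasts `k₀` trials plus a delay. Restarting after each detected failure bounds a moment of
the delay of order larger than `1`, uniformly in `k₀` (`lintegral_truncWait_le`,
`lintegral_next_sub_le`); hence the delays add up at most linearly, at a rate free of `k₀`
(`ae_sum_delay_le`). Displacement is at most `m` per unit time along a successful path, so the
delays alter the speed by `O(1 / k₀)` only (`path_speed`). With `L` fixed, a large `k₀` gives an
approximate speed with error just above `16 * m * Φ / κ` (`exists_speed`), and a large `L` makes
this error small (`exists_approx_speed`). Approximate speeds with vanishing errors form a Cauchy
sequence, and its limit is the speed.

The hypotheses hold only for almost every configuration, whereas trials restart from configurations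
seen from the walk. Homogeneity of jumps and the equilibrium `μ` make the laws of the latter
absolutely continuous with respect to `μ̄` (`ae_initial_fromWalk`), so everything can be arranged to
hold on a set of full measure that the walk never leaves (`exists_closed_good`). -/

namespace RWDRE

/-! ### Abstract trial systems and their Markov property -/

/-- A Markov chain of trajectories `ω`, observed along a family of shifts `step n`: given the
history `hist n`, the shifted trajectory `step n ω` has law `law (state (step n ω))`.
The event `success` is almost a history event: if a later shift is successful, then the initial
trial is successful exactly when `ω ∈ intact n`. -/
structure TrialSystem (A Ω : Type*) [MeasurableSpace A] [mΩ : MeasurableSpace Ω] where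
  law : Kernel A Ω
  law_markov : IsMarkovKernel law
  hist : ℕ → MeasurableSpace Ω
  hist_le : ∀ n, hist n ≤ mΩ
  hist_mono : Monotone hist
  step : ℕ → Ω → Ω
  measurable_step : ∀ n, Measurable (step n)
  measurable_step_hist : ∀ j k, Measurable[hist (j + k), hist k] (step j)
  state : Ω → A
  measurable_state : Measurable[hist 0] state
  good : Set A
  reg : Set Ω
  ae_state : ∀ η ∈ good, ∀ᵐ ω ∂(law η), state ω = η
  ae_reg : ∀ η ∈ good, ∀ᵐ ω ∂(law η),
    ω ∈ reg ∧ ∀ n, step n ω ∈ reg ∧ state (step n ω) ∈ good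
  step_step : ∀ ω ∈ reg, ∀ j k, step k (step j ω) = step (j + k) ω
  step_zero : ∀ ω ∈ reg, step 0 ω = ω
  markov : ∀ η ∈ good, ∀ (n : ℕ) (B : Set Ω), MeasurableSet[hist n] B →
    ∀ C : Set Ω, MeasurableSet C →
      law η (B ∩ step n ⁻¹' C) = ∫⁻ ω in B, law (state (step n ω)) C ∂(law η)
  success : Set Ω
  measurableSet_success : MeasurableSet success
  intact : ℕ → Set Ω
  measurableSet_intact : ∀ n, 1 ≤ n → MeasurableSet[hist n] (intact n)
  glue : ∀ ω ∈ reg, ∀ n, 1 ≤ n → step n ω ∈ success → (ω ∈ success ↔ ω ∈ intact n)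
  success_iff : ∀ ω ∈ reg, ω ∈ success ↔ ∀ n, 1 ≤ n → ω ∈ intact n
  prob : ℝ
  prob_pos : 0 < prob
  prob_le : ∀ η ∈ good, prob ≤ (law η).real success
  expo : ℝ
  one_lt_expo : 1 < expo
  expo_le_two : expo ≤ 2
  bound : ℝ
  moment : ∀ η ∈ good, ∑' j : ℕ, ((j : ℝ≥0∞) + 1) ^ expo *
    law η ((⋂ i < j, intact (i + 1)) \ intact (j + 1)) ≤ ENNReal.ofReal bound

namespace TrialSystem

variable {A Ω : Type*} [MeasurableSpace A] [mΩ : MeasurableSpace Ω] (T : TrialSystem A Ω)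

attribute [instance] TrialSystem.law_markov

lemma measurable_state' : Measurable T.state := T.measurable_state.mono (T.hist_le 0) le_rfl

/-- The trajectory is regular and so are all its shifts. -/
def Regular (ω : Ω) : Prop := ω ∈ T.reg ∧ ∀ n, T.step n ω ∈ T.reg ∧ T.state (T.step n ω) ∈ T.good

lemma ae_regular {η : A} (hη : η ∈ T.good) : ∀ᵐ ω ∂(T.law η), T.Regular ω :=
  T.ae_reg η hη

variable {T} in
lemma Regular.step {ω : Ω} (h : T.Regular ω) (n : ℕ) : T.Regular (T.step n ω) :=
  ⟨(h.2 n).1, fun k => by rw [T.step_step ω h.1]; exact h.2 _⟩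

variable {T} in
lemma Regular.state_mem {ω : Ω} (h : T.Regular ω) : T.state ω ∈ T.good := by
  have := (h.2 0).2
  rwa [T.step_zero ω h.1] at this

/-- This is the event that failure of the initial trial is first detected at `j + 1`. Since it
belongs to the history at that index, the Markov property can be used to start afresh right after
the detection. -/
lemma measurableSet_fail (j : ℕ) :
    MeasurableSet[T.hist (j + 1)] ((⋂ i < j, T.intact (i + 1)) \ T.intact (j + 1)) := by
  refine MeasurableSet.diff (m := T.hist (j + 1)) ?_ (T.measurableSet_intact _ (by omega))
  refine MeasurableSet.iInter (m := T.hist (j + 1)) fun i =>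
    MeasurableSet.iInter (m := T.hist (j + 1)) fun hi => ?_
  exact T.hist_mono (by omega : i + 1 ≤ j + 1) _ (T.measurableSet_intact _ (by omega))

/-- The field `markov` identifies the image of the law restricted to `B` with a mixture of laws;
integrating against both measures extends it from events to functions. -/
lemma lintegral_markov {η : A} (hη : η ∈ T.good) (n : ℕ) {B : Set Ω}
    (hB : MeasurableSet[T.hist n] B) {f : Ω → ℝ≥0∞} (hf : Measurable f) :
    ∫⁻ ω in B, f (T.step n ω) ∂(T.law η)
      = ∫⁻ ω in B, ∫⁻ ω', f ω' ∂(T.law (T.state (T.step n ω))) ∂(T.law η) := by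
  have hst : Measurable fun ω => T.state (T.step n ω) :=
    T.measurable_state'.comp (T.measurable_step n)
  have hker : Measurable fun ω => T.law (T.state (T.step n ω)) := T.law.measurable.comp hst
  have key : ((T.law η).restrict B).map (T.step n)
      = ((T.law η).restrict B).bind (fun ω => T.law (T.state (T.step n ω))) := by
    ext C hC
    rw [Measure.map_apply (T.measurable_step n) hC, Measure.bind_apply hC hker.aemeasurable,
      Measure.restrict_apply (T.measurable_step n hC), Set.inter_comm, T.markov η hη n B hB C hC]
  rw [← lintegral_map hf (T.measurable_step n), key,
    Measure.lintegral_bind hker.aemeasurable hf.aemeasurable]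

/-- If `X` is centred under all the laws `law η`, then `X ∘ step n` is orthogonal to `hist n`. -/
lemma integral_mul_step_eq_zero {η : A} (hη : η ∈ T.good) (n : ℕ) {φ X : Ω → ℝ}
    (hφ : Measurable[T.hist n] φ) {b c : ℝ} (hφb : ∀ ω, |φ ω| ≤ b) (hX : Measurable X)
    (hXc : ∀ ω, |X ω| ≤ c) (hzero : ∀ η' ∈ T.good, ∫ ω, X ω ∂(T.law η') = 0) :
    ∫ ω, φ ω * X (T.step n ω) ∂(T.law η) = 0 := by
  have hXm : Measurable fun ω => X (T.step n ω) := hX.comp (T.measurable_step n)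
  have hXi : Integrable (fun ω => X (T.step n ω)) (T.law η) :=
    Integrable.of_bound hXm.aestronglyMeasurable c (Eventually.of_forall fun ω => hXc _)
  have hsets : ∀ B, MeasurableSet[T.hist n] B →
      ∫ ω in B, X (T.step n ω) ∂(T.law η) = 0 := by
    intro B hB
    rw [integral_eq_lintegral_pos_part_sub_lintegral_neg_part hXi.integrableOn,
      T.lintegral_markov hη n hB (f := fun ω => ENNReal.ofReal (X ω)) (by fun_prop),
      T.lintegral_markov hη n hB (f := fun ω => ENNReal.ofReal (-X ω)) (by fun_prop), sub_eq_zero]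
    congr 1
    refine lintegral_congr_ae (ae_restrict_of_ae ?_)
    filter_upwards [T.ae_reg η hη] with ω hω
    have h0 := hzero _ (hω.2 n).2
    have hi : Integrable X (T.law (T.state (T.step n ω))) :=
      Integrable.of_bound hX.aestronglyMeasurable c (Eventually.of_forall fun ω => hXc _)
    rw [integral_eq_lintegral_pos_part_sub_lintegral_neg_part hi, sub_eq_zero] at h0
    have h1 := hi.lintegral_lt_top
    have h2 := hi.neg.lintegral_lt_top
    exact (ENNReal.toReal_eq_toReal_iff' h1.ne h2.ne).1 h0
  -- The vanishing integrals over history events say that the conditional expectation is zero; the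
  -- history-measurable factor `φ` can then be pulled out.
  have hce : (0 : Ω → ℝ) =ᵐ[T.law η] (T.law η)[fun ω => X (T.step n ω) | T.hist n] := by
    refine ae_eq_condExp_of_forall_setIntegral_eq (T.hist_le n) hXi ?_ ?_ ?_
    · intro s _ _; exact integrableOn_zero
    · intro s hs _; rw [hsets s hs]; simp
    · exact aestronglyMeasurable_zero
  have hmul : Integrable (φ * fun ω => X (T.step n ω)) (T.law η) := by
    refine Integrable.of_bound (((hφ.mono (T.hist_le n) le_rfl).mul hXm).aestronglyMeasurable)
      (b * c) (Eventually.of_forall fun ω => ?_)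
    rw [Pi.mul_apply, norm_mul]
    exact mul_le_mul (hφb ω) (hXc _) (abs_nonneg _) ((abs_nonneg _).trans (hφb ω))
  have hpull := condExp_mul_of_stronglyMeasurable_left (m := T.hist n)
    (hφ.stronglyMeasurable) hmul hXi
  calc ∫ ω, φ ω * X (T.step n ω) ∂(T.law η)
      = ∫ ω, ((T.law η)[φ * (fun ω => X (T.step n ω)) | T.hist n]) ω ∂(T.law η) :=
        (integral_condExp (T.hist_le n)).symm
    _ = ∫ ω, (0 : ℝ) ∂(T.law η) := by
        refine integral_congr_ae ?_
        filter_upwards [hpull, hce] with ω h1 h2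
        rw [h1, Pi.mul_apply, ← h2]; simp
    _ = 0 := by simp

end TrialSystem
end RWDRE

/-! ### Success times: moments, and the law of the future at a renewal -/

noncomputable section

namespace RWDRE

lemma measurable_natInf {Ω : Type*} [MeasurableSpace Ω] {p : ℕ → Ω → Prop}
    (hp : ∀ k, MeasurableSet {ω | p k ω}) : Measurable fun ω => sInf {k | p k ω} := by
  refine measurable_to_countable' fun n => ?_
  have h1 : MeasurableSet ({ω | p n ω} ∩ ⋂ j < n, {ω | p j ω}ᶜ) :=
    (hp n).inter (MeasurableSet.iInter fun j => MeasurableSet.iInter fun _ => (hp j).compl)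
  have h2 : MeasurableSet (⋂ j, {ω | p j ω}ᶜ) := MeasurableSet.iInter fun j => (hp j).compl
  have key : ∀ ω, sInf {k | p k ω} = n ↔
      (p n ω ∧ ∀ j < n, ¬ p j ω) ∨ (n = 0 ∧ ∀ j, ¬ p j ω) := by
    intro ω
    constructor
    · intro h
      by_cases he : ∃ j, p j ω
      · left
        have hm : p (sInf {k | p k ω}) ω := Nat.sInf_mem (s := {k | p k ω}) he
        rw [h] at hm
        exact ⟨hm, fun j hj hpj => absurd (Nat.sInf_le (s := {k | p k ω}) hpj) (by omega)⟩
      · right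
        push Not at he
        have : {k | p k ω} = ∅ := by ext k; simp [he k]
        rw [this, Nat.sInf_empty] at h
        exact ⟨h.symm, he⟩
    · rintro (⟨hn, hj⟩ | ⟨rfl, hj⟩)
      · refine le_antisymm (Nat.sInf_le hn) ?_
        by_contra hlt
        push Not at hlt
        exact hj _ hlt (Nat.sInf_mem (s := {k | p k ω}) ⟨n, hn⟩)
      · have : {k | p k ω} = ∅ := by ext k; simp [hj k]
        rw [this, Nat.sInf_empty]
  -- Since `sInf ∅ = 0`, the value `0` also collects the event that no index satisfies `p`.
  by_cases hn : n = 0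
  · convert h1.union h2 using 1
    ext ω
    subst hn
    simpa using key ω
  · convert h1 using 1
    ext ω
    simp [key, hn]

/-- Convexity of the power function with weights `l` and `r`, applied to `l⁻¹ * x` and `r⁻¹ * y`.
The weights come out as `l ^ (1 - a)` and `r ^ (1 - a)`, which are at most `l⁻¹` and `r⁻¹` because
`a ≤ 2`. With `r` near `1` the second term is inflated only slightly, which a recursive moment bound
can absorb. -/
lemma ENNReal.add_rpow_le_of_le_two {a : ℝ} (ha1 : 1 ≤ a) (ha2 : a ≤ 2) {l r : ℝ≥0∞}
    (hl : l ≠ 0) (hr : r ≠ 0) (hlr : l + r = 1) (x y : ℝ≥0∞) :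
    (x + y) ^ a ≤ l⁻¹ * x ^ a + r⁻¹ * y ^ a := by
  have hl1 : l ≤ 1 := hlr ▸ le_self_add
  have hr1 : r ≤ 1 := hlr ▸ le_add_self
  have hlt : l ≠ ∞ := ne_top_of_le_ne_top ENNReal.one_ne_top hl1
  have hrt : r ≠ ∞ := ne_top_of_le_ne_top ENNReal.one_ne_top hr1
  have aux : ∀ s z : ℝ≥0∞, s ≠ 0 → s ≠ ∞ → s ≤ 1 → s * (s⁻¹ * z) ^ a ≤ s⁻¹ * z ^ a := by
    intro s z h0 ht h1
    rw [ENNReal.mul_rpow_of_nonneg _ _ (by linarith), ← mul_assoc]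
    gcongr
    calc s * s⁻¹ ^ a ≤ s * s⁻¹ ^ (2 : ℝ) := by
          gcongr
          exact ENNReal.one_le_inv.2 h1
      _ = s⁻¹ := by
          rw [show (2 : ℝ) = ((2 : ℕ) : ℝ) by norm_num, ENNReal.rpow_natCast, pow_two, ← mul_assoc,
            ENNReal.mul_inv_cancel h0 ht, one_mul]
  have h := ENNReal.rpow_arith_mean_le_arith_mean2_rpow l r (l⁻¹ * x) (r⁻¹ * y) hlr ha1
  rw [← mul_assoc, ← mul_assoc, ENNReal.mul_inv_cancel hl hlt, ENNReal.mul_inv_cancel hr hrt,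
    one_mul, one_mul] at h
  exact h.trans (add_le_add (aux l x hl hlt hl1) (aux r y hr hrt hr1))

namespace TrialSystem

variable {A Ω : Type*} [MeasurableSpace A] [mΩ : MeasurableSpace Ω] (T : TrialSystem A Ω)

lemma measurableSet_step_success (k : ℕ) : MeasurableSet {ω | T.step k ω ∈ T.success} :=
  T.measurable_step k T.measurableSet_success

lemma measurable_law_step (n : ℕ) {C : Set Ω} (hC : MeasurableSet C) :
    Measurable fun ω => T.law (T.state (T.step n ω)) C :=
  (Kernel.measurable_coe _ hC).comp (T.measurable_state'.comp (T.measurable_step n))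

/-- The first success, truncated at `K`. -/
def truncWait (K : ℕ) (ω : Ω) : ℕ := sInf {k | k = K ∨ T.step k ω ∈ T.success}

/-- The first success. -/
def wait (ω : Ω) : ℕ := sInf {k | T.step k ω ∈ T.success}

/-- The first success at or after `k₀`. -/
def next (k₀ : ℕ) (ω : Ω) : ℕ := sInf {k | k₀ ≤ k ∧ T.step k ω ∈ T.success}

/-- The trajectory shifted to the first success at or after `k₀`. -/
def renew (k₀ : ℕ) (ω : Ω) : Ω := T.step (T.next k₀ ω) ω

lemma measurable_truncWait (K : ℕ) : Measurable (T.truncWait K) :=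
  measurable_natInf fun k => (MeasurableSet.const _).union (T.measurableSet_step_success k)

lemma measurable_wait : Measurable T.wait :=
  measurable_natInf fun k => T.measurableSet_step_success k

lemma measurable_next (k₀ : ℕ) : Measurable (T.next k₀) :=
  measurable_natInf fun k => (MeasurableSet.const _).inter (T.measurableSet_step_success k)

lemma measurable_renew (k₀ : ℕ) : Measurable (T.renew k₀) := by
  have : Measurable fun p : Ω × ℕ => T.step p.2 p.1 :=
    measurable_from_prod_countable_left fun n => T.measurable_step n
  exact this.comp (measurable_id.prodMk (T.measurable_next k₀))

lemma truncWait_le (K : ℕ) (ω : Ω) : T.truncWait K ω ≤ K := Nat.sInf_le (Or.inl rfl)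

lemma truncWait_le_of_step {ω : Ω} (hω : ω ∈ T.reg) (K j : ℕ) :
    T.truncWait K ω ≤ j + T.truncWait K (T.step j ω) := by
  rcases Nat.sInf_mem (s := {k | k = K ∨ T.step k (T.step j ω) ∈ T.success}) ⟨K, Or.inl rfl⟩
    with h | h
  · have := T.truncWait_le K ω
    unfold truncWait at *
    omega
  · refine Nat.sInf_le (Or.inr ?_)
    rwa [T.step_step ω hω] at h

lemma truncWait_of_success {ω : Ω} (hω : ω ∈ T.reg) (hs : ω ∈ T.success) (K : ℕ) :
    T.truncWait K ω = 0 :=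
  Nat.eq_zero_of_le_zero (Nat.sInf_le (Or.inr (by rwa [T.step_zero ω hω])))

lemma disjoint_fail :
    Pairwise (Function.onFun Disjoint fun j => (⋂ i < j, T.intact (i + 1)) \ T.intact (j + 1)) := by
  have key : ∀ j k, j < k → Disjoint ((⋂ i < j, T.intact (i + 1)) \ T.intact (j + 1))
      ((⋂ i < k, T.intact (i + 1)) \ T.intact (k + 1)) := by
    intro j k hjk
    rw [Set.disjoint_left]
    rintro ω ⟨_, h1⟩ ⟨h2, _⟩
    exact h1 (Set.mem_iInter₂.1 h2 j hjk)
  intro j k hjk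
  rcases lt_or_gt_of_ne hjk with h | h
  · exact key j k h
  · exact (key k j h).symm

lemma exists_fail {ω : Ω} (hω : ω ∈ T.reg) (hs : ω ∉ T.success) :
    ∃ j, ω ∈ (⋂ i < j, T.intact (i + 1)) \ T.intact (j + 1) := by
  classical
  rw [T.success_iff ω hω] at hs
  push Not at hs
  have hs' : ∃ j, ω ∉ T.intact (j + 1) := by
    obtain ⟨n, hn, h⟩ := hs
    exact ⟨n - 1, by rwa [Nat.sub_add_cancel hn]⟩
  refine ⟨Nat.find hs', ?_, Nat.find_spec hs'⟩
  refine Set.mem_iInter₂.2 fun i hi => ?_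
  exact not_not.1 (Nat.find_min hs' hi)

lemma prob_le_one {η : A} (hη : η ∈ T.good) : T.prob ≤ 1 :=
  (T.prob_le η hη).trans measureReal_le_one

/-- The detection events are disjoint, and each of them excludes success. -/
lemma tsum_fail_le {η : A} (hη : η ∈ T.good) :
    ∑' j : ℕ, T.law η ((⋂ i < j, T.intact (i + 1)) \ T.intact (j + 1))
      ≤ ENNReal.ofReal (1 - T.prob) := by
  have hm : ∀ j, MeasurableSet ((⋂ i < j, T.intact (i + 1)) \ T.intact (j + 1)) := fun j =>
    T.hist_le _ _ (T.measurableSet_fail j)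
  rw [← measure_iUnion T.disjoint_fail hm]
  calc T.law η (⋃ j, (⋂ i < j, T.intact (i + 1)) \ T.intact (j + 1))
      ≤ T.law η T.successᶜ := by
        refine measure_mono_ae ?_
        filter_upwards [T.ae_regular hη] with ω hω h
        obtain ⟨j, hj⟩ := Set.mem_iUnion.1 h
        exact fun hs => hj.2 ((T.success_iff ω hω.1).1 hs (j + 1) (by omega))
    _ ≤ ENNReal.ofReal (1 - T.prob) := by
        rw [← ofReal_measureReal, probReal_compl_eq_one_sub T.measurableSet_success]
        exact ENNReal.ofReal_le_ofReal (by linarith [T.prob_le η hη])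

/-- A bound on the `expo`-th moment of the first success time. -/
def waitBound : ℝ := (2 / T.prob) ^ 2 * max T.bound 0

lemma waitBound_nonneg : 0 ≤ T.waitBound := by unfold waitBound; positivity

/-- If failure is detected at `j + 1`, the wait is at most `j + 1` plus the wait of a trajectory
restarted from a good state, and a failure occurs with probability at most `1 - prob`. The supremum
`h` of the moment over good states therefore satisfies a contracting inequality, whose solution does
not involve `K`. -/
lemma lintegral_truncWait_le {η : A} (hη : η ∈ T.good) (K : ℕ) :
    ∫⁻ ω, (T.truncWait K ω : ℝ≥0∞) ^ T.expo ∂(T.law η) ≤ ENNReal.ofReal T.waitBound := by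
  have ha0 : 0 ≤ T.expo := by linarith [T.one_lt_expo]
  set h : ℝ≥0∞ := ⨆ η' ∈ T.good, ∫⁻ ω, (T.truncWait K ω : ℝ≥0∞) ^ T.expo ∂(T.law η') with hh
  -- The truncation is there for this: an inequality of the form `h ≤ A + θ * h` with `θ < 1` bounds
  -- `h` only if `h` is known to be finite.
  have hfin : h ≠ ∞ := by
    refine ne_top_of_le_ne_top (b := (K : ℝ≥0∞) ^ T.expo) (by simp [ha0]) ?_
    refine iSup₂_le fun η' _ => ?_
    calc _ ≤ ∫⁻ ω, (K : ℝ≥0∞) ^ T.expo ∂(T.law η') := by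
          gcongr with ω
          exact_mod_cast T.truncWait_le K ω
      _ = _ := by simp
  have hp0 := T.prob_pos
  have hp1 := T.prob_le_one hη
  -- The weights spend half of the success probability: `(1 - prob) / (1 - prob / 2)` is still below
  -- `1`.
  set l : ℝ≥0∞ := ENNReal.ofReal (T.prob / 2) with hl
  set r : ℝ≥0∞ := ENNReal.ofReal (1 - T.prob / 2) with hr
  have hl0 : l ≠ 0 := by rw [hl]; simp; linarith
  have hr0 : r ≠ 0 := by rw [hr]; simp; linarith
  have hlr : l + r = 1 := by
    rw [hl, hr, ← ENNReal.ofReal_add (by linarith) (by linarith)]; simp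
  have hmeas : Measurable fun ω => (T.truncWait K ω : ℝ≥0∞) ^ T.expo := by
    have := T.measurable_truncWait K
    exact ((measurable_of_countable (fun n : ℕ => (n : ℝ≥0∞))).comp this).pow_const _
  have hrec : ∀ η' ∈ T.good, ∫⁻ ω, (T.truncWait K ω : ℝ≥0∞) ^ T.expo ∂(T.law η')
      ≤ l⁻¹ * ENNReal.ofReal T.bound + r⁻¹ * (h * ENNReal.ofReal (1 - T.prob)) := by
    intro η' hη'
    set F : ℕ → Set Ω := fun j => (⋂ i < j, T.intact (i + 1)) \ T.intact (j + 1) with hF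
    have hFm : ∀ j, MeasurableSet (F j) := fun j => T.hist_le _ _ (T.measurableSet_fail j)
    have hpt : ∀ᵐ ω ∂(T.law η'), (T.truncWait K ω : ℝ≥0∞) ^ T.expo ≤
        ∑' j : ℕ, (F j).indicator (fun ω => l⁻¹ * ((j : ℝ≥0∞) + 1) ^ T.expo
          + r⁻¹ * (T.truncWait K (T.step (j + 1) ω) : ℝ≥0∞) ^ T.expo) ω := by
      filter_upwards [T.ae_regular hη'] with ω hω
      by_cases hs : ω ∈ T.success
      · rw [T.truncWait_of_success hω.1 hs]
        simp [ENNReal.zero_rpow_of_pos (show 0 < T.expo by linarith [T.one_lt_expo])]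
      · obtain ⟨j, hj⟩ := T.exists_fail hω.1 hs
        refine le_trans ?_ (ENNReal.le_tsum j)
        rw [Set.indicator_of_mem (show ω ∈ F j from hj)]
        refine le_trans ?_ (ENNReal.add_rpow_le_of_le_two T.one_lt_expo.le T.expo_le_two hl0 hr0
          hlr _ _)
        gcongr
        exact_mod_cast T.truncWait_le_of_step hω.1 K (j + 1)
    calc _ ≤ ∫⁻ ω, ∑' j : ℕ, (F j).indicator (fun ω => l⁻¹ * ((j : ℝ≥0∞) + 1) ^ T.expo
          + r⁻¹ * (T.truncWait K (T.step (j + 1) ω) : ℝ≥0∞) ^ T.expo) ω ∂(T.law η') :=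
          lintegral_mono_ae hpt
      _ = ∑' j : ℕ, (l⁻¹ * (((j : ℝ≥0∞) + 1) ^ T.expo * T.law η' (F j)) + r⁻¹ *
          ∫⁻ ω in F j, (T.truncWait K (T.step (j + 1) ω) : ℝ≥0∞) ^ T.expo ∂(T.law η')) := by
          rw [lintegral_tsum]
          · congr 1
            ext j
            have hmj : Measurable fun ω =>
                (T.truncWait K (T.step (j + 1) ω) : ℝ≥0∞) ^ T.expo :=
              hmeas.comp (T.measurable_step _)
            rw [lintegral_indicator (hFm j), lintegral_add_left measurable_const,
              lintegral_const, lintegral_const_mul _ hmj,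
              Measure.restrict_apply_univ, mul_assoc]
          · intro j
            exact ((measurable_const.add ((hmeas.comp (T.measurable_step (j + 1))).const_mul
              _)).indicator (hFm j)).aemeasurable
      _ ≤ ∑' j : ℕ, (l⁻¹ * (((j : ℝ≥0∞) + 1) ^ T.expo * T.law η' (F j))
            + r⁻¹ * (h * T.law η' (F j))) := by
          gcongr with j
          rw [T.lintegral_markov hη' (j + 1) (T.measurableSet_fail j) hmeas]
          calc _ ≤ ∫⁻ ω in F j, h ∂(T.law η') := by
                refine lintegral_mono_ae (ae_restrict_of_ae ?_)
                filter_upwards [T.ae_regular hη'] with ω hω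
                exact le_iSup₂ (f := fun η' _ => ∫⁻ ω, (T.truncWait K ω : ℝ≥0∞) ^ T.expo
                  ∂(T.law η')) _ (hω.2 (j + 1)).2
            _ = _ := by rw [lintegral_const, Measure.restrict_apply_univ]
      _ = l⁻¹ * ∑' j : ℕ, (((j : ℝ≥0∞) + 1) ^ T.expo * T.law η' (F j))
            + r⁻¹ * (h * ∑' j : ℕ, T.law η' (F j)) := by
          rw [ENNReal.tsum_add, ENNReal.tsum_mul_left, ENNReal.tsum_mul_left,
            ENNReal.tsum_mul_left]
      _ ≤ _ := by
          gcongr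
          · exact T.moment η' hη'
          · exact T.tsum_fail_le hη'
  have hh' : h ≤ l⁻¹ * ENNReal.ofReal T.bound + r⁻¹ * (h * ENNReal.ofReal (1 - T.prob)) :=
    iSup₂_le hrec
  have hle : ∫⁻ ω, (T.truncWait K ω : ℝ≥0∞) ^ T.expo ∂(T.law η) ≤ h :=
    le_iSup₂ (f := fun η' _ => ∫⁻ ω, (T.truncWait K ω : ℝ≥0∞) ^ T.expo ∂(T.law η')) η hη
  refine hle.trans ?_
  rw [← ENNReal.ofReal_toReal hfin]
  refine ENNReal.ofReal_le_ofReal ?_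
  have hreal : h.toReal ≤ (T.prob / 2)⁻¹ * max T.bound 0
      + (1 - T.prob / 2)⁻¹ * (h.toReal * (1 - T.prob)) := by
    have := ENNReal.toReal_mono (by finiteness) hh'
    rw [ENNReal.toReal_add (by finiteness) (by finiteness), ENNReal.toReal_mul, ENNReal.toReal_mul,
      ENNReal.toReal_mul, ENNReal.toReal_inv, ENNReal.toReal_inv, hl, hr,
      ENNReal.toReal_ofReal' (r := T.bound),
      ENNReal.toReal_ofReal (by linarith : 0 ≤ T.prob / 2),
      ENNReal.toReal_ofReal (by linarith : 0 ≤ 1 - T.prob / 2),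
      ENNReal.toReal_ofReal (by linarith : 0 ≤ 1 - T.prob)] at this
    exact this
  have h0 : 0 ≤ h.toReal := ENNReal.toReal_nonneg
  -- This is `1 - prob ≤ (1 - prob / 2) ^ 2`. It leaves `prob / 2 * h` on the left, hence the factor
  -- `(2 / prob) ^ 2` in `waitBound`.
  have h2 : (1 - T.prob / 2)⁻¹ * (h.toReal * (1 - T.prob)) ≤ (1 - T.prob / 2) * h.toReal := by
    rw [inv_mul_le_iff₀ (by linarith)]
    nlinarith [sq_nonneg T.prob]
  unfold waitBound
  have h3 : (T.prob / 2) * h.toReal ≤ (T.prob / 2)⁻¹ * max T.bound 0 := by linarith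
  calc h.toReal = (2 / T.prob) * ((T.prob / 2) * h.toReal) := by field_simp
    _ ≤ (2 / T.prob) * ((T.prob / 2)⁻¹ * max T.bound 0) := by gcongr
    _ = _ := by field_simp

/-- Without any success the truncated wait equals `K`, so `K` times the probability of this event
stays below a bound independent of `K`. -/
lemma ae_exists_success {η : A} (hη : η ∈ T.good) :
    ∀ᵐ ω ∂(T.law η), ∃ k, T.step k ω ∈ T.success := by
  have hE : MeasurableSet {ω | ∀ k, T.step k ω ∉ T.success} := by
    rw [Set.ofPred_forall]
    exact MeasurableSet.iInter fun k => (T.measurableSet_step_success k).compl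
  have hbound : ∀ K : ℕ, (K : ℝ≥0∞) * T.law η {ω | ∀ k, T.step k ω ∉ T.success}
      ≤ ENNReal.ofReal T.waitBound := by
    intro K
    rcases Nat.eq_zero_or_pos K with rfl | hK
    · simp
    refine le_trans ?_ (T.lintegral_truncWait_le hη K)
    calc _ ≤ ∫⁻ ω in {ω | ∀ k, T.step k ω ∉ T.success}, (K : ℝ≥0∞) ∂(T.law η) := by
          rw [lintegral_const, Measure.restrict_apply_univ]
      _ ≤ ∫⁻ ω in {ω | ∀ k, T.step k ω ∉ T.success}, (T.truncWait K ω : ℝ≥0∞) ^ T.expo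
            ∂(T.law η) := by
          refine setLIntegral_mono' hE fun ω hω => ?_
          have : T.truncWait K ω = K := by
            rcases Nat.sInf_mem (s := {k | k = K ∨ T.step k ω ∈ T.success}) ⟨K, Or.inl rfl⟩
              with h | h
            · exact h
            · exact absurd h (hω _)
          rw [this]
          calc (K : ℝ≥0∞) = (K : ℝ≥0∞) ^ (1 : ℝ) := (ENNReal.rpow_one _).symm
            _ ≤ _ := ENNReal.rpow_le_rpow_of_exponent_le (by exact_mod_cast hK) T.one_lt_expo.le
      _ ≤ _ := setLIntegral_le_lintegral _ _
  have hz : T.law η {ω | ∀ k, T.step k ω ∉ T.success} = 0 := by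
    by_contra hne
    obtain ⟨K, hK⟩ := ENNReal.exists_nat_mul_gt hne
      (ENNReal.ofReal_ne_top (r := T.waitBound))
    exact absurd (hbound K) (not_le.2 hK)
  rw [ae_iff]
  convert hz using 2
  ext ω
  simp

/-- A shifted trajectory has a mixture of laws of good states, so null events for all of those laws
remain null after any shift. -/
lemma ae_step {p : Ω → Prop} (hp : MeasurableSet {ω | p ω})
    (h : ∀ η ∈ T.good, ∀ᵐ ω ∂(T.law η), p ω) {η : A} (hη : η ∈ T.good) :
    ∀ᵐ ω ∂(T.law η), ∀ n, p (T.step n ω) := by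
  rw [ae_all_iff]
  intro n
  rw [ae_iff]
  have := T.markov η hη n Set.univ MeasurableSet.univ _ hp.compl
  rw [Set.univ_inter] at this
  refine this.trans ?_
  rw [setLIntegral_univ, lintegral_eq_zero_iff (T.measurable_law_step n hp.compl)]
  filter_upwards [T.ae_regular hη] with ω hω
  exact h _ (hω.2 n).2

/-- Regular trajectories with infinitely many successes. -/
def Recurrent (ω : Ω) : Prop := T.Regular ω ∧ ∀ n, ∃ k, n ≤ k ∧ T.step k ω ∈ T.success

lemma ae_recurrent {η : A} (hη : η ∈ T.good) : ∀ᵐ ω ∂(T.law η), T.Recurrent ω := by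
  have hm : MeasurableSet {ω | ∃ k, T.step k ω ∈ T.success} := by
    rw [Set.ofPred_exists]
    exact MeasurableSet.iUnion fun k => T.measurableSet_step_success k
  filter_upwards [T.ae_regular hη, T.ae_step hm (fun η hη => T.ae_exists_success hη) hη]
    with ω h1 h2
  refine ⟨h1, fun n => ?_⟩
  obtain ⟨k, hk⟩ := h2 n
  exact ⟨n + k, by omega, by rwa [T.step_step ω h1.1] at hk⟩

variable {T}

lemma Recurrent.step {ω : Ω} (h : T.Recurrent ω) (j : ℕ) : T.Recurrent (T.step j ω) := by
  refine ⟨h.1.step j, fun n => ?_⟩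
  obtain ⟨k, hk, hs⟩ := h.2 (j + n)
  refine ⟨k - j, by omega, ?_⟩
  rw [T.step_step ω h.1.1, Nat.add_sub_cancel' (by omega)]
  exact hs

lemma Recurrent.next_spec {ω : Ω} (h : T.Recurrent ω) (k₀ : ℕ) :
    k₀ ≤ T.next k₀ ω ∧ T.renew k₀ ω ∈ T.success :=
  Nat.sInf_mem (s := {k | k₀ ≤ k ∧ T.step k ω ∈ T.success}) (h.2 k₀)

lemma Recurrent.renew {ω : Ω} (h : T.Recurrent ω) (k₀ : ℕ) : T.Recurrent (T.renew k₀ ω) :=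
  h.step _

lemma Recurrent.next_eq {ω : Ω} (h : T.Recurrent ω) (k₀ : ℕ) :
    T.next k₀ ω = k₀ + T.wait (T.step k₀ ω) := by
  have hw : T.step (T.wait (T.step k₀ ω)) (T.step k₀ ω) ∈ T.success := by
    obtain ⟨k, -, hk⟩ := (h.step k₀).2 0
    exact Nat.sInf_mem (s := {k | T.step k (T.step k₀ ω) ∈ T.success}) ⟨k, hk⟩
  rw [T.step_step ω h.1.1] at hw
  refine le_antisymm (Nat.sInf_le ⟨by omega, hw⟩) ?_
  obtain ⟨h1, h2⟩ := h.next_spec k₀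
  have : T.wait (T.step k₀ ω) ≤ T.next k₀ ω - k₀ := by
    refine Nat.sInf_le ?_
    rw [Set.mem_ofPred_eq, T.step_step ω h.1.1, Nat.add_sub_cancel' h1]
    exact h2
  omega

variable (T)

/-- Fatou's lemma as the truncation level tends to infinity. -/
lemma lintegral_wait_le {η : A} (hη : η ∈ T.good) :
    ∫⁻ ω, (T.wait ω : ℝ≥0∞) ^ T.expo ∂(T.law η) ≤ ENNReal.ofReal T.waitBound := by
  have hmeas : ∀ K, Measurable fun ω => (T.truncWait K ω : ℝ≥0∞) ^ T.expo := fun K =>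
    ((measurable_of_countable (fun n : ℕ => (n : ℝ≥0∞))).comp (T.measurable_truncWait K)).pow_const _
  calc _ ≤ ∫⁻ ω, liminf (fun K => (T.truncWait K ω : ℝ≥0∞) ^ T.expo) atTop ∂(T.law η) := by
        refine lintegral_mono_ae ?_
        filter_upwards [T.ae_recurrent hη] with ω hω
        obtain ⟨k, -, hk⟩ := hω.2 0
        refine le_liminf_of_le (by isBoundedDefault) ?_
        filter_upwards [eventually_ge_atTop k] with K hK
        refine ENNReal.rpow_le_rpow ?_ (by linarith [T.one_lt_expo])
        refine Nat.cast_le.2 ?_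
        rcases Nat.sInf_mem (s := {k | k = K ∨ T.step k ω ∈ T.success}) ⟨K, Or.inl rfl⟩
          with h | h
        · have h1 : T.truncWait K ω = K := h
          rw [h1]
          exact (Nat.sInf_le (s := {k | T.step k ω ∈ T.success}) hk).trans hK
        · exact Nat.sInf_le (s := {k | T.step k ω ∈ T.success}) h
    _ ≤ liminf (fun K => ∫⁻ ω, (T.truncWait K ω : ℝ≥0∞) ^ T.expo ∂(T.law η)) atTop :=
        lintegral_liminf_le hmeas
    _ ≤ _ := by
        refine liminf_le_of_le (by isBoundedDefault) fun b hb => ?_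
        obtain ⟨K, hK⟩ := hb.exists
        exact hK.trans (T.lintegral_truncWait_le hη K)

/-- The excess over `k₀` is the first success time of the trajectory shifted by `k₀`, which starts
from a good state. The bound is thus free of `k₀`, and that makes the delays negligible relative to
`k₀`. -/
lemma lintegral_next_sub_le {η : A} (hη : η ∈ T.good) (k₀ : ℕ) :
    ∫⁻ ω, ((T.next k₀ ω - k₀ : ℕ) : ℝ≥0∞) ^ T.expo ∂(T.law η) ≤ ENNReal.ofReal T.waitBound := by
  have hmeas : Measurable fun ω => (T.wait ω : ℝ≥0∞) ^ T.expo :=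
    ((measurable_of_countable (fun n : ℕ => (n : ℝ≥0∞))).comp T.measurable_wait).pow_const _
  calc _ = ∫⁻ ω, (T.wait (T.step k₀ ω) : ℝ≥0∞) ^ T.expo ∂(T.law η) := by
        refine lintegral_congr_ae ?_
        filter_upwards [T.ae_recurrent hη] with ω hω
        rw [hω.next_eq, Nat.add_sub_cancel_left]
    _ = ∫⁻ ω, ∫⁻ ω', (T.wait ω' : ℝ≥0∞) ^ T.expo ∂(T.law (T.state (T.step k₀ ω)))
          ∂(T.law η) := by
        simpa using T.lintegral_markov hη k₀ (B := Set.univ) MeasurableSet.univ hmeas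
    _ ≤ ∫⁻ ω, ENNReal.ofReal T.waitBound ∂(T.law η) := by
        refine lintegral_mono_ae ?_
        filter_upwards [T.ae_regular hη] with ω hω
        exact T.lintegral_wait_le (hω.2 k₀).2
    _ = _ := by simp

/-- The history event that, together with the success of the trial started at `n`, says that the
initial trial is successful and that `next k₀ = n`. -/
def nextEvent (k₀ n : ℕ) : Set Ω :=
  T.intact n ∩ ⋂ j, ⋂ (_ : k₀ ≤ j ∧ j < n), T.step j ⁻¹' (T.intact (n - j))ᶜ

lemma measurableSet_nextEvent {k₀ n : ℕ} (hn : 1 ≤ n) :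
    MeasurableSet[T.hist n] (T.nextEvent k₀ n) := by
  refine MeasurableSet.inter (m := T.hist n) (T.measurableSet_intact n hn) ?_
  refine MeasurableSet.iInter (m := T.hist n) fun j =>
    MeasurableSet.iInter (m := T.hist n) fun hj => ?_
  have h1 := T.measurableSet_intact (n - j) (by omega)
  have h2 := (T.measurable_step_hist j (n - j)) (MeasurableSet.compl (m := T.hist (n - j)) h1)
  rwa [Nat.add_sub_cancel' hj.2.le] at h2

/-- When the trial at `n` succeeds, `glue` turns the success or failure of every earlier trial into
a statement about the history at `n`. The two sides then compare the same information. -/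
lemma mem_nextEvent_iff {ω : Ω} (hω : T.Recurrent ω) {k₀ n : ℕ} (hk : 1 ≤ k₀) (hn : k₀ ≤ n) :
    (ω ∈ T.nextEvent k₀ n ∧ T.step n ω ∈ T.success) ↔ (ω ∈ T.success ∧ T.next k₀ ω = n) := by
  have hglue : T.step n ω ∈ T.success → ∀ j < n,
      (T.step j ω ∈ T.success ↔ T.step j ω ∈ T.intact (n - j)) := by
    intro hs j hj
    refine T.glue _ (hω.1.2 j).1 (n - j) (by omega) ?_
    rwa [T.step_step ω hω.1.1, Nat.add_sub_cancel' hj.le]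
  constructor
  · rintro ⟨⟨h1, h2⟩, hs⟩
    refine ⟨(T.glue ω hω.1.1 n (by omega) hs).2 h1, ?_⟩
    refine le_antisymm (Nat.sInf_le ⟨hn, hs⟩) ?_
    by_contra hlt
    push Not at hlt
    obtain ⟨h3, h4⟩ := hω.next_spec k₀
    exact Set.mem_iInter₂.1 h2 (T.next k₀ ω) ⟨h3, hlt⟩ ((hglue hs _ hlt).1 h4)
  · rintro ⟨h1, rfl⟩
    obtain ⟨h3, h4⟩ := hω.next_spec k₀
    refine ⟨⟨(T.glue ω hω.1.1 _ (by omega) h4).1 h1, ?_⟩, h4⟩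
    refine Set.mem_iInter₂.2 fun j hj hmem => ?_
    exact absurd (Nat.sInf_le (s := {k | k₀ ≤ k ∧ T.step k ω ∈ T.success})
      ⟨hj.1, (hglue h4 j hj.2).2 hmem⟩) (not_le.2 hj.2)

lemma success_eq_iUnion (k₀ : ℕ) :
    T.success = ⋃ n, (T.success ∩ {ω | T.next k₀ ω = n}) := by
  ext ω; simp

/-- On each value `n` of `next k₀`, the conditioning is a history event followed by a success at
`n`, so the Markov property at `n` applies. A moment bound given success therefore survives a
renewal with the same constant. The requirement `1 ≤ k₀` ensures `1 ≤ n`, where `intact n` is a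
history event. -/
lemma lintegral_renew_le {η : A} (hη : η ∈ T.good) {k₀ : ℕ} (hk : 1 ≤ k₀) {X : Ω → ℝ≥0∞}
    (hX : Measurable X) {c : ℝ≥0∞}
    (h : ∀ η' ∈ T.good, ∫⁻ ω in T.success, X ω ∂(T.law η') ≤ c * T.law η' T.success) :
    ∫⁻ ω in T.success, X (T.renew k₀ ω) ∂(T.law η) ≤ c * T.law η T.success := by
  have hnm : ∀ n, MeasurableSet (T.success ∩ {ω | T.next k₀ ω = n}) := fun n =>
    T.measurableSet_success.inter (T.measurable_next k₀ (measurableSet_singleton n))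
  have hdisj : Pairwise (Function.onFun Disjoint fun n => T.success ∩ {ω | T.next k₀ ω = n}) := by
    intro i j hij
    rw [Function.onFun, Set.disjoint_left]
    rintro ω ⟨_, h1⟩ ⟨_, h2⟩
    exact hij (h1.symm.trans h2)
  conv_lhs => rw [T.success_eq_iUnion k₀]
  conv_rhs => rw [T.success_eq_iUnion k₀]
  rw [lintegral_iUnion hnm hdisj, measure_iUnion hdisj hnm, ← ENNReal.tsum_mul_left]
  refine ENNReal.tsum_le_tsum fun n => ?_
  by_cases hn : k₀ ≤ n
  · have hB := T.measurableSet_nextEvent (k₀ := k₀) (n := n) (by omega)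
    have hae : (T.success ∩ {ω | T.next k₀ ω = n} : Set Ω) =ᵐ[T.law η]
        (T.nextEvent k₀ n ∩ T.step n ⁻¹' T.success : Set Ω) := by
      filter_upwards [T.ae_recurrent hη] with ω hω
      exact propext (T.mem_nextEvent_iff hω hk hn).symm
    have hG : Measurable (T.success.indicator X) := hX.indicator T.measurableSet_success
    calc ∫⁻ ω in T.success ∩ {ω | T.next k₀ ω = n}, X (T.renew k₀ ω) ∂(T.law η)
        = ∫⁻ ω in T.success ∩ {ω | T.next k₀ ω = n}, X (T.step n ω) ∂(T.law η) := by
          refine setLIntegral_congr_fun (hnm n) fun ω hω => ?_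
          simp only [renew]
          rw [hω.2]
      _ = ∫⁻ ω in T.nextEvent k₀ n ∩ T.step n ⁻¹' T.success, X (T.step n ω) ∂(T.law η) :=
          setLIntegral_congr hae
      _ = ∫⁻ ω in T.nextEvent k₀ n, T.success.indicator X (T.step n ω) ∂(T.law η) := by
          rw [Set.inter_comm, ← Measure.restrict_restrict
            (T.measurable_step n T.measurableSet_success),
            ← lintegral_indicator (T.measurable_step n T.measurableSet_success)]
          rfl
      _ = ∫⁻ ω in T.nextEvent k₀ n, ∫⁻ ω' in T.success, X ω' ∂(T.law (T.state (T.step n ω)))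
            ∂(T.law η) := by
          rw [T.lintegral_markov hη n hB hG]
          simp_rw [lintegral_indicator T.measurableSet_success]
      _ ≤ ∫⁻ ω in T.nextEvent k₀ n, c * T.law (T.state (T.step n ω)) T.success ∂(T.law η) := by
          refine lintegral_mono_ae (ae_restrict_of_ae ?_)
          filter_upwards [T.ae_regular hη] with ω hω
          exact h _ (hω.2 n).2
      _ = c * T.law η (T.success ∩ {ω | T.next k₀ ω = n}) := by
          rw [lintegral_const_mul _ (T.measurable_law_step n T.measurableSet_success),
            ← T.markov η hη n _ hB _ T.measurableSet_success, measure_congr hae]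
  · have : T.law η (T.success ∩ {ω | T.next k₀ ω = n}) = 0 := by
      rw [measure_eq_zero_iff_ae_notMem]
      filter_upwards [T.ae_recurrent hη] with ω hω h2
      exact hn (h2.2 ▸ (hω.next_spec k₀).1)
    rw [setLIntegral_measure_zero _ _ this]
    exact zero_le

/-- Functions of the history up to the random time `next k₀`. -/
def PreRenewal (k₀ : ℕ) (φ : Ω → ℝ) : Prop :=
  ∀ n, ∃ φn : Ω → ℝ, Measurable[T.hist n] φn ∧ ∀ ω, T.next k₀ ω = n → φ ω = φn ω

/-- The same splitting over the values of `next k₀` shows that what is known before a renewal is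
orthogonal to any observable of the renewed trajectory that is centred given success. -/
lemma integral_mul_renew_eq_zero {η : A} (hη : η ∈ T.good) {k₀ : ℕ} (hk : 1 ≤ k₀)
    {φ X : Ω → ℝ} (hφ : T.PreRenewal k₀ φ) (hφm : Measurable φ) {b c : ℝ}
    (hφb : ∀ ω, |φ ω| ≤ b) (hX : Measurable X) (hXc : ∀ ω, |X ω| ≤ c)
    (hzero : ∀ η' ∈ T.good, ∫ ω in T.success, X ω ∂(T.law η') = 0) :
    ∫ ω in T.success, φ ω * X (T.renew k₀ ω) ∂(T.law η) = 0 := by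
  have hnm : ∀ n, MeasurableSet (T.success ∩ {ω | T.next k₀ ω = n}) := fun n =>
    T.measurableSet_success.inter (T.measurable_next k₀ (measurableSet_singleton n))
  have hdisj : Pairwise (Function.onFun Disjoint fun n => T.success ∩ {ω | T.next k₀ ω = n}) := by
    intro i j hij
    rw [Function.onFun, Set.disjoint_left]
    rintro ω ⟨_, h1⟩ ⟨_, h2⟩
    exact hij (h1.symm.trans h2)
  have hint : Integrable (fun ω => φ ω * X (T.renew k₀ ω)) (T.law η) := by
    refine Integrable.of_bound (hφm.mul (hX.comp (T.measurable_renew k₀))).aestronglyMeasurable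
      (b * c) (Eventually.of_forall fun ω => ?_)
    rw [norm_mul]
    exact mul_le_mul (hφb ω) (hXc _) (abs_nonneg _) ((abs_nonneg _).trans (hφb ω))
  conv_lhs => rw [T.success_eq_iUnion k₀]
  rw [integral_iUnion hnm hdisj hint.integrableOn]
  refine (tsum_congr fun n => ?_).trans tsum_zero
  by_cases hn : k₀ ≤ n
  · have hB := T.measurableSet_nextEvent (k₀ := k₀) (n := n) (by omega)
    obtain ⟨φn, hφn, hφeq⟩ := hφ n
    have hG : Measurable (T.success.indicator X) := hX.indicator T.measurableSet_success
    -- The representative `φn` agrees with `φ` only where `next k₀ = n` and may be unbounded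
    -- elsewhere; clamping to `[-b, b]` makes it bounded without changing it there.
    have hclamp : Measurable[T.hist n] ((T.nextEvent k₀ n).indicator
        fun ω => max (-b) (min b (φn ω))) := by
      refine Measurable.indicator ?_ hB
      exact Measurable.max measurable_const (Measurable.min measurable_const hφn)
    rw [← integral_indicator (hnm n)]
    refine Eq.trans (integral_congr_ae ?_) (T.integral_mul_step_eq_zero hη n hclamp
      (b := max b 0) (c := max c 0) (fun ω => ?_) hG (fun ω => ?_) fun η' hη' => ?_)
    · filter_upwards [T.ae_recurrent hη] with ω hω
      have hiff := T.mem_nextEvent_iff hω hk hn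
      by_cases hmem : ω ∈ T.success ∧ T.next k₀ ω = n
      · obtain ⟨h1, h2⟩ := hiff.2 hmem
        rw [Set.indicator_of_mem (show ω ∈ T.success ∩ {ω | T.next k₀ ω = n} from hmem),
          Set.indicator_of_mem h1, Set.indicator_of_mem h2, renew, hmem.2, ← hφeq ω hmem.2]
        have := abs_le.1 (hφb ω)
        rw [min_eq_right this.2, max_eq_right this.1]
      · rw [Set.indicator_of_notMem (show ω ∉ T.success ∩ {ω | T.next k₀ ω = n} from hmem)]
        by_cases h1 : ω ∈ T.nextEvent k₀ n
        · rw [Set.indicator_of_notMem (fun h2 => hmem (hiff.1 ⟨h1, h2⟩)), mul_zero]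
        · rw [Set.indicator_of_notMem h1, zero_mul]
    · by_cases h1 : ω ∈ T.nextEvent k₀ n
      · have hb : 0 ≤ b := (abs_nonneg _).trans (hφb ω)
        rw [Set.indicator_of_mem h1, max_eq_left hb]
        exact abs_le.2 ⟨le_max_left _ _, max_le (by linarith) (min_le_left _ _)⟩
      · rw [Set.indicator_of_notMem h1]; simp
    · by_cases h1 : ω ∈ T.success
      · rw [Set.indicator_of_mem h1]; exact (hXc ω).trans (le_max_left _ _)
      · rw [Set.indicator_of_notMem h1]; simp
    · rw [integral_indicator T.measurableSet_success]; exact hzero η' hη'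
  · refine setIntegral_measure_zero _ ?_
    rw [measure_eq_zero_iff_ae_notMem]
    filter_upwards [T.ae_recurrent hη] with ω hω h2
    exact hn (h2.2 ▸ (hω.next_spec k₀).1)

end TrialSystem
end RWDRE
end

/-! ### Laws of large numbers for rewards and delays -/

noncomputable section

namespace RWDRE

namespace TrialSystem

variable {A Ω : Type*} [MeasurableSpace A] [mΩ : MeasurableSpace Ω] (T : TrialSystem A Ω)

/-- The mean of `f` under `law η` conditioned on success. -/
def mean (f : Ω → ℝ) (η : A) : ℝ :=
  (∫ ω in T.success, f ω ∂(T.law η)) / (T.law η).real T.success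

/-- `f` minus its conditional mean given the initial state. -/
def centered (f : Ω → ℝ) (ω : Ω) : ℝ := f ω - T.mean f (T.state ω)

lemma measurable_mean {f : Ω → ℝ} (hf : Measurable f) : Measurable (T.mean f) := by
  refine Measurable.div ?_ ?_
  · simp_rw [← integral_indicator T.measurableSet_success]
    exact ((hf.indicator T.measurableSet_success).stronglyMeasurable.integral_kernel).measurable
  · exact (Kernel.measurable_coe _ T.measurableSet_success).ennreal_toReal

lemma success_pos {η : A} (hη : η ∈ T.good) : 0 < (T.law η).real T.success :=
  T.prob_pos.trans_le (T.prob_le η hη)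

lemma abs_mean_le {f : Ω → ℝ} {b : ℝ} (hb : ∀ ω, |f ω| ≤ b) (η : A) : |T.mean f η| ≤ b := by
  have hb0 : 0 ≤ b := by
    by_cases h : Nonempty Ω
    · exact (abs_nonneg _).trans (hb h.some)
    · have : T.law η Set.univ = 1 := measure_univ
      have h0 : (Set.univ : Set Ω) = ∅ := by
        ext ω; exact absurd ⟨ω⟩ h
      rw [h0] at this
      simp at this
  unfold mean
  rw [abs_div, abs_of_nonneg (measureReal_nonneg (μ := T.law η) (s := T.success))]
  refine div_le_of_le_mul₀ measureReal_nonneg hb0 ?_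
  exact norm_setIntegral_le_of_norm_le_const (f := f) (measure_lt_top (T.law η) _)
    fun ω _ => hb ω

lemma mean_mul {η : A} (hη : η ∈ T.good) (f : Ω → ℝ) :
    T.mean f η * (T.law η).real T.success = ∫ ω in T.success, f ω ∂(T.law η) :=
  div_mul_cancel₀ _ (T.success_pos hη).ne'

variable {f : Ω → ℝ} {b : ℝ}

lemma measurable_centered (hf : Measurable f) : Measurable (T.centered f) :=
  hf.sub ((T.measurable_mean hf).comp T.measurable_state')

lemma abs_centered_le (hb : ∀ ω, |f ω| ≤ b) (ω : Ω) : |T.centered f ω| ≤ 2 * b := by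
  have h1 := abs_le.1 (hb ω)
  have h2 := abs_le.1 (T.abs_mean_le hb (T.state ω))
  unfold centered
  exact abs_le.2 ⟨by linarith, by linarith⟩

/-- The subtracted mean depends on the initial state only, which every history contains. -/
lemma preRenewal_centered {k₀ : ℕ} (hf : Measurable f) (hp : T.PreRenewal k₀ f) :
    T.PreRenewal k₀ (T.centered f) := by
  intro n
  obtain ⟨fn, hfn, h⟩ := hp n
  have hs : Measurable[T.hist n] T.state :=
    T.measurable_state.mono (T.hist_mono (Nat.zero_le n)) le_rfl
  refine ⟨fun ω => fn ω - T.mean f (T.state ω), ?_, fun ω hω => by rw [centered, h ω hω]⟩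
  exact Measurable.sub hfn ((T.measurable_mean hf).comp hs)

lemma measurable_birkhoffSum {k₀ : ℕ} {g : Ω → ℝ} (hg : Measurable g) (n : ℕ) :
    Measurable (birkhoffSum (T.renew k₀) g n) := by
  unfold birkhoffSum
  exact Finset.measurable_sum _ fun i _ => hg.comp ((T.measurable_renew k₀).iterate i)

lemma abs_birkhoffSum_le {Ω : Type*} {Θ : Ω → Ω} {g : Ω → ℝ} {c : ℝ} (hc : ∀ ω, |g ω| ≤ c)
    (n : ℕ) (ω : Ω) : |birkhoffSum Θ g n ω| ≤ n * c := by
  unfold birkhoffSum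
  refine (Finset.abs_sum_le_sum_abs _ _).trans ?_
  refine (Finset.sum_le_sum fun i _ => hc _).trans ?_
  simp

lemma integrable_of_abs_le {g : Ω → ℝ} (hg : Measurable g) {c : ℝ} (hc : ∀ ω, |g ω| ≤ c)
    (P : Measure Ω) [IsFiniteMeasure P] : Integrable g P :=
  Integrable.of_bound hg.aestronglyMeasurable c (Eventually.of_forall hc)

lemma setIntegral_mean_state {η : A} (hη : η ∈ T.good) (f : Ω → ℝ) :
    ∫ ω in T.success, T.mean f (T.state ω) ∂(T.law η) = ∫ ω in T.success, f ω ∂(T.law η) := by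
  have : ∫ ω in T.success, T.mean f (T.state ω) ∂(T.law η)
      = ∫ ω in T.success, T.mean f η ∂(T.law η) := by
    refine integral_congr_ae (ae_restrict_of_ae ?_)
    filter_upwards [T.ae_state η hη] with ω hω
    rw [hω]
  rw [this, setIntegral_const, smul_eq_mul, mul_comm, T.mean_mul hη]

lemma integral_centered {η : A} (hη : η ∈ T.good) (hf : Measurable f) (hb : ∀ ω, |f ω| ≤ b) :
    ∫ ω in T.success, T.centered f ω ∂(T.law η) = 0 := by
  unfold centered
  rw [integral_sub (integrable_of_abs_le hf hb _), T.setIntegral_mean_state hη, sub_self]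
  exact integrable_of_abs_le ((T.measurable_mean hf).comp T.measurable_state')
    (fun ω => T.abs_mean_le hb _) _

lemma integral_centered_sq_le {η : A} (hη : η ∈ T.good) (hf : Measurable f)
    (hb : ∀ ω, |f ω| ≤ b) :
    ∫ ω in T.success, T.centered f ω ^ 2 ∂(T.law η) ≤ ∫ ω in T.success, f ω ^ 2 ∂(T.law η) := by
  have h1 : ∫ ω in T.success, T.centered f ω ^ 2 ∂(T.law η)
      = ∫ ω in T.success, (f ω ^ 2 - 2 * T.mean f η * f ω + T.mean f η ^ 2) ∂(T.law η) := by
    refine integral_congr_ae (ae_restrict_of_ae ?_)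
    filter_upwards [T.ae_state η hη] with ω hω
    rw [centered, hω]; ring
  have hi1 : Integrable (fun ω => f ω ^ 2) ((T.law η).restrict T.success) :=
    integrable_of_abs_le (hf.pow_const 2) (c := b ^ 2) (fun ω => by
      rw [abs_pow]; exact pow_le_pow_left₀ (abs_nonneg _) (hb ω) 2) _
  have hi2 : Integrable (fun ω => 2 * T.mean f η * f ω) ((T.law η).restrict T.success) :=
    (integrable_of_abs_le hf hb _).const_mul _
  have hi12 : Integrable (fun ω => f ω ^ 2 - 2 * T.mean f η * f ω)
      ((T.law η).restrict T.success) := hi1.sub hi2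
  rw [h1, integral_add hi12 (integrable_const _), integral_sub hi1 hi2,
    integral_const_mul, ← T.mean_mul hη f, setIntegral_const, smul_eq_mul]
  nlinarith [mul_nonneg (sq_nonneg (T.mean f η)) (T.success_pos hη).le]

/-- Split off the first term: the sum of length `n + 1` is `centered f` plus the sum of length `n`
of the renewed trajectory. The latter is centred given success, uniformly over good states, so the
cross term vanishes and second moments add up. Both claims must be carried through the induction
together, since centredness is what kills the cross term. -/
lemma birkhoffSum_centered {k₀ : ℕ} (hk : 1 ≤ k₀) (hf : Measurable f) (hb : ∀ ω, |f ω| ≤ b)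
    (hp : T.PreRenewal k₀ f) {V : ℝ} (hV : 0 ≤ V)
    (hsq : ∀ η ∈ T.good, ∫ ω in T.success, f ω ^ 2 ∂(T.law η) ≤ V * (T.law η).real T.success)
    (n : ℕ) : ∀ η ∈ T.good,
    ∫ ω in T.success, birkhoffSum (T.renew k₀) (T.centered f) n ω ∂(T.law η) = 0 ∧
    ∫ ω in T.success, birkhoffSum (T.renew k₀) (T.centered f) n ω ^ 2 ∂(T.law η)
      ≤ n * V * (T.law η).real T.success := by
  induction n with
  | zero => intro η hη; simp
  | succ n ih =>
    intro η hη
    set u := birkhoffSum (T.renew k₀) (T.centered f) n with hu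
    have hum : Measurable u := T.measurable_birkhoffSum (T.measurable_centered hf) n
    have hub : ∀ ω, |u ω| ≤ n * (2 * b) := abs_birkhoffSum_le (T.abs_centered_le hb) n
    have hΘm : Measurable fun ω => u (T.renew k₀ ω) := hum.comp (T.measurable_renew k₀)
    have hDm := T.measurable_centered hf
    have hDi : Integrable (T.centered f) ((T.law η).restrict T.success) :=
      integrable_of_abs_le hDm (T.abs_centered_le hb) _
    have hui : Integrable (fun ω => u (T.renew k₀ ω)) ((T.law η).restrict T.success) :=
      integrable_of_abs_le hΘm (fun ω => hub _) _
    have hD2 : Integrable (fun ω => T.centered f ω ^ 2) ((T.law η).restrict T.success) :=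
      integrable_of_abs_le (hDm.pow_const 2) (c := (2 * b) ^ 2) (fun ω => by
        rw [abs_pow]; exact pow_le_pow_left₀ (abs_nonneg _) (T.abs_centered_le hb ω) 2) _
    have hu2 : Integrable (fun ω => u (T.renew k₀ ω) ^ 2) ((T.law η).restrict T.success) :=
      integrable_of_abs_le (hΘm.pow_const 2) (c := (n * (2 * b)) ^ 2) (fun ω => by
        rw [abs_pow]; exact pow_le_pow_left₀ (abs_nonneg _) (hub _) 2) _
    have hDu : Integrable (fun ω => T.centered f ω * u (T.renew k₀ ω))
        ((T.law η).restrict T.success) :=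
      integrable_of_abs_le (hDm.mul hΘm) (c := (2 * b) * (n * (2 * b))) (fun ω => by
        rw [Pi.mul_apply, abs_mul]
        exact mul_le_mul (T.abs_centered_le hb ω) (hub _) (abs_nonneg _)
          ((abs_nonneg _).trans (T.abs_centered_le hb ω))) _
    have hzero : ∫ ω in T.success, u (T.renew k₀ ω) ∂(T.law η) = 0 := by
      have := T.integral_mul_renew_eq_zero hη hk (φ := fun _ => 1)
        (fun n => ⟨fun _ => 1, measurable_const, fun _ _ => rfl⟩) measurable_const (b := 1)
        (by simp) hum hub (fun η' hη' => (ih η' hη').1)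
      simpa using this
    have hcross : ∫ ω in T.success, T.centered f ω * u (T.renew k₀ ω) ∂(T.law η) = 0 :=
      T.integral_mul_renew_eq_zero hη hk (T.preRenewal_centered hf hp) hDm
        (T.abs_centered_le hb) hum hub (fun η' hη' => (ih η' hη').1)
    have hsqΘ : ∫ ω in T.success, u (T.renew k₀ ω) ^ 2 ∂(T.law η)
        ≤ n * V * (T.law η).real T.success := by
      have hX : Measurable fun ω => ENNReal.ofReal (u ω ^ 2) := (hum.pow_const 2).ennreal_ofReal
      have hu2' : ∀ η' : A, Integrable (fun ω => u ω ^ 2) ((T.law η').restrict T.success) :=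
        fun η' => integrable_of_abs_le (hum.pow_const 2) (c := (n * (2 * b)) ^ 2) (fun ω => by
          rw [abs_pow]; exact pow_le_pow_left₀ (abs_nonneg _) (hub _) 2) _
      have h := T.lintegral_renew_le hη hk hX (c := ENNReal.ofReal (n * V)) (fun η' hη' => by
        rw [← ofReal_integral_eq_lintegral_ofReal (hu2' η')
          (Eventually.of_forall fun ω => sq_nonneg _), ← ofReal_measureReal,
          ← ENNReal.ofReal_mul (by positivity)]
        exact ENNReal.ofReal_le_ofReal (ih η' hη').2)
      rw [← ofReal_integral_eq_lintegral_ofReal hu2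
          (Eventually.of_forall fun ω => sq_nonneg _), ← ofReal_measureReal,
          ← ENNReal.ofReal_mul (by positivity)] at h
      exact (ENNReal.ofReal_le_ofReal_iff (by positivity)).1 h
    constructor
    · simp_rw [birkhoffSum_succ']
      rw [integral_add hDi hui, T.integral_centered hη hf hb, hzero, add_zero]
    · simp_rw [birkhoffSum_succ']
      have hexp : ∀ ω, (T.centered f ω + u (T.renew k₀ ω)) ^ 2 = T.centered f ω ^ 2
          + 2 * (T.centered f ω * u (T.renew k₀ ω)) + u (T.renew k₀ ω) ^ 2 := fun ω => by ring
      simp_rw [← hu, hexp]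
      have hDDu : Integrable (fun ω => T.centered f ω ^ 2
          + 2 * (T.centered f ω * u (T.renew k₀ ω))) ((T.law η).restrict T.success) :=
        hD2.add (hDu.const_mul 2)
      rw [integral_add hDDu hu2, integral_add hD2 (hDu.const_mul 2),
        integral_const_mul, hcross]
      have := T.integral_centered_sq_le hη hf hb
      have := hsq η hη
      push_cast
      linarith

lemma measure_birkhoffSum_le {η : A} (hη : η ∈ T.good) {k₀ : ℕ} (hk : 1 ≤ k₀) (hf : Measurable f)
    (hb : ∀ ω, |f ω| ≤ b) (hp : T.PreRenewal k₀ f) {V : ℝ} (hV : 0 ≤ V)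
    (hsq : ∀ η ∈ T.good, ∫ ω in T.success, f ω ^ 2 ∂(T.law η) ≤ V * (T.law η).real T.success)
    {n : ℕ} (hn : 1 ≤ n) {δ : ℝ} (hδ : 0 < δ) :
    T.law η (T.success ∩ {ω | δ * n ≤ |birkhoffSum (T.renew k₀) (T.centered f) n ω|})
      ≤ ENNReal.ofReal (V / (δ ^ 2 * n)) := by
  set u := birkhoffSum (T.renew k₀) (T.centered f) n with hu
  have hum : Measurable u := T.measurable_birkhoffSum (T.measurable_centered hf) n
  have hub : ∀ ω, |u ω| ≤ n * (2 * b) := abs_birkhoffSum_le (T.abs_centered_le hb) n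
  have hu2 : Integrable (fun ω => u ω ^ 2) ((T.law η).restrict T.success) :=
    integrable_of_abs_le (hum.pow_const 2) (c := (n * (2 * b)) ^ 2) (fun ω => by
      rw [abs_pow]; exact pow_le_pow_left₀ (abs_nonneg _) (hub _) 2) _
  have hn0 : (0 : ℝ) < n := by exact_mod_cast hn
  have h1 := mul_meas_ge_le_integral_of_nonneg (Eventually.of_forall fun ω => sq_nonneg (u ω)) hu2
    ((δ * n) ^ 2)
  have h2 := (T.birkhoffSum_centered hk hf hb hp hV hsq n η hη).2
  have hset : {ω | (δ * n) ^ 2 ≤ u ω ^ 2} = {ω | δ * n ≤ |u ω|} := by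
    ext ω
    simp only [Set.mem_ofPred_eq]
    rw [← sq_abs (u ω)]
    exact pow_le_pow_iff_left₀ (by positivity) (abs_nonneg _) two_ne_zero
  have hm : MeasurableSet {ω | δ * n ≤ |u ω|} := measurableSet_le measurable_const hum.abs
  rw [hset, measureReal_restrict_apply hm, Set.inter_comm] at h1
  rw [← ofReal_measureReal]
  refine ENNReal.ofReal_le_ofReal ?_
  rw [le_div_iff₀ (by positivity)]
  have h3 : (n : ℝ) * V * (T.law η).real T.success ≤ n * V :=
    mul_le_of_le_one_right (by positivity) measureReal_le_one
  have h4 : (T.law η).real (T.success ∩ {ω | δ * n ≤ |u ω|}) * (δ ^ 2 * n) * n ≤ V * n := by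
    calc _ = (δ * n) ^ 2 * (T.law η).real (T.success ∩ {ω | δ * n ≤ |u ω|}) := by ring
      _ ≤ _ := by linarith
  exact le_of_mul_le_mul_right h4 hn0

end TrialSystem

/-- A sequence with bounded increments that is `o(n)` along the squares is `o(n)`. -/
lemma eventually_abs_le_of_squares {s : ℕ → ℝ} {c δ : ℝ} (hc : ∀ n, |s (n + 1) - s n| ≤ c)
    (hδ : 0 < δ) (h : ∀ᶠ j : ℕ in atTop, |s (j ^ 2)| ≤ δ * (j ^ 2 : ℕ)) :
    ∀ᶠ n : ℕ in atTop, |s n| ≤ 2 * δ * n := by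
  have hc0 : 0 ≤ c := (abs_nonneg _).trans (hc 0)
  have hinc : ∀ k n, |s (n + k) - s n| ≤ k * c := by
    intro k n
    induction k with
    | zero => simp
    | succ k ih =>
      have := hc (n + k)
      calc |s (n + (k + 1)) - s n| = |(s (n + k + 1) - s (n + k)) + (s (n + k) - s n)| := by
            congr 1; rw [add_assoc]; ring
        _ ≤ c + k * c := (abs_add_le _ _).trans (add_le_add this ih)
        _ = _ := by push_cast; ring
  have h2 : ∀ᶠ j : ℕ in atTop, 2 * c / δ ≤ (j : ℝ) :=
    tendsto_natCast_atTop_atTop.eventually_ge_atTop _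
  have hsq : Tendsto Nat.sqrt atTop atTop := by
    refine tendsto_atTop.2 fun b => ?_
    filter_upwards [eventually_ge_atTop (b * b)] with n hn
    exact Nat.le_sqrt.2 hn
  filter_upwards [hsq.eventually h, hsq.eventually h2] with n h3 h4
  have h5 := Nat.sqrt_le_add n
  have h6 := Nat.sqrt_le n
  set j := Nat.sqrt n
  have h7 := hinc (n - j ^ 2) (j ^ 2)
  rw [Nat.add_sub_cancel' (by rw [pow_two]; exact h6)] at h7
  have h8 : ((n - j ^ 2 : ℕ) : ℝ) ≤ 2 * j := by
    have : n - j ^ 2 ≤ 2 * j := by rw [pow_two]; omega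
    exact_mod_cast this
  have h9 : ((j ^ 2 : ℕ) : ℝ) ≤ n := by rw [pow_two]; exact_mod_cast h6
  have h10 : ((n - j ^ 2 : ℕ) : ℝ) * c ≤ 2 * j * c := by gcongr
  have h11 : 2 * j * c ≤ δ * (j ^ 2 : ℕ) := by
    rw [div_le_iff₀ hδ] at h4
    push_cast
    nlinarith [Nat.cast_nonneg (α := ℝ) j]
  have h12 : δ * (j ^ 2 : ℕ) ≤ δ * n := by gcongr
  calc |s n| = |(s n - s (j ^ 2)) + s (j ^ 2)| := by congr 1; ring
    _ ≤ |s n - s (j ^ 2)| + |s (j ^ 2)| := abs_add_le _ _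
    _ ≤ 2 * δ * n := by linarith

namespace TrialSystem

variable {A Ω : Type*} [MeasurableSpace A] [mΩ : MeasurableSpace Ω] (T : TrialSystem A Ω)
variable {f : Ω → ℝ} {b : ℝ}

variable {T} in
lemma Recurrent.iterate {ω : Ω} (h : T.Recurrent ω) (k₀ n : ℕ) :
    T.Recurrent ((T.renew k₀)^[n] ω) := by
  induction n with
  | zero => exact h
  | succ n ih => rw [Function.iterate_succ_apply']; exact ih.renew k₀

/-- A strong law of large numbers, up to the oscillation `ε` of the conditional means. -/
lemma ae_birkhoffSum_near {η : A} (hη : η ∈ T.good) {k₀ : ℕ} (hk : 1 ≤ k₀) (hf : Measurable f)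
    (hb : ∀ ω, |f ω| ≤ b) (hp : T.PreRenewal k₀ f) {c ε : ℝ}
    (hmean : ∀ η ∈ T.good, |T.mean f η - c| ≤ ε) {δ : ℝ} (hδ : 0 < δ) :
    ∀ᵐ ω ∂(T.law η), ω ∈ T.success →
      ∀ᶠ n : ℕ in atTop, |birkhoffSum (T.renew k₀) f n ω - n * c| ≤ (ε + δ) * n := by
  -- For a bounded reward the crude second moment `b ^ 2` suffices: Chebyshev's bound at the squares
  -- is then summable, and bounded increments fill the gaps.
  have hsq : ∀ η ∈ T.good,
      ∫ ω in T.success, f ω ^ 2 ∂(T.law η) ≤ b ^ 2 * (T.law η).real T.success := by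
    intro η _
    refine (le_abs_self _).trans (norm_setIntegral_le_of_norm_le_const (f := fun ω => f ω ^ 2)
      (measure_lt_top (T.law η) _) fun ω _ => ?_)
    rw [norm_pow]
    exact pow_le_pow_left₀ (norm_nonneg _) (hb ω) 2
  have hsum : ∑' j : ℕ, T.law η (T.success ∩
      {ω | δ / 2 * ((j + 1) ^ 2 : ℕ) ≤
        |birkhoffSum (T.renew k₀) (T.centered f) ((j + 1) ^ 2) ω|}) ≠ ∞ := by
    refine ne_top_of_le_ne_top ?_ (ENNReal.tsum_le_tsum fun j =>
      T.measure_birkhoffSum_le hη hk hf hb hp (sq_nonneg b) hsq (Nat.one_le_pow _ _ (by omega))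
        (half_pos hδ))
    have hs : Summable fun j : ℕ => b ^ 2 / ((δ / 2) ^ 2 * (((j + 1) ^ 2 : ℕ) : ℝ)) := by
      have h1 : Summable fun j : ℕ => 1 / ((j : ℝ) ^ 2) :=
        Real.summable_one_div_nat_pow.2 (by norm_num)
      have h2 := ((summable_nat_add_iff 1).2 h1).mul_left (b ^ 2 / (δ / 2) ^ 2)
      refine h2.congr fun j => ?_
      push_cast
      field_simp
    rw [← ENNReal.ofReal_tsum_of_nonneg (fun j => by positivity) hs]
    exact ENNReal.ofReal_ne_top
  filter_upwards [ae_eventually_notMem hsum, T.ae_recurrent hη] with ω h1 h2 hs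
  have h3 : ∀ᶠ j : ℕ in atTop,
      |birkhoffSum (T.renew k₀) (T.centered f) (j ^ 2) ω| ≤ δ / 2 * (j ^ 2 : ℕ) := by
    filter_upwards [(tendsto_sub_atTop_nat 1).eventually h1, eventually_ge_atTop 1] with j hj hj1
    rw [Nat.sub_add_cancel hj1] at hj
    by_contra hcon
    exact hj ⟨hs, (not_le.1 hcon).le⟩
  have h4 := eventually_abs_le_of_squares
    (s := fun n => birkhoffSum (T.renew k₀) (T.centered f) n ω) (c := 2 * b) (fun n => by
    simp only [birkhoffSum_succ, add_sub_cancel_left]; exact T.abs_centered_le hb _) (half_pos hδ) h3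
  filter_upwards [h4] with n hn
  -- A centred sum, which is `o(n)`, plus the deviations from `c` of the conditional means at the
  -- renewal states, each at most `ε`.
  have h5 : birkhoffSum (T.renew k₀) f n ω - n * c
      = birkhoffSum (T.renew k₀) (T.centered f) n ω
        + ∑ k ∈ Finset.range n, (T.mean f (T.state ((T.renew k₀)^[k] ω)) - c) := by
    simp only [birkhoffSum, centered, Finset.sum_sub_distrib, Finset.sum_const, Finset.card_range,
      nsmul_eq_mul]
    ring
  have h6 : |∑ k ∈ Finset.range n, (T.mean f (T.state ((T.renew k₀)^[k] ω)) - c)| ≤ n * ε := by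
    refine (Finset.abs_sum_le_sum_abs _ _).trans ?_
    refine (Finset.sum_le_sum fun k _ => hmean _ (h2.iterate k₀ k).1.state_mem).trans ?_
    simp
  rw [h5]
  refine (abs_add_le _ _).trans ?_
  linarith

/-- The time wasted after `k₀` before the next success. -/
def delay (k₀ : ℕ) (ω : Ω) : ℝ := ((T.next k₀ ω - k₀ : ℕ) : ℝ)

lemma measurable_delay (k₀ : ℕ) : Measurable (T.delay k₀) :=
  (measurable_of_countable fun n : ℕ => ((n - k₀ : ℕ) : ℝ)).comp (T.measurable_next k₀)

lemma delay_nonneg (k₀ : ℕ) (ω : Ω) : 0 ≤ T.delay k₀ ω := Nat.cast_nonneg _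

lemma delay_le_rpow (k₀ : ℕ) (ω : Ω) : T.delay k₀ ω ≤ T.delay k₀ ω ^ T.expo := by
  unfold delay
  rcases Nat.eq_zero_or_pos (T.next k₀ ω - k₀) with h | h
  · rw [h, Nat.cast_zero]; exact Real.zero_rpow_nonneg _
  · calc _ = ((T.next k₀ ω - k₀ : ℕ) : ℝ) ^ (1 : ℝ) := (Real.rpow_one _).symm
      _ ≤ _ := Real.rpow_le_rpow_of_exponent_le (by exact_mod_cast h) T.one_lt_expo.le

/-- Dividing by `prob` puts the moment in the form relative to the success probability that is
preserved by renewals. -/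
lemma lintegral_delay_le {η : A} (hη : η ∈ T.good) (k₀ : ℕ) :
    ∫⁻ ω in T.success, ENNReal.ofReal (T.delay k₀ ω ^ T.expo) ∂(T.law η)
      ≤ ENNReal.ofReal (T.waitBound / T.prob) * T.law η T.success := by
  have h1 : ∀ ω, ENNReal.ofReal (T.delay k₀ ω ^ T.expo)
      = ((T.next k₀ ω - k₀ : ℕ) : ℝ≥0∞) ^ T.expo := by
    intro ω
    rw [← ENNReal.ofReal_rpow_of_nonneg (T.delay_nonneg k₀ ω) (by linarith [T.one_lt_expo]), delay,
      ENNReal.ofReal_natCast]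
  simp_rw [h1]
  refine (setLIntegral_le_lintegral _ _).trans ((T.lintegral_next_sub_le hη k₀).trans ?_)
  rw [← ofReal_measureReal, ← ENNReal.ofReal_mul
    (div_nonneg T.waitBound_nonneg T.prob_pos.le)]
  refine ENNReal.ofReal_le_ofReal ?_
  rw [div_mul_eq_mul_div, le_div_iff₀ T.prob_pos]
  exact mul_le_mul_of_nonneg_left (T.prob_le η hη) T.waitBound_nonneg

lemma lintegral_iterate_renew_le {k₀ : ℕ} (hk : 1 ≤ k₀) {X : Ω → ℝ≥0∞} (hX : Measurable X)
    {c : ℝ≥0∞}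
    (h : ∀ η' ∈ T.good, ∫⁻ ω in T.success, X ω ∂(T.law η') ≤ c * T.law η' T.success) (n : ℕ) :
    ∀ η ∈ T.good, ∫⁻ ω in T.success, X ((T.renew k₀)^[n] ω) ∂(T.law η)
      ≤ c * T.law η T.success := by
  induction n with
  | zero => exact h
  | succ n ih =>
    intro η hη
    simp_rw [Function.iterate_succ_apply]
    exact T.lintegral_renew_le hη hk (hX.comp ((T.measurable_renew k₀).iterate n)) ih

lemma preRenewal_next {k₀ : ℕ} (F : ℕ → ℝ) : T.PreRenewal k₀ fun ω => F (T.next k₀ ω) :=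
  fun n => ⟨fun _ => F n, measurable_const, fun ω hω => by simp only [hω]⟩

/-- Truncate the delays at `n`. The truncated second moment is at most `n ^ (2 - expo)` times the
moment constant, so Chebyshev's inequality gives order `n ^ (1 - expo)`; a union bound over the `n`
delays for exceeding `n` has the same order. The truncated conditional means contribute at most `C *
n`, and the deviation allowed to the centred part contributes the extra `n`. -/
lemma measure_sum_delay_le {η : A} (hη : η ∈ T.good) {k₀ : ℕ} (hk : 1 ≤ k₀) {n : ℕ} (hn : 1 ≤ n) :
    T.law η (T.success ∩ {ω | (T.waitBound / T.prob + 1) * n <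
        birkhoffSum (T.renew k₀) (T.delay k₀) n ω})
      ≤ ENNReal.ofReal (2 * (T.waitBound / T.prob) * (n : ℝ) ^ (1 - T.expo)) := by
  have hn0 : (0 : ℝ) < n := by exact_mod_cast hn
  have ha := T.one_lt_expo
  have ha2 := T.expo_le_two
  set C := T.waitBound / T.prob with hC
  have hC0 : 0 ≤ C := div_nonneg T.waitBound_nonneg T.prob_pos.le
  have hdm := T.measurable_delay k₀
  set f : Ω → ℝ := fun ω => min (T.delay k₀ ω) n with hf
  have hfm : Measurable f := hdm.min measurable_const
  have hf0 : ∀ ω, 0 ≤ f ω := fun ω => le_min (T.delay_nonneg k₀ ω) hn0.le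
  have hfb : ∀ ω, |f ω| ≤ n := fun ω => by rw [abs_of_nonneg (hf0 ω)]; exact min_le_right _ _
  have hfp : T.PreRenewal k₀ f := T.preRenewal_next fun k => min ((k - k₀ : ℕ) : ℝ) n
  -- integrals against the delay moment
  have hint : ∀ (g : Ω → ℝ) (s : ℝ), Measurable g → 0 ≤ s → (∀ ω, 0 ≤ g ω) → (∃ c, ∀ ω, |g ω| ≤ c) →
      (∀ ω, g ω ≤ s * T.delay k₀ ω ^ T.expo) → ∀ η' ∈ T.good,
      ∫ ω in T.success, g ω ∂(T.law η') ≤ s * C * (T.law η').real T.success := by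
    intro g s hg hs hg0 hgb hle η' hη'
    obtain ⟨c, hc⟩ := hgb
    have h1 : ∫⁻ ω in T.success, ENNReal.ofReal (g ω) ∂(T.law η')
        ≤ ENNReal.ofReal s * (ENNReal.ofReal C * T.law η' T.success) := by
      calc _ ≤ ∫⁻ ω in T.success, ENNReal.ofReal s * ENNReal.ofReal (T.delay k₀ ω ^ T.expo)
            ∂(T.law η') := by
            refine lintegral_mono fun ω => ?_
            rw [← ENNReal.ofReal_mul hs]
            exact ENNReal.ofReal_le_ofReal (hle ω)
        _ = ENNReal.ofReal s * ∫⁻ ω in T.success, ENNReal.ofReal (T.delay k₀ ω ^ T.expo)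
            ∂(T.law η') := lintegral_const_mul _ (hdm.pow_const _).ennreal_ofReal
        _ ≤ _ := by gcongr; exact T.lintegral_delay_le hη' k₀
    rw [← ofReal_integral_eq_lintegral_ofReal (integrable_of_abs_le hg hc _)
      (Eventually.of_forall hg0), ← ofReal_measureReal, ← ENNReal.ofReal_mul hC0,
      ← ENNReal.ofReal_mul hs, ← mul_assoc] at h1
    exact (ENNReal.ofReal_le_ofReal_iff
      (mul_nonneg (mul_nonneg hs hC0) measureReal_nonneg)).1 h1
  have hmean : ∀ η' ∈ T.good, T.mean f η' ≤ C := by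
    intro η' hη'
    rw [mean, div_le_iff₀ (T.success_pos hη')]
    have := hint f 1 hfm zero_le_one hf0 ⟨n, hfb⟩ (fun ω => by
      rw [one_mul]; exact (min_le_left _ _).trans (T.delay_le_rpow k₀ ω)) η' hη'
    rwa [one_mul] at this
  have hsq : ∀ η' ∈ T.good, ∫ ω in T.success, f ω ^ 2 ∂(T.law η')
      ≤ (n : ℝ) ^ (2 - T.expo) * C * (T.law η').real T.success := by
    refine hint (fun ω => f ω ^ 2) _ (hfm.pow_const 2) (by positivity) (fun ω => sq_nonneg _)
      ⟨n ^ 2, fun ω => by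
        rw [abs_pow]; exact pow_le_pow_left₀ (abs_nonneg _) (hfb ω) 2⟩ fun ω => ?_
    calc f ω ^ 2 = f ω ^ (2 - T.expo) * f ω ^ T.expo := by
          rw [← Real.rpow_add_of_nonneg (hf0 ω) (by linarith) (by linarith),
            sub_add_cancel, Real.rpow_two]
      _ ≤ _ := by
          refine mul_le_mul (Real.rpow_le_rpow (hf0 ω) (min_le_right _ _) (by linarith))
            (Real.rpow_le_rpow (hf0 ω) (min_le_left _ _) (by linarith))
            (Real.rpow_nonneg (hf0 ω) _) (by positivity)
  have hcheb := T.measure_birkhoffSum_le hη hk hfm hfb hfp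
    (V := (n : ℝ) ^ (2 - T.expo) * C) (by positivity) hsq hn one_pos
  have hlarge : ∀ k, T.law η (T.success ∩ {ω | (n : ℝ) < T.delay k₀ ((T.renew k₀)^[k] ω)})
      ≤ ENNReal.ofReal (C * (n : ℝ) ^ (-T.expo)) := by
    intro k
    have hX : Measurable fun ω => ENNReal.ofReal (T.delay k₀ ω ^ T.expo) :=
      (hdm.pow_const _).ennreal_ofReal
    have h1 := T.lintegral_iterate_renew_le hk hX
      (fun η' hη' => T.lintegral_delay_le hη' k₀) k η hη
    have hiter := (T.measurable_renew k₀).iterate k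
    have hm : MeasurableSet {ω | (n : ℝ) < T.delay k₀ ((T.renew k₀)^[k] ω)} :=
      measurableSet_lt measurable_const (hdm.comp hiter)
    have h2 := meas_ge_le_lintegral_div (μ := (T.law η).restrict T.success)
      (hX.comp hiter).aemeasurable (ε := ENNReal.ofReal ((n : ℝ) ^ T.expo))
      (by simp only [ne_eq, ENNReal.ofReal_eq_zero, not_le]; positivity) ENNReal.ofReal_ne_top
    calc _ = (T.law η).restrict T.success {ω | (n : ℝ) < T.delay k₀ ((T.renew k₀)^[k] ω)} := by
          rw [Measure.restrict_apply hm, Set.inter_comm]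
      _ ≤ (T.law η).restrict T.success {ω | ENNReal.ofReal ((n : ℝ) ^ T.expo) ≤
            ENNReal.ofReal (T.delay k₀ ((T.renew k₀)^[k] ω) ^ T.expo)} := by
          refine measure_mono fun ω hω => ?_
          exact ENNReal.ofReal_le_ofReal
            (Real.rpow_le_rpow hn0.le (le_of_lt hω) (by linarith))
      _ ≤ (ENNReal.ofReal C * T.law η T.success) / ENNReal.ofReal ((n : ℝ) ^ T.expo) :=
          h2.trans (ENNReal.div_le_div_right h1 _)
      _ ≤ ENNReal.ofReal C / ENNReal.ofReal ((n : ℝ) ^ T.expo) := by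
          refine ENNReal.div_le_div_right (mul_le_of_le_one_right (by simp) MeasureTheory.prob_le_one) _
      _ = _ := by
          rw [← ENNReal.ofReal_div_of_pos (by positivity), Real.rpow_neg hn0.le, div_eq_mul_inv]
  have hsub : T.law η (T.success ∩ {ω | (C + 1) * n < birkhoffSum (T.renew k₀) (T.delay k₀) n ω})
      ≤ T.law η ((T.success ∩
          {ω | 1 * (n : ℝ) ≤ |birkhoffSum (T.renew k₀) (T.centered f) n ω|}) ∪
        ⋃ k ∈ Finset.range n,
          (T.success ∩ {ω | (n : ℝ) < T.delay k₀ ((T.renew k₀)^[k] ω)})) := by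
    refine measure_mono_ae ?_
    filter_upwards [T.ae_recurrent hη] with ω hω hmem
    obtain ⟨hs, hlt⟩ := hmem
    by_contra hcon
    have hcon1 : ω ∉ T.success ∩
        {ω | 1 * (n : ℝ) ≤ |birkhoffSum (T.renew k₀) (T.centered f) n ω|} :=
      fun h => hcon (Or.inl h)
    have hcon2 : ∀ k ∈ Finset.range n, T.delay k₀ ((T.renew k₀)^[k] ω) ≤ n := by
      intro k hk'
      by_contra h
      exact hcon (Or.inr (Set.mem_iUnion₂.2 ⟨k, hk', hs, not_le.1 h⟩))
    have h1 : |birkhoffSum (T.renew k₀) (T.centered f) n ω| < n := by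
      by_contra h
      exact hcon1 ⟨hs, by rw [Set.mem_ofPred_eq, one_mul]; exact not_lt.1 h⟩
    have h2 : birkhoffSum (T.renew k₀) (T.delay k₀) n ω
        = birkhoffSum (T.renew k₀) (T.centered f) n ω
          + ∑ k ∈ Finset.range n, T.mean f (T.state ((T.renew k₀)^[k] ω)) := by
      simp only [birkhoffSum, centered, Finset.sum_sub_distrib, sub_add_cancel]
      refine Finset.sum_congr rfl fun k hk' => ?_
      exact (min_eq_left (hcon2 k hk')).symm
    have h3 : ∑ k ∈ Finset.range n, T.mean f (T.state ((T.renew k₀)^[k] ω)) ≤ n * C := by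
      refine (Finset.sum_le_sum fun k _ => hmean _ (hω.iterate k₀ k).1.state_mem).trans ?_
      simp
    have hlt' : (C + 1) * n < birkhoffSum (T.renew k₀) (T.delay k₀) n ω := hlt
    have := (abs_lt.1 h1).2
    linarith
  refine hsub.trans ((measure_union_le _ _).trans ?_)
  have hpow1 : (n : ℝ) ^ (2 - T.expo) * C / (1 ^ 2 * n) = C * (n : ℝ) ^ (1 - T.expo) := by
    rw [show (2 - T.expo) = (1 - T.expo) + 1 by ring, Real.rpow_add_one hn0.ne']
    field_simp
  have hpow2 : (n : ℝ) * (C * (n : ℝ) ^ (-T.expo)) = C * (n : ℝ) ^ (1 - T.expo) := by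
    rw [show (1 - T.expo) = -T.expo + 1 by ring, Real.rpow_add_one hn0.ne']
    ring
  calc _ ≤ ENNReal.ofReal ((n : ℝ) ^ (2 - T.expo) * C / (1 ^ 2 * n))
        + ∑ k ∈ Finset.range n, ENNReal.ofReal (C * (n : ℝ) ^ (-T.expo)) :=
        add_le_add hcheb ((measure_biUnion_finset_le _ _).trans
          (Finset.sum_le_sum fun k _ => hlarge k))
    _ = ENNReal.ofReal (C * (n : ℝ) ^ (1 - T.expo))
        + ENNReal.ofReal (C * (n : ℝ) ^ (1 - T.expo)) := by
        rw [hpow1, Finset.sum_const, Finset.card_range, nsmul_eq_mul, ← ENNReal.ofReal_natCast,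
          ← ENNReal.ofReal_mul hn0.le, hpow2]
    _ = _ := by
        rw [← ENNReal.ofReal_add (by positivity) (by positivity)]
        congr 1; ring

/-- The delays grow at most linearly, at a rate that does not depend on `k₀`. -/
lemma ae_sum_delay_le {η : A} (hη : η ∈ T.good) {k₀ : ℕ} (hk : 1 ≤ k₀) :
    ∀ᵐ ω ∂(T.law η), ω ∈ T.success → ∀ᶠ n : ℕ in atTop,
      birkhoffSum (T.renew k₀) (T.delay k₀) n ω ≤ 2 * (T.waitBound / T.prob + 1) * n := by
  set C := T.waitBound / T.prob with hC
  have hC0 : 0 ≤ C := div_nonneg T.waitBound_nonneg T.prob_pos.le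
  -- The exponent `1 - expo` may be close to zero, so summability is sought along powers of two.
  -- Monotonicity of the partial sums fills the gaps at the cost of a factor `2`.
  have hsum : ∑' j : ℕ, T.law η (T.success ∩ {ω | (C + 1) * (2 ^ j : ℕ) <
      birkhoffSum (T.renew k₀) (T.delay k₀) (2 ^ j) ω}) ≠ ∞ := by
    refine ne_top_of_le_ne_top ?_ (ENNReal.tsum_le_tsum fun j =>
      T.measure_sum_delay_le hη hk (Nat.one_le_two_pow))
    have hs : Summable fun j : ℕ => 2 * C * (((2 ^ j : ℕ) : ℝ)) ^ (1 - T.expo) := by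
      have h1 : Summable fun j : ℕ => ((2 : ℝ) ^ (1 - T.expo)) ^ j :=
        summable_geometric_of_lt_one (by positivity)
          (Real.rpow_lt_one_of_one_lt_of_neg (by norm_num) (by linarith [T.one_lt_expo]))
      refine (h1.mul_left (2 * C)).congr fun j => ?_
      push_cast
      rw [← Real.rpow_natCast, ← Real.rpow_natCast, ← Real.rpow_mul (by norm_num),
        ← Real.rpow_mul (by norm_num), mul_comm (j : ℝ)]
    rw [← ENNReal.ofReal_tsum_of_nonneg (fun j => by positivity) hs]
    exact ENNReal.ofReal_ne_top
  filter_upwards [ae_eventually_notMem hsum] with ω h1 hs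
  have hmono : Monotone fun n => birkhoffSum (T.renew k₀) (T.delay k₀) n ω :=
    monotone_nat_of_le_succ fun n => by
      rw [birkhoffSum_succ]; linarith [T.delay_nonneg k₀ ((T.renew k₀)^[n] ω)]
  have hlog : Tendsto (fun n => Nat.log 2 n + 1) atTop atTop := by
    refine tendsto_atTop.2 fun b => ?_
    filter_upwards [eventually_ge_atTop (2 ^ b)] with n hn
    exact (Nat.le_log_of_pow_le (by norm_num) hn).trans (Nat.le_succ _)
  filter_upwards [hlog.eventually h1, eventually_ge_atTop 1] with n hn hn1
  have h2 : birkhoffSum (T.renew k₀) (T.delay k₀) (2 ^ (Nat.log 2 n + 1)) ω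
      ≤ (C + 1) * (2 ^ (Nat.log 2 n + 1) : ℕ) := by
    by_contra h
    exact hn ⟨hs, not_le.1 h⟩
  have h3 : n ≤ 2 ^ (Nat.log 2 n + 1) := (Nat.lt_pow_succ_log_self (by norm_num) n).le
  have h4 : ((2 ^ (Nat.log 2 n + 1) : ℕ) : ℝ) ≤ 2 * n := by
    have : 2 ^ (Nat.log 2 n + 1) ≤ 2 * n := by
      rw [pow_succ, mul_comm]
      exact Nat.mul_le_mul_left 2 (Nat.pow_log_le_self 2 (by omega))
    exact_mod_cast this
  calc _ ≤ _ := hmono h3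
    _ ≤ (C + 1) * (2 ^ (Nat.log 2 n + 1) : ℕ) := h2
    _ ≤ (C + 1) * (2 * n) := by gcongr
    _ = _ := by ring

end TrialSystem
end RWDRE
end

/-! ### From sums over cycles to the speed of the path -/

noncomputable section

namespace RWDRE

/-- Truncation of a real number to `[-b, b]`. -/
def clamp (b x : ℝ) : ℝ := max (-b) (min b x)

lemma abs_clamp_le {b : ℝ} (hb : 0 ≤ b) (x : ℝ) : |clamp b x| ≤ b :=
  abs_le.2 ⟨le_max_left _ _, max_le (by linarith) (min_le_left _ _)⟩

lemma clamp_eq_self {b x : ℝ} (h : |x| ≤ b) : clamp b x = x := by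
  have := abs_le.1 h
  rw [clamp, min_eq_right this.2, max_eq_right this.1]

lemma measurable_clamp (b : ℝ) : Measurable (clamp b) :=
  measurable_const.max (measurable_const.min measurable_id)

/-- A path with renewal times `len * ∑ N k`, Lipschitz after each of them, has an almost constant
speed `c` if the normalized short increments average to `c` and the long gaps are rare. -/
lemma path_speed {z : ℝ≥0 → ℝ} {N : ℕ → ℕ} {Δ g : ℕ → ℝ} {len k₀ : ℕ} {m C ε c : ℝ}
    (hlen : 1 ≤ len) (hk : 1 ≤ k₀) (hm : 0 ≤ m) (hC : 0 ≤ C) (hc : |c| ≤ 2 * m)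
    (hN : ∀ k, k₀ ≤ N k) (hε : 0 ≤ ε)
    (hz : ∀ n, ∀ s : ℝ≥0,
      |z ((len * ∑ k ∈ Finset.range n, N k : ℕ) + s) - ∑ k ∈ Finset.range n, Δ k| ≤ m * s)
    (hΔ : ∀ k, |Δ k| ≤ m * (len * N k))
    (hg : ∀ k, g k = if N k ≤ 2 * k₀ then Δ k / (k₀ * len) else 0)
    (hdelay : ∀ᶠ n : ℕ in atTop, ∑ k ∈ Finset.range n, ((N k - k₀ : ℕ) : ℝ) ≤ C * n)
    (hmean : ∀ᶠ n : ℕ in atTop, |∑ k ∈ Finset.range n, g k - n * c| ≤ ε * n)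
    {δ : ℝ} (hδ : 0 < δ) :
    ∀ᶠ t : ℝ≥0 in atTop, |z t - c * t| ≤ (ε + 5 * m * C / k₀ + δ) * t := by
  obtain ⟨n₀, hn₀⟩ := eventually_atTop.1 (hdelay.and hmean)
  set τ : ℕ → ℕ := fun n => ∑ k ∈ Finset.range n, N k with hτ
  have hτmono : Monotone τ := monotone_nat_of_le_succ fun n => by
    simp only [hτ, Finset.sum_range_succ]; omega
  have hτge : ∀ n, n * k₀ ≤ τ n := fun n => by
    simp only [hτ]
    calc n * k₀ = ∑ k ∈ Finset.range n, k₀ := by simp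
      _ ≤ _ := Finset.sum_le_sum fun k _ => hN k
  have hk0 : (0 : ℝ) < k₀ := by exact_mod_cast hk
  have hl0 : (0 : ℝ) < len := by exact_mod_cast hlen
  have hlarge : ∀ᶠ t : ℝ≥0 in atTop, 3 * m * (k₀ * len + len * C) / δ ≤ (t : ℝ) :=
    (NNReal.tendsto_coe_atTop.2 tendsto_id).eventually_ge_atTop _
  filter_upwards [hlarge, eventually_ge_atTop ((len * τ n₀ : ℕ) : ℝ≥0)] with t ht1 ht2
  have hex : ∃ n, t < ((len * τ (n + 1) : ℕ) : ℝ≥0) := by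
    obtain ⟨n, hn⟩ := exists_nat_gt t
    refine ⟨n, hn.trans_le ?_⟩
    have h1 : n ≤ len * τ (n + 1) := by
      calc n ≤ (n + 1) * k₀ := by nlinarith
        _ ≤ τ (n + 1) := hτge _
        _ ≤ _ := Nat.le_mul_of_pos_left _ hlen
    exact_mod_cast h1
  classical
  -- The number of cycles completed by time `t`.
  set n := Nat.find hex with hn
  have hlt := Nat.find_spec hex
  rw [← hn] at hlt
  have hge : ((len * τ n : ℕ) : ℝ≥0) ≤ t := by
    rcases Nat.eq_zero_or_pos n with h0 | h0
    · rw [h0]; simp [hτ]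
    · have := Nat.find_min hex (m := n - 1) (by omega)
      rw [Nat.sub_add_cancel h0] at this
      exact not_lt.1 this
  have hnn : n₀ ≤ n := by
    by_contra h
    push Not at h
    have h1 : ((len * τ (n + 1) : ℕ) : ℝ≥0) ≤ ((len * τ n₀ : ℕ) : ℝ≥0) :=
      Nat.cast_le.2 (Nat.mul_le_mul_left _ (hτmono h))
    exact absurd (hlt.trans_le (h1.trans ht2)) (lt_irrefl _)
  obtain ⟨hd1, hm1⟩ := hn₀ n hnn
  obtain ⟨hd2, -⟩ := hn₀ (n + 1) (by omega)
  obtain ⟨s, hs⟩ := exists_add_of_le hge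
  have hsum : ∀ j, ((τ j : ℕ) : ℝ) = j * k₀ + ∑ k ∈ Finset.range j, ((N k - k₀ : ℕ) : ℝ) := by
    intro j
    simp only [hτ]
    push_cast
    rw [← nsmul_eq_mul, ← Finset.card_range j, ← Finset.sum_const, Finset.card_range,
      ← Finset.sum_add_distrib]
    refine Finset.sum_congr rfl fun k _ => ?_
    rw [Nat.cast_sub (hN k)]; ring
  have hsr : (t : ℝ) = len * τ n + s := by
    rw [hs]; push_cast; rfl
  have hltr : (t : ℝ) < len * τ (n + 1) := by exact_mod_cast hlt
  have hH0 : 0 ≤ ∑ k ∈ Finset.range n, ((N k - k₀ : ℕ) : ℝ) :=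
    Finset.sum_nonneg fun k _ => Nat.cast_nonneg _
  rw [hsum] at hltr
  have hn1 : (((n + 1 : ℕ)) : ℝ) = n + 1 := by push_cast; ring
  rw [hn1] at hltr hd2
  set H := ∑ k ∈ Finset.range n, ((N k - k₀ : ℕ) : ℝ) with hH
  -- The part of `[0, t]` not accounted for by `n` cycles of nominal length `k₀ * len`: the delays
  -- so far and the current incomplete cycle.
  set e : ℝ := t - k₀ * len * n with he
  have hs0 : (0 : ℝ) ≤ s := s.2
  have he1 : e ≤ k₀ * len + len * (C * (n + 1)) := by
    have := mul_le_mul_of_nonneg_left hd2 hl0.le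
    rw [he]; nlinarith
  have hse : (s : ℝ) ≤ e := by
    rw [he, hsr, hsum]
    nlinarith [mul_nonneg hl0.le hH0]
  have he0 : 0 ≤ e := hs0.trans hse
  have hz1 := hz n s
  rw [← hs] at hz1
  -- Only cycles with `N k > 2 * k₀` differ. For those `N k ≤ 2 * (N k - k₀)`, so the discarded
  -- displacement is charged to the delays.
  have hshort : |∑ k ∈ Finset.range n, Δ k - k₀ * len * ∑ k ∈ Finset.range n, g k|
      ≤ 2 * m * len * H := by
    rw [Finset.mul_sum, ← Finset.sum_sub_distrib, hH, Finset.mul_sum]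
    refine (Finset.abs_sum_le_sum_abs _ _).trans (Finset.sum_le_sum fun k _ => ?_)
    rw [hg]
    split_ifs with h
    · rw [mul_div_cancel₀ _ (by positivity), sub_self, abs_zero]
      positivity
    · rw [mul_zero, sub_zero]
      refine (hΔ k).trans ?_
      have h1 : (N k : ℝ) ≤ 2 * ((N k - k₀ : ℕ) : ℝ) := by
        have : N k ≤ 2 * (N k - k₀) := by omega
        exact_mod_cast this
      calc m * (len * N k) ≤ m * (len * (2 * ((N k - k₀ : ℕ) : ℝ))) := by gcongr
        _ = _ := by ring
  -- The terms linear in the delays have coefficients `m`, `2 * m` and `2 * m`, whence the `5 * m *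
  -- C / k₀` in the conclusion.
  have hmain : |z t - c * t| ≤ m * s + 2 * m * len * H + k₀ * len * (ε * n) + 2 * m * e := by
    have hdec : z t - c * t = (z t - ∑ k ∈ Finset.range n, Δ k)
        + (∑ k ∈ Finset.range n, Δ k - k₀ * len * ∑ k ∈ Finset.range n, g k)
        + k₀ * len * (∑ k ∈ Finset.range n, g k - n * c) - c * e := by
      rw [he]; ring
    have h1 : |k₀ * len * (∑ k ∈ Finset.range n, g k - n * c)| ≤ k₀ * len * (ε * n) := by
      rw [abs_mul, abs_of_pos (by positivity)]
      gcongr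
    have h2 : |c * e| ≤ 2 * m * e := by
      rw [abs_mul, abs_of_nonneg he0]
      gcongr
    rw [hdec]
    refine (abs_sub _ _).trans (add_le_add ((abs_add_le _ _).trans (add_le_add
      ((abs_add_le _ _).trans (add_le_add hz1 hshort)) h1)) h2)
  have hkt : k₀ * len * n ≤ (t : ℝ) := by linarith
  have h3 : 3 * m * (k₀ * len + len * C) ≤ δ * t := by
    rw [div_le_iff₀ hδ] at ht1; linarith
  have h4 : 5 * m * (len * C * n) ≤ 5 * m * C / k₀ * t := by
    calc 5 * m * (len * C * n) = 5 * m * C / k₀ * (k₀ * len * n) := by field_simp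
      _ ≤ _ := by gcongr
  have h5 : k₀ * len * (ε * n) ≤ ε * t := by
    calc k₀ * len * (ε * n) = ε * (k₀ * len * n) := by ring
      _ ≤ _ := by gcongr
  have h6 : m * s ≤ m * e := by gcongr
  have h7 : 3 * m * e ≤ 3 * m * (k₀ * len + len * (C * (n + 1))) := by gcongr
  have h8 : 2 * m * len * H ≤ 2 * m * len * (C * n) := by gcongr
  linarith

namespace TrialSystem

variable {A Ω : Type*} [MeasurableSpace A] [mΩ : MeasurableSpace Ω] (T : TrialSystem A Ω)

/-- The normalized and truncated displacement until the next success. -/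
def reward (X : ℝ≥0 → Ω → ℝ) (len k₀ : ℕ) (m : ℝ) (ω : Ω) : ℝ :=
  if T.next k₀ ω ≤ 2 * k₀ then
    clamp (2 * m) (X ((len * T.next k₀ ω : ℕ) : ℝ≥0) ω / (k₀ * len)) else 0

variable {X : ℝ≥0 → Ω → ℝ} {len k₀ : ℕ} {m : ℝ}

lemma abs_reward_le (hm : 0 ≤ m) (ω : Ω) : |T.reward X len k₀ m ω| ≤ 2 * m := by
  unfold reward
  split_ifs
  · exact abs_clamp_le (by linarith) _
  · simp only [abs_zero]; linarith

lemma measurable_reward (hX : ∀ n : ℕ, Measurable (X n)) :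
    Measurable (T.reward X len k₀ m) := by
  have h1 : Measurable fun p : Ω × ℕ => X ((len * p.2 : ℕ) : ℝ≥0) p.1 :=
    measurable_from_prod_countable_left fun n => hX (len * n)
  have h2 : Measurable fun ω => X ((len * T.next k₀ ω : ℕ) : ℝ≥0) ω :=
    h1.comp (measurable_id.prodMk (T.measurable_next k₀))
  exact Measurable.ite (measurableSet_le (T.measurable_next k₀) measurable_const)
    ((measurable_clamp _).comp (h2.div_const _)) measurable_const

lemma preRenewal_reward (hX : ∀ n : ℕ, Measurable[T.hist n] (X ((len * n : ℕ) : ℝ≥0))) :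
    T.PreRenewal k₀ (T.reward X len k₀ m) := by
  intro n
  refine ⟨fun ω => if n ≤ 2 * k₀ then clamp (2 * m) (X ((len * n : ℕ) : ℝ≥0) ω / (k₀ * len)) else 0,
    ?_, fun ω hω => by simp only [reward, hω]⟩
  split_ifs
  · exact (measurable_clamp _).comp ((hX n).div_const _)
  · exact measurable_const

variable {T} in
lemma Recurrent.iterate_mem {ω : Ω} (h : T.Recurrent ω) (hs : ω ∈ T.success) (k₀ n : ℕ) :
    (T.renew k₀)^[n] ω ∈ T.success := by
  rcases n with _ | n
  · exact hs
  · rw [Function.iterate_succ_apply']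
    exact ((h.iterate k₀ n).next_spec k₀).2

/-- If the conditional mean rewards are within `ε` of `c`, then the speed is almost `c`. -/
theorem ae_speed {η : A} (hη : η ∈ T.good) (hlen : 1 ≤ len) (hk : 1 ≤ k₀) (hm : 0 ≤ m)
    (hXm : ∀ n : ℕ, Measurable (X n))
    (hXhist : ∀ n : ℕ, Measurable[T.hist n] (X ((len * n : ℕ) : ℝ≥0)))
    (hadd : ∀ ω ∈ T.reg, ∀ (n : ℕ) (t : ℝ≥0),
      X ((len * n : ℕ) + t) ω = X ((len * n : ℕ) : ℝ≥0) ω + X t (T.step n ω))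
    (hcone : ∀ ω ∈ T.reg, ω ∈ T.success → ∀ t, |X t ω| ≤ m * t)
    {c ε : ℝ} (hc : |c| ≤ 2 * m) (hε : 0 ≤ ε)
    (hmean : ∀ η ∈ T.good, |T.mean (T.reward X len k₀ m) η - c| ≤ ε) {δ : ℝ} (hδ : 0 < δ) :
    ∀ᵐ ω ∂(T.law η), ∀ᶠ t : ℝ≥0 in atTop, |X t ω - c * t|
      ≤ (ε + 10 * m * (T.waitBound / T.prob + 1) / k₀ + δ) * t := by
  set C := 2 * (T.waitBound / T.prob + 1) with hC
  have hC0 : 0 ≤ C := by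
    have := div_nonneg T.waitBound_nonneg T.prob_pos.le
    positivity
  have hδ3 : 0 < δ / 3 := by positivity
  set f := T.reward X len k₀ m with hf
  have hfm : Measurable f := T.measurable_reward hXm
  set p : Ω → Prop := fun ω => ω ∈ T.success → ∀ᶠ n : ℕ in atTop,
    birkhoffSum (T.renew k₀) (T.delay k₀) n ω ≤ C * n ∧
      |birkhoffSum (T.renew k₀) f n ω - n * c| ≤ (ε + δ / 3) * n with hp
  -- Measurability is needed to transfer `p` to all shifts by the Markov property; the initial trial
  -- need not succeed, and `p` will be used from the first successful one.
  have hpm : MeasurableSet {ω | p ω} := by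
    have h1 : {ω | p ω} = T.successᶜ ∪ ⋃ N : ℕ, ⋂ n : ℕ, ⋂ (_ : N ≤ n),
        ({ω | birkhoffSum (T.renew k₀) (T.delay k₀) n ω ≤ C * n} ∩
          {ω | |birkhoffSum (T.renew k₀) f n ω - n * c| ≤ (ε + δ / 3) * n}) := by
      ext ω
      simp only [hp, eventually_atTop, Set.mem_ofPred_eq, Set.mem_union, Set.mem_compl_iff,
        Set.mem_iUnion, Set.mem_iInter, Set.mem_inter_iff, imp_iff_not_or]
    rw [h1]
    refine T.measurableSet_success.compl.union (MeasurableSet.iUnion fun N =>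
      MeasurableSet.iInter fun n => MeasurableSet.iInter fun _ => ?_)
    exact (measurableSet_le (T.measurable_birkhoffSum (T.measurable_delay k₀) n)
      measurable_const).inter (measurableSet_le
      ((T.measurable_birkhoffSum hfm n).sub_const _).abs measurable_const)
  have hpae : ∀ η ∈ T.good, ∀ᵐ ω ∂(T.law η), p ω := by
    intro η hη
    filter_upwards [T.ae_sum_delay_le hη hk, T.ae_birkhoffSum_near hη hk hfm (T.abs_reward_le hm)
      (T.preRenewal_reward hXhist) hmean hδ3] with ω h1 h2 hs
    exact (h1 hs).and (h2 hs)
  filter_upwards [T.ae_step hpm hpae hη, T.ae_recurrent hη] with ω h1 hω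
  obtain ⟨j, -, hj⟩ := hω.2 0
  have hev := h1 j hj
  set ω' := T.step j ω with hω'
  have hr : T.Recurrent ω' := hω.step j
  -- Additivity at trial times telescopes the path over the successive renewals.
  have hadd' : ∀ n (s : ℝ≥0), X ((len * ∑ k ∈ Finset.range n,
      T.next k₀ ((T.renew k₀)^[k] ω') : ℕ) + s) ω' =
      ∑ k ∈ Finset.range n, X ((len * T.next k₀ ((T.renew k₀)^[k] ω') : ℕ) : ℝ≥0)
        ((T.renew k₀)^[k] ω') + X s ((T.renew k₀)^[n] ω') := by
    intro n
    induction n with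
    | zero => intro s; simp
    | succ n ih =>
      intro s
      rw [Finset.sum_range_succ, mul_add, Nat.cast_add, add_assoc, ih,
        hadd _ (hr.iterate k₀ n).1.1, Finset.sum_range_succ, add_assoc,
        Function.iterate_succ_apply']
      rfl
  have hspeed := path_speed (z := fun t => X t ω')
    (N := fun k => T.next k₀ ((T.renew k₀)^[k] ω'))
    (Δ := fun k => X ((len * T.next k₀ ((T.renew k₀)^[k] ω') : ℕ) : ℝ≥0) ((T.renew k₀)^[k] ω'))
    (g := fun k => f ((T.renew k₀)^[k] ω')) (C := C) (ε := ε + δ / 3)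
    hlen hk hm hC0 hc (fun k => ((hr.iterate k₀ k).next_spec k₀).1) (by positivity)
    (fun n s => by
      rw [hadd', add_sub_cancel_left]
      exact hcone _ (hr.iterate k₀ n).1.1 (hr.iterate_mem hj k₀ n) s)
    (fun k => by
      have := hcone _ (hr.iterate k₀ k).1.1 (hr.iterate_mem hj k₀ k)
        ((len * T.next k₀ ((T.renew k₀)^[k] ω') : ℕ) : ℝ≥0)
      refine this.trans (le_of_eq ?_)
      push_cast; rfl)
    (fun k => by
      simp only [hf, reward]
      split_ifs with h
      -- A successful path obeys the cone bound, and the cycle has at most `2 * k₀` trials, so the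
      -- normalized displacement is at most `2 * m` and the clamp is inactive.
      · refine clamp_eq_self ?_
        have := hcone _ (hr.iterate k₀ k).1.1 (hr.iterate_mem hj k₀ k)
          ((len * T.next k₀ ((T.renew k₀)^[k] ω') : ℕ) : ℝ≥0)
        have hk0 : (0 : ℝ) < k₀ := by exact_mod_cast hk
        have hl0 : (0 : ℝ) < len := by exact_mod_cast hlen
        rw [abs_div, abs_of_pos (by positivity : (0 : ℝ) < k₀ * len), div_le_iff₀ (by positivity)]
        refine this.trans ?_
        have h2 : ((T.next k₀ ((T.renew k₀)^[k] ω') : ℕ) : ℝ) ≤ 2 * k₀ := by exact_mod_cast h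
        push_cast
        calc m * (len * (T.next k₀ ((T.renew k₀)^[k] ω') : ℝ)) ≤ m * (len * (2 * k₀)) := by gcongr
          _ = _ := by ring
      · rfl)
    (hev.mono fun n hn => hn.1) (hev.mono fun n hn => hn.2) hδ3
  set v : ℝ := ε + δ / 3 + 5 * m * C / k₀ + δ / 3 with hv
  have hv0 : 0 ≤ v := by positivity
  -- The fixed contribution of the time before the first success, absorbed by `δ / 3 * t` for large
  -- `t`.
  set B : ℝ := |X ((len * j : ℕ) : ℝ≥0) ω| + |c| * (len * j : ℕ) with hB
  have hlarge : ∀ᶠ t : ℝ≥0 in atTop, B / (δ / 3) ≤ (t : ℝ) :=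
    (NNReal.tendsto_coe_atTop.2 tendsto_id).eventually_ge_atTop _
  have hshift : Tendsto (fun t : ℝ≥0 => t - ((len * j : ℕ) : ℝ≥0)) atTop atTop := by
    refine tendsto_atTop.2 fun b => ?_
    filter_upwards [eventually_ge_atTop (b + ((len * j : ℕ) : ℝ≥0))] with t ht
    exact le_tsub_of_add_le_right ht
  filter_upwards [hshift.eventually hspeed, hlarge, eventually_ge_atTop ((len * j : ℕ) : ℝ≥0)]
    with t h3 h4 h5
  set s := t - ((len * j : ℕ) : ℝ≥0) with hs
  have hts : t = ((len * j : ℕ) : ℝ≥0) + s := (add_tsub_cancel_of_le h5).symm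
  have hst : (t : ℝ) = ((len * j : ℕ) : ℝ) + s := by rw [hts]; push_cast; rfl
  have hXt : X t ω = X ((len * j : ℕ) : ℝ≥0) ω + X s ω' := by rw [hts]; exact hadd ω hω.1.1 j s
  rw [div_le_iff₀ hδ3] at h4
  have hst' : (s : ℝ) ≤ t := by rw [hst]; linarith [Nat.cast_nonneg (α := ℝ) (len * j)]
  have hdec : X t ω - c * t = (X ((len * j : ℕ) : ℝ≥0) ω - c * (len * j : ℕ)) + (X s ω' - c * s) := by
    rw [hXt, hst]; ring
  have h6 : |X ((len * j : ℕ) : ℝ≥0) ω - c * (len * j : ℕ)| ≤ B := by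
    refine (abs_sub _ _).trans (le_of_eq ?_)
    rw [abs_mul, abs_of_nonneg (Nat.cast_nonneg (α := ℝ) (len * j))]
  calc |X t ω - c * t| ≤ B + v * s := by
        rw [hdec]; exact (abs_add_le _ _).trans (add_le_add h6 h3)
    _ ≤ δ / 3 * t + v * t := by
        have := mul_le_mul_of_nonneg_left hst' hv0
        linarith
    _ = _ := by rw [hv, hC]; ring

end TrialSystem
end RWDRE
end

/-! ### The Markov property of environment and noise, also as seen from the walk -/

noncomputable section

namespace RWDRE

section Noise

variable {S : Type*} [MeasurableSpace S]

lemma measurable_noiseShift (n : ℕ) : Measurable fun (y : ℕ → S) k => y (n + k) :=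
  measurable_pi_lambda _ fun _ => measurable_pi_apply _

lemma infinitePi_map_noiseShift (ν : Measure S) [IsProbabilityMeasure ν] (n : ℕ) :
    (Measure.infinitePi fun _ : ℕ => ν).map (fun y k => y (n + k))
      = Measure.infinitePi fun _ : ℕ => ν := by
  refine Measure.eq_infinitePi _ fun s t ht => ?_
  rw [Measure.map_apply (measurable_noiseShift n)
    (MeasurableSet.pi s.countable_toSet fun i _ => ht i)]
  have h1 : (fun (y : ℕ → S) k => y (n + k)) ⁻¹' Set.pi s t
      = Set.pi (s.map (addLeftEmbedding n) : Finset ℕ) fun i => t (i - n) := by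
    ext y
    simp [Set.mem_pi]
  rw [h1, Measure.infinitePi_pi _ fun i _ => ht _, Finset.prod_map]
  simp

/-- Disjoint blocks of coordinates are independent, and the shifted sequence has the original law.
-/
lemma infinitePi_inter_noiseShift (ν : Measure S) [IsProbabilityMeasure ν] (n : ℕ)
    {B C : Set (ℕ → S)}
    (hB : MeasurableSet[⨆ (k : ℕ) (_ : k < n), MeasurableSpace.comap (fun y : ℕ → S => y k)
      inferInstance] B) (hC : MeasurableSet C) :
    (Measure.infinitePi fun _ : ℕ => ν) (B ∩ (fun y k => y (n + k)) ⁻¹' C)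
      = (Measure.infinitePi fun _ : ℕ => ν) B * (Measure.infinitePi fun _ : ℕ => ν) C := by
  set P := Measure.infinitePi fun _ : ℕ => ν with hP
  have hind : iIndepFun (fun k (y : ℕ → S) => y k) P :=
    iIndepFun_infinitePi (P := fun _ : ℕ => ν) (X := fun _ s => s) fun _ => measurable_id
  have hind2 := indep_iSup_of_disjoint (fun k => (measurable_pi_apply k).comap_le) hind
    (S := {k | k < n}) (T := {k | n ≤ k}) (by
      rw [Set.disjoint_left]; intro k h1 h2; exact absurd (show k < n from h1) (not_lt.2 h2))
  have hC' : MeasurableSet[⨆ k ∈ {k | n ≤ k}, MeasurableSpace.comap (fun y : ℕ → S => y k)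
      inferInstance] ((fun y k => y (n + k)) ⁻¹' C) := by
    have hm : Measurable[⨆ k ∈ {k | n ≤ k}, MeasurableSpace.comap (fun y : ℕ → S => y k)
        inferInstance] (fun (y : ℕ → S) k => y (n + k)) := by
      refine @measurable_pi_lambda _ _ _ (_) _ _ fun k => ?_
      refine Measurable.mono (comap_measurable _) ?_ le_rfl
      exact le_iSup₂ (f := fun k (_ : k ∈ {k | n ≤ k}) => MeasurableSpace.comap
        (fun y : ℕ → S => y k) inferInstance) (n + k) (by simp)
    exact hm hC
  have := (Indep_iff _ _ P).1 hind2 B _ hB hC'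
  rw [this, ← Measure.map_apply (measurable_noiseShift n) hC, infinitePi_map_noiseShift]

end Noise

variable {d : ℕ} {E S : Type*}

@[simp] lemma shiftConfig_zero (η : Config d E) : shiftConfig 0 η = η := by
  funext y; simp [shiftConfig]

lemma shiftConfig_shiftConfig (x y : Site d) (η : Config d E) :
    shiftConfig x (shiftConfig y η) = shiftConfig (y + x) η := by
  funext z; simp [shiftConfig, add_assoc]

section Maps

variable {D : PathSpace d E}

/-- The sample seen from the walk at time `n`. -/
def fromWalk (Z : ℝ≥0 → D.Sample S → Site d) (n : ℕ) (ω : D.Sample S) : D.Sample S :=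
  spaceShift (Z n ω) (timeShift (n : ℝ≥0) ω)

/-- The initial configuration of a sample. -/
def initial (ω : D.Sample S) : Config d E := ω.1.1 0

lemma initial_fromWalk (Z : ℝ≥0 → D.Sample S → Site d) (n : ℕ) (ω : D.Sample S) :
    initial (fromWalk Z n ω) = shiftConfig (Z n ω) (ω.1.1 n) := by
  simp [initial, fromWalk, spaceShift, timeShift, pathSpaceShift, pathTimeShift]

lemma spaceShift_spaceShift (x y : Site d) (ω : D.Sample S) :
    spaceShift x (spaceShift y ω) = spaceShift (y + x) ω := by
  refine Prod.ext (Subtype.ext ?_) rfl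
  funext s
  exact shiftConfig_shiftConfig x y _

lemma timeShift_spaceShift (t : ℝ≥0) (x : Site d) (ω : D.Sample S) :
    timeShift t (spaceShift x ω) = spaceShift x (timeShift t ω) := rfl

lemma timeShift_natCast_timeShift (k n : ℕ) (ω : D.Sample S) :
    timeShift (k : ℝ≥0) (timeShift (n : ℝ≥0) ω) = timeShift ((n + k : ℕ) : ℝ≥0) ω := by
  refine Prod.ext (Subtype.ext ?_) ?_
  · funext s
    simp [timeShift, pathTimeShift, add_assoc]
  · funext j
    simp only [timeShift, Nat.floor_natCast, add_assoc]

@[simp] lemma spaceShift_zero (ω : D.Sample S) : spaceShift 0 ω = ω := by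
  refine Prod.ext (Subtype.ext ?_) rfl
  funext s
  exact shiftConfig_zero _

@[simp] lemma timeShift_zero (ω : D.Sample S) : timeShift 0 ω = ω := by
  refine Prod.ext (Subtype.ext ?_) ?_
  · funext s; simp [timeShift, pathTimeShift]
  · funext j; simp [timeShift]

end Maps

lemma envSigma_mono {d : ℕ} {E S : Type*} [MeasurableSpace E] {D : PathSpace d E} :
    Monotone (envSigma D S) := fun _ _ hst =>
  iSup₂_le fun u hu => le_iSup₂ (f := fun u (_ : u ≤ _) => MeasurableSpace.comap
    (fun ω : D.Sample S => ω.1.1 u) inferInstance) u (hu.trans hst)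

lemma noiseSigma_mono {d : ℕ} {E S : Type*} [MeasurableSpace S] {D : PathSpace d E} :
    Monotone (noiseSigma D S) := fun _ _ hst =>
  iSup₂_le fun k hk => le_iSup₂ (f := fun k (_ : k < _) => MeasurableSpace.comap
    (fun ω : D.Sample S => ω.2 k) inferInstance) k (hk.trans_le hst)

variable [MeasurableSpace E] [MeasurableSpace S] {D : PathSpace d E}

lemma measurable_shiftConfig (x : Site d) : Measurable (shiftConfig x : Config d E → Config d E) :=
  measurable_pi_lambda _ fun _ => measurable_pi_apply _

lemma measurable_pathAt (t : ℝ≥0) : Measurable fun ξ : D.Path => ξ.1 t :=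
  (measurable_pi_apply t).comp measurable_subtype_coe

lemma measurable_envAt (t : ℝ≥0) : Measurable fun ω : D.Sample S => ω.1.1 t :=
  (measurable_pathAt t).comp measurable_fst

lemma measurable_pathTimeShift (t : ℝ≥0) : Measurable (pathTimeShift t : D.Path → D.Path) :=
  Measurable.subtype_mk (measurable_pi_lambda _ fun s => measurable_pathAt (t + s))

lemma measurable_pathSpaceShift (x : Site d) : Measurable (pathSpaceShift x : D.Path → D.Path) :=
  Measurable.subtype_mk (measurable_pi_lambda _ fun s =>
    (measurable_shiftConfig x).comp (measurable_pathAt s))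

lemma measurable_timeShift (t : ℝ≥0) : Measurable (timeShift t : D.Sample S → D.Sample S) :=
  ((measurable_pathTimeShift t).comp measurable_fst).prodMk
    ((measurable_noiseShift _).comp measurable_snd)

lemma measurable_spaceShift (x : Site d) : Measurable (spaceShift x : D.Sample S → D.Sample S) :=
  ((measurable_pathSpaceShift x).comp measurable_fst).prodMk measurable_snd

lemma envSigma_le (t : ℝ≥0) : envSigma D S t ≤ (inferInstance : MeasurableSpace (D.Sample S)) :=
  iSup₂_le fun u _ => (measurable_envAt u).comap_le

lemma noiseSigma_le (n : ℕ) : noiseSigma D S n ≤ (inferInstance : MeasurableSpace (D.Sample S)) :=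
  iSup₂_le fun k _ => ((measurable_pi_apply k).comp measurable_snd).comap_le

lemma histSigma_le (t : ℝ≥0) : histSigma D S t ≤ (inferInstance : MeasurableSpace (D.Sample S)) :=
  sup_le (envSigma_le t) (noiseSigma_le _)

lemma histSigma_mono : Monotone (histSigma D S) := fun _ _ hst =>
  sup_le_sup (envSigma_mono hst) (noiseSigma_mono (Nat.ceil_mono hst))

lemma measurable_envAt_hist {u t : ℝ≥0} (h : u ≤ t) :
    Measurable[histSigma D S t] fun ω : D.Sample S => ω.1.1 u := by
  refine Measurable.mono (comap_measurable _) ?_ le_rfl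
  exact (le_iSup₂ (f := fun u (_ : u ≤ t) => MeasurableSpace.comap
    (fun ω : D.Sample S => ω.1.1 u) inferInstance) u h).trans le_sup_left

lemma measurable_noiseAt_hist {k n : ℕ} (h : k < n) :
    Measurable[histSigma D S n] fun ω : D.Sample S => ω.2 k := by
  refine Measurable.mono (comap_measurable _) ?_ le_rfl
  refine le_trans ?_ le_sup_right
  exact le_iSup₂ (f := fun k (_ : k < ⌈(n : ℝ≥0)⌉₊) => MeasurableSpace.comap
    (fun ω : D.Sample S => ω.2 k) inferInstance) k (by rwa [Nat.ceil_natCast])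

section Laws

variable (K : Kernel (Config d E) D.Path) [IsMarkovKernel K] (ν : Measure S)
  [IsProbabilityMeasure ν]

/-- The laws `ℙ_η`, as a kernel. -/
def lawKernel : Kernel (Config d E) (D.Sample S) :=
  K ×ₖ Kernel.const _ (Measure.infinitePi fun _ : ℕ => ν)

instance : IsMarkovKernel (lawKernel K ν) := by unfold lawKernel; infer_instance

lemma lawKernel_apply (η : Config d E) : lawKernel K ν η = lawFrom K ν η := by
  rw [lawKernel, Kernel.prod_apply, Kernel.const_apply, lawFrom]

lemma lawFrom_eq : lawFrom K ν = fun η => lawKernel K ν η :=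
  funext fun η => (lawKernel_apply K ν η).symm

variable {K ν}

lemma lawKernel_map_spaceShift (hKtrans : IsTranslationInvariantFamily K) (x : Site d)
    (η : Config d E) :
    (lawKernel K ν η).map (spaceShift x) = lawKernel K ν (shiftConfig x η) := by
  rw [lawKernel_apply, lawKernel_apply, lawFrom, lawFrom, ← hKtrans x η]
  have := Measure.map_prod_map (K η) (Measure.infinitePi fun _ : ℕ => ν)
    (measurable_pathSpaceShift (D := D) x) measurable_id
  rw [Measure.map_id] at this
  rw [this]
  rfl

lemma lawKernel_start (hK : IsMarkovFamily K) (η : Config d E) :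
    ∀ᵐ ω ∂(lawKernel K ν η), initial ω = η := by
  rw [lawKernel_apply, lawFrom]
  exact Measure.quasiMeasurePreserving_fst.ae (hK.start η)

/-- The history at an integer time is generated by rectangles, on which the Markov property of `ξ`
and the independence of `Y` can be treated separately. -/
lemma histSigma_eq_prod (n : ℕ) :
    histSigma D S (n : ℝ≥0) = @Prod.instMeasurableSpace _ _ (pathSigma D n)
      (⨆ (k : ℕ) (_ : k < n), MeasurableSpace.comap (fun y : ℕ → S => y k) inferInstance) := by
  unfold histSigma Prod.instMeasurableSpace MeasurableSpace.prod
  simp only [MeasurableSpace.comap_iSup, MeasurableSpace.comap_comp, Nat.ceil_natCast]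
  rfl

/-- The Markov property of `(ξ, Y)` at integer times. -/
lemma lawKernel_markov (hK : IsMarkovFamily K) (η : Config d E) (n : ℕ) {B : Set (D.Sample S)}
    (hB : MeasurableSet[histSigma D S (n : ℝ≥0)] B) {C : Set (D.Sample S)} (hC : MeasurableSet C) :
    lawKernel K ν η (B ∩ timeShift (n : ℝ≥0) ⁻¹' C)
      = ∫⁻ ω in B, lawKernel K ν (ω.1.1 n) C ∂(lawKernel K ν η) := by
  set N := Measure.infinitePi fun _ : ℕ => ν with hN
  set P := lawKernel K ν η with hP
  have hgm : Measurable fun ω : D.Sample S => lawKernel K ν (ω.1.1 n) C :=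
    (Kernel.measurable_coe _ hC).comp (measurable_envAt _)
  have hle := histSigma_le (D := D) (S := S) (n : ℝ≥0)
  have hrect : ∀ (B₁ : Set D.Path) (B₂ : Set (ℕ → S)), MeasurableSet[pathSigma D n] B₁ →
      MeasurableSet[⨆ (k : ℕ) (_ : k < n), MeasurableSpace.comap (fun y : ℕ → S => y k)
        inferInstance] B₂ →
      P ((B₁ ×ˢ B₂) ∩ timeShift (n : ℝ≥0) ⁻¹' C) = ∫⁻ ω in B₁ ×ˢ B₂, lawKernel K ν (ω.1.1 n) C ∂P := by
    intro B₁ B₂ h1 h2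
    have h1' : MeasurableSet B₁ :=
      (iSup₂_le fun u _ => (measurable_pathAt u).comap_le : pathSigma D n ≤ _) _ h1
    have h2' : MeasurableSet B₂ :=
      (iSup₂_le fun k _ => (measurable_pi_apply k).comap_le :
        (⨆ (k : ℕ) (_ : k < n), MeasurableSpace.comap (fun y : ℕ → S => y k) inferInstance)
          ≤ _) _ h2
    have hker : Measurable fun ξ : D.Path => K (ξ.1 n) := K.measurable.comp (measurable_pathAt _)
    have hmap1 : ((K η).restrict B₁).map (pathTimeShift (n : ℝ≥0))
        = ((K η).restrict B₁).bind (fun ξ => K (ξ.1 n)) := by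
      ext A hA
      rw [Measure.map_apply (measurable_pathTimeShift _) hA, Measure.bind_apply hA hker.aemeasurable,
        Measure.restrict_apply (measurable_pathTimeShift _ hA), Set.inter_comm,
        hK.markov η n A hA B₁ h1]
    have hmap2 : (N.restrict B₂).map (fun y k => y (n + k)) = N B₂ • N := by
      ext A hA
      rw [Measure.map_apply (measurable_noiseShift n) hA,
        Measure.restrict_apply (measurable_noiseShift n hA), Set.inter_comm,
        infinitePi_inter_noiseShift ν n h2 hA, Measure.smul_apply, smul_eq_mul]
    have hPr : P.restrict (B₁ ×ˢ B₂) = ((K η).restrict B₁).prod (N.restrict B₂) := by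
      rw [hP, lawKernel_apply, lawFrom, Measure.prod_restrict]
    have hts : (timeShift (n : ℝ≥0) : D.Sample S → D.Sample S)
        = Prod.map (pathTimeShift (n : ℝ≥0)) (fun y k => y (n + k)) := by
      funext ω
      simp [timeShift, Prod.map]
    have hsec : Measurable fun ξ : D.Path => N (Prod.mk ξ ⁻¹' C) :=
      measurable_measure_prodMk_left hC
    calc P ((B₁ ×ˢ B₂) ∩ timeShift (n : ℝ≥0) ⁻¹' C)
        = ((P.restrict (B₁ ×ˢ B₂)).map (timeShift (n : ℝ≥0))) C := by
          rw [Measure.map_apply (measurable_timeShift _) hC,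
            Measure.restrict_apply (measurable_timeShift _ hC), Set.inter_comm]
      _ = ((((K η).restrict B₁).map (pathTimeShift (n : ℝ≥0))).prod (N B₂ • N)) C := by
          rw [hPr, hts, ← hmap2, Measure.map_prod_map _ _ (measurable_pathTimeShift _)
            (measurable_noiseShift n)]
      _ = ∫⁻ ξ, N B₂ * N (Prod.mk ξ ⁻¹' C)
            ∂(((K η).restrict B₁).map (pathTimeShift (n : ℝ≥0))) := by
          rw [Measure.prod_apply hC]
          rfl
      _ = ∫⁻ ξ in B₁, N B₂ * lawKernel K ν (ξ.1 n) C ∂(K η) := by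
          rw [hmap1, Measure.lintegral_bind hker.aemeasurable
            (hsec.const_mul _).aemeasurable]
          refine lintegral_congr fun ξ => ?_
          rw [lintegral_const_mul _ hsec, lawKernel_apply, lawFrom, Measure.prod_apply hC]
      _ = ∫⁻ ω in B₁ ×ˢ B₂, lawKernel K ν (ω.1.1 n) C ∂P := by
          rw [hPr, lintegral_prod _ hgm.aemeasurable]
          refine lintegral_congr fun ξ => ?_
          simp only
          rw [lintegral_const, Measure.restrict_apply_univ, mul_comm]
  -- With `C` fixed, both sides are measures in `B`, the first of them finite. They agree on the
  -- rectangles, a generating π-system, hence on the whole history σ-algebra.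
  have hmeas : (P.restrict (timeShift (n : ℝ≥0) ⁻¹' C)).trim hle
      = (P.withDensity fun ω => lawKernel K ν (ω.1.1 n) C).trim hle := by
    have hfin : IsFiniteMeasure (P.restrict (timeShift (n : ℝ≥0) ⁻¹' C)) := inferInstance
    have hkey : ∀ B₁ B₂, MeasurableSet[pathSigma D n] B₁ →
        MeasurableSet[⨆ (k : ℕ) (_ : k < n), MeasurableSpace.comap (fun y : ℕ → S => y k)
          inferInstance] B₂ → MeasurableSet[histSigma D S (n : ℝ≥0)] (B₁ ×ˢ B₂) →
        (P.restrict (timeShift (n : ℝ≥0) ⁻¹' C)).trim hle (B₁ ×ˢ B₂)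
          = (P.withDensity fun ω => lawKernel K ν (ω.1.1 n) C).trim hle (B₁ ×ˢ B₂) := by
      intro B₁ B₂ h1 h2 h12
      rw [trim_measurableSet_eq hle h12, trim_measurableSet_eq hle h12,
        Measure.restrict_apply (hle _ h12), withDensity_apply _ (hle _ h12)]
      exact hrect B₁ B₂ h1 h2
    have hgen := histSigma_eq_prod (D := D) (S := S) n
    have hms : ∀ B₁ B₂, MeasurableSet[pathSigma D n] B₁ →
        MeasurableSet[⨆ (k : ℕ) (_ : k < n), MeasurableSpace.comap (fun y : ℕ → S => y k)
          inferInstance] B₂ → MeasurableSet[histSigma D S (n : ℝ≥0)] (B₁ ×ˢ B₂) := by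
      intro B₁ B₂ h1 h2
      rw [hgen]
      exact @MeasurableSet.prod _ _ (pathSigma D n) (_) _ _ h1 h2
    refine ext_of_generate_finite (m0 := histSigma D S (n : ℝ≥0)) _
      (hgen.trans (@generateFrom_prod _ _ (pathSigma D n) (_)).symm)
      (@isPiSystem_prod _ _ (pathSigma D n) (_)) ?_ ?_
    · rintro _ ⟨B₁, h1, B₂, h2, rfl⟩
      exact hkey B₁ B₂ h1 h2 (hms B₁ B₂ h1 h2)
    · have := hkey Set.univ Set.univ MeasurableSet.univ MeasurableSet.univ
        (hms _ _ MeasurableSet.univ MeasurableSet.univ)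
      rwa [Set.univ_prod_univ] at this
  have h := congrArg (fun μ => μ B) hmeas
  rw [trim_measurableSet_eq hle hB, trim_measurableSet_eq hle hB,
    Measure.restrict_apply (hle _ hB), withDensity_apply _ (hle _ hB)] at h
  exact h

variable {Z : ℝ≥0 → D.Sample S → Site d}

lemma measurable_fromWalk (hZ : ∀ t, Measurable (Z t)) (n : ℕ) : Measurable (fromWalk Z n) := by
  have h1 : Measurable fun p : D.Sample S × Site d => spaceShift p.2 p.1 :=
    measurable_from_prod_countable_left fun x => measurable_spaceShift x
  exact h1.comp ((measurable_timeShift _).prodMk (hZ n))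

lemma measurable_initial' : Measurable (initial : D.Sample S → Config d E) := measurable_envAt 0

/-- The Markov property seen from the walk. -/
lemma lawKernel_markov_fromWalk (hK : IsMarkovFamily K) (hKtrans : IsTranslationInvariantFamily K)
    (hZ : ∀ t, Measurable[histSigma D S t] (Z t)) (η : Config d E) (n : ℕ) {B : Set (D.Sample S)}
    (hB : MeasurableSet[histSigma D S (n : ℝ≥0)] B) {C : Set (D.Sample S)} (hC : MeasurableSet C) :
    lawKernel K ν η (B ∩ fromWalk Z n ⁻¹' C)
      = ∫⁻ ω in B, lawKernel K ν (initial (fromWalk Z n ω)) C ∂(lawKernel K ν η) := by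
  have hle := histSigma_le (D := D) (S := S) (n : ℝ≥0)
  have hZm : ∀ t, Measurable (Z t) := fun t => (hZ t).mono (histSigma_le t) le_rfl
  -- On each of the countably many pieces the space shift is deterministic, so the Markov property
  -- in time can be followed by translation invariance.
  have hpiece : ∀ x, MeasurableSet[histSigma D S (n : ℝ≥0)] (B ∩ {ω | Z n ω = x}) := fun x =>
    MeasurableSet.inter (m := histSigma D S (n : ℝ≥0)) hB (hZ n (measurableSet_singleton x))
  have hcover : B = ⋃ x, B ∩ {ω | Z n ω = x} := by ext ω; simp
  have hdisj : Pairwise (Function.onFun Disjoint fun x => B ∩ {ω | Z n ω = x}) := by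
    intro x y hxy
    rw [Function.onFun, Set.disjoint_left]
    rintro ω ⟨_, h1⟩ ⟨_, h2⟩
    exact hxy (h1.symm.trans h2)
  conv_lhs => rw [hcover, Set.iUnion_inter]
  conv_rhs => rw [hcover]
  rw [measure_iUnion (fun x y hxy => (hdisj hxy).mono Set.inter_subset_left Set.inter_subset_left)
      fun x => (hle _ (hpiece x)).inter (measurable_fromWalk hZm n hC),
    lintegral_iUnion (fun x => hle _ (hpiece x)) hdisj]
  refine tsum_congr fun x => ?_
  have h1 : B ∩ {ω | Z n ω = x} ∩ fromWalk Z n ⁻¹' C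
      = B ∩ {ω | Z n ω = x} ∩ timeShift (n : ℝ≥0) ⁻¹' (spaceShift x ⁻¹' C) := by
    ext ω
    simp only [Set.mem_inter_iff, Set.mem_ofPred_eq, Set.mem_preimage, fromWalk]
    constructor
    · rintro ⟨⟨h1, rfl⟩, h3⟩; exact ⟨⟨h1, rfl⟩, h3⟩
    · rintro ⟨⟨h1, rfl⟩, h3⟩; exact ⟨⟨h1, rfl⟩, h3⟩
  rw [h1, lawKernel_markov hK η n (hpiece x) (measurable_spaceShift x hC)]
  refine setLIntegral_congr_fun (hle _ (hpiece x)) fun ω hω => ?_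
  rw [initial_fromWalk, hω.2, ← lawKernel_map_spaceShift hKtrans,
    Measure.map_apply (measurable_spaceShift x) hC]

end Laws
end RWDRE
end

/-! ### Null sets of configurations seen from the walk -/

noncomputable section

namespace RWDRE

/-- The event that the left limit at `n` is `y`, read off a sequence of times. -/
def leftEvent {d : ℕ} {E S : Type*} {D : PathSpace d E} (Z : ℝ≥0 → D.Sample S → Site d)
    (n : ℕ) (y : Site d) : Set (D.Sample S) :=
  ⋃ N : ℕ, ⋂ k : ℕ, ⋂ _ : N ≤ k, {ω | Z (n - 1 / (k + 2)) ω = y}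

lemma measurableSet_leftEvent {d : ℕ} {E S : Type*} [MeasurableSpace E] {D : PathSpace d E}
    {Z : ℝ≥0 → D.Sample S → Site d} {n : ℕ} (hn : 1 ≤ n) (y : Site d) :
    MeasurableSet[preJumpSigma Z n] (leftEvent Z n y) := by
  refine MeasurableSet.iUnion (m := preJumpSigma Z n) fun N =>
    MeasurableSet.iInter (m := preJumpSigma Z n) fun k =>
    MeasurableSet.iInter (m := preJumpSigma Z n) fun _ => ?_
  have hlt : (n : ℝ≥0) - 1 / (k + 2) < n :=
    tsub_lt_self (by exact_mod_cast hn) (by positivity)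
  have : Measurable[preJumpSigma Z n] (Z (n - 1 / (k + 2))) := by
    refine Measurable.mono (comap_measurable _) ?_ le_rfl
    exact (le_iSup₂ (f := fun s (_ : s < (n : ℝ≥0)) => MeasurableSpace.comap (Z s) inferInstance)
      _ hlt).trans le_sup_right
  exact this (measurableSet_singleton y)

lemma tendsto_left_times {n : ℕ} (hn : 1 ≤ n) :
    Tendsto (fun k : ℕ => (n : ℝ≥0) - 1 / (k + 2)) atTop (𝓝[<] (n : ℝ≥0)) := by
  refine tendsto_nhdsWithin_iff.2 ⟨?_, Eventually.of_forall fun k =>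
    show (n : ℝ≥0) - 1 / ((k : ℝ≥0) + 2) < n from
      tsub_lt_self (Nat.cast_pos.2 hn) (by positivity)⟩
  have h1 : Tendsto (fun k : ℕ => (1 : ℝ≥0) / ((k : ℝ≥0) + 2)) atTop (𝓝 0) := by
    have h2 : Tendsto (fun k : ℕ => (1 : ℝ≥0) / (k : ℝ≥0)) atTop (𝓝 0) := by
      rw [← NNReal.tendsto_coe]
      push_cast
      exact tendsto_const_div_atTop_nhds_zero_nat 1
    have h3 := (tendsto_add_atTop_iff_nat 2).2 h2
    refine h3.congr fun k => ?_
    push_cast; rfl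
  simpa using (tendsto_const_nhds (x := (n : ℝ≥0))).sub h1

/-- In a discrete space convergence means eventual constancy, so one sequence of times increasing to
`n` determines the left limit. This yields a version of the left limit that is measurable before the
jump. -/
lemma mem_leftEvent_iff {d : ℕ} {E S : Type*} {D : PathSpace d E}
    {Z : ℝ≥0 → D.Sample S → Site d} {n : ℕ} (hn : 1 ≤ n) {ω : D.Sample S}
    (h : IsCadlag fun t => Z t ω) (y : Site d) : ω ∈ leftEvent Z n y ↔ leftVal Z n ω = y := by
  obtain ⟨l, hl⟩ := (h n).2
  have hne : (𝓝[<] (n : ℝ≥0)).NeBot := (tendsto_left_times hn).neBot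
  have hleft : leftVal Z n ω = l := by
    unfold leftVal
    exact leftLim_eq_of_tendsto hl
  have hev : ∀ᶠ k : ℕ in atTop, Z (n - 1 / (k + 2)) ω = l := by
    have := hl.comp (tendsto_left_times hn)
    have h2 := this.eventually (show ∀ᶠ x in 𝓝 l, x = l by
      rw [nhds_discrete]; exact rfl)
    exact h2
  simp only [leftEvent, Set.mem_iUnion, Set.mem_iInter, Set.mem_ofPred_eq]
  rw [hleft]
  constructor
  · rintro ⟨N, hN⟩
    obtain ⟨k, h1, h2⟩ := (hev.and (eventually_ge_atTop N)).exists
    exact h1.symm.trans (hN k h2)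
  · rintro rfl
    obtain ⟨N, hN⟩ := eventually_atTop.1 hev
    exact ⟨N, hN⟩

variable {d : ℕ} {E S : Type*} [MeasurableSpace E] [MeasurableSpace S] {D : PathSpace d E}
  {K : Kernel (Config d E) D.Path} [IsMarkovKernel K] {ν : Measure S} [IsProbabilityMeasure ν]
  {q : Kernel (Config d E) (Site d)} [IsMarkovKernel q] {μ ρ : Measure (Config d E)}
  {Z : ℝ≥0 → D.Sample S → Site d}

lemma lintegral_lawMix {f : D.Sample S → ℝ≥0∞} (hf : Measurable f) :
    ∫⁻ ω, f ω ∂(lawMix K ν ρ) = ∫⁻ η, ∫⁻ ω, f ω ∂(lawKernel K ν η) ∂ρ := by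
  rw [lawMix, lawFrom_eq, Measure.lintegral_bind (lawKernel K ν).measurable.aemeasurable
    hf.aemeasurable]

lemma lawMix_apply {C : Set (D.Sample S)} (hC : MeasurableSet C) :
    lawMix K ν ρ C = ∫⁻ η, lawKernel K ν η C ∂ρ := by
  rw [lawMix, lawFrom_eq, Measure.bind_apply hC (lawKernel K ν).measurable.aemeasurable]

instance [IsProbabilityMeasure ρ] : IsProbabilityMeasure (lawMix K ν ρ) :=
  ⟨by rw [lawMix_apply MeasurableSet.univ]; simp⟩

lemma lawMix_eq_zero_iff {C : Set (D.Sample S)} (hC : MeasurableSet C) :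
    lawMix K ν ρ C = 0 ↔ ∀ᵐ η ∂ρ, lawKernel K ν η C = 0 := by
  rw [lawMix_apply hC, lintegral_eq_zero_iff (Kernel.measurable_coe _ hC)]
  rfl

lemma lintegral_lawWithStart (hK : IsMarkovFamily K) [IsProbabilityMeasure μ]
    {f : D.Sample S × Site d → ℝ≥0∞} (hf : Measurable f) :
    ∫⁻ p, f p ∂(lawWithStart K ν q μ)
      = ∫⁻ η, ∫⁻ ω, ∫⁻ x, f (ω, x) ∂(q η) ∂(lawKernel K ν η) ∂μ := by
  have hm : Measurable fun ω : D.Sample S => ∫⁻ x, f (ω, x) ∂(q.comap _ measurable_initial ω) :=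
    hf.lintegral_kernel_prod_right'
  rw [lawWithStart, Measure.lintegral_compProd hf, lintegral_lawMix hm]
  refine lintegral_congr fun η => lintegral_congr_ae ?_
  filter_upwards [lawKernel_start (ν := ν) hK η] with ω hω
  rw [Kernel.comap_apply]
  have : ω.1.1 0 = η := hω
  rw [this]

lemma measurable_shiftConfig_prod :
    Measurable fun p : Config d E × Site d => shiftConfig p.2 p.1 :=
  measurable_from_prod_countable_left fun x => measurable_shiftConfig x

lemma measurable_spaceShift_prod :
    Measurable fun p : D.Sample S × Site d => spaceShift p.2 p.1 :=
  measurable_from_prod_countable_left fun x => measurable_spaceShift x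

lemma measurable_startShift :
    Measurable fun p : D.Sample S × Site d => shiftConfig p.2 (p.1.1.1 0) :=
  measurable_shiftConfig_prod.comp ((measurable_initial.comp measurable_fst).prodMk measurable_snd)

lemma lintegral_muBar (hK : IsMarkovFamily K) [IsProbabilityMeasure μ]
    {f : Config d E → ℝ≥0∞} (hf : Measurable f) :
    ∫⁻ η, f η ∂(muBar K ν q μ) = ∫⁻ η, ∫⁻ x, f (shiftConfig x η) ∂(q η) ∂μ := by
  have hfs : Measurable fun p : D.Sample S × Site d => f (shiftConfig p.2 (p.1.1.1 0)) :=
    hf.comp measurable_startShift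
  rw [muBar, lintegral_map hf measurable_startShift, lintegral_lawWithStart hK hfs]
  refine lintegral_congr fun η => ?_
  calc _ = ∫⁻ _ω, ∫⁻ x, f (shiftConfig x η) ∂(q η) ∂(lawKernel K ν η) := by
        refine lintegral_congr_ae ?_
        filter_upwards [lawKernel_start (ν := ν) hK η] with ω hω
        have : ω.1.1 0 = η := hω
        simp only [this]
    _ = _ := by simp

instance [IsProbabilityMeasure μ] : IsProbabilityMeasure (lawWithStart K ν q μ) := by
  unfold lawWithStart; infer_instance

instance [IsProbabilityMeasure μ] : IsProbabilityMeasure (muBar K ν q μ) :=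
  Measure.isProbabilityMeasure_map measurable_startShift.aemeasurable

/-- Seen from the starting point of the walk, the sample has law `ℙ_μ̄`. -/
lemma lawWithStart_map_spaceShift (hK : IsMarkovFamily K)
    (hKtrans : IsTranslationInvariantFamily K) [IsProbabilityMeasure μ] :
    (lawWithStart K ν q μ).map (fun p => spaceShift p.2 p.1) = lawMix K ν (muBar K ν q μ) := by
  ext C hC
  have hind : Measurable (C.indicator (1 : D.Sample S → ℝ≥0∞)) := measurable_one.indicator hC
  have hind' : Measurable fun p : D.Sample S × Site d =>
      C.indicator (1 : D.Sample S → ℝ≥0∞) (spaceShift p.2 p.1) :=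
    hind.comp measurable_spaceShift_prod
  rw [← lintegral_indicator_one hC, lintegral_map hind measurable_spaceShift_prod,
    lintegral_lawWithStart hK hind', lawMix_apply hC,
    lintegral_muBar hK (Kernel.measurable_coe _ hC)]
  refine lintegral_congr fun η => ?_
  rw [lintegral_lintegral_swap hind'.aemeasurable]
  refine lintegral_congr fun x => ?_
  rw [← lawKernel_map_spaceShift hKtrans, Measure.map_apply (measurable_spaceShift x) hC,
    ← lintegral_indicator_one (measurable_spaceShift x hC)]
  rfl

/-- There are countably many shifts and each preserves `μ`, so for `μ`-almost every configuration no
shift at all enters a given null set. -/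
lemma muBar_absolutelyContinuous (hK : IsMarkovFamily K) [IsProbabilityMeasure μ]
    (hμ : IsTranslationInvariantEquilibrium K μ) : muBar K ν q μ ≪ μ := by
  refine Measure.AbsolutelyContinuous.mk fun A hA h0 => ?_
  have hind : Measurable (A.indicator (1 : Config d E → ℝ≥0∞)) := measurable_one.indicator hA
  have hind' : Measurable fun η => ∫⁻ x, A.indicator (1 : Config d E → ℝ≥0∞) (shiftConfig x η)
      ∂(q η) := (hind.comp measurable_shiftConfig_prod).lintegral_kernel_prod_right'
  rw [← lintegral_indicator_one hA, lintegral_muBar hK hind, lintegral_eq_zero_iff hind']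
  have hall : ∀ᵐ η ∂μ, ∀ x : Site d, shiftConfig x η ∉ A := by
    rw [ae_all_iff]
    intro x
    have : μ (shiftConfig x ⁻¹' A) = 0 := by
      rw [← Measure.map_apply (measurable_shiftConfig x) hA, hμ.translation x, h0]
    exact measure_eq_zero_iff_ae_notMem.1 this
  filter_upwards [hall] with η hη
  simp [hη]

/-- Under `ℙ_μ̄`, the configuration at time `t` is absolutely continuous w.r.t. `μ`. -/
lemma ae_envAt_of_ae (hK : IsMarkovFamily K) [IsProbabilityMeasure μ]
    (hμ : IsTranslationInvariantEquilibrium K μ) (t : ℝ≥0) {p : Config d E → Prop}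
    (hp : ∀ᵐ η ∂μ, p η) : ∀ᵐ ω ∂(lawMix K ν (muBar K ν q μ)), p (ω.1.1 t) := by
  set N := toMeasurable μ {η | ¬ p η} with hN
  have hNm : MeasurableSet N := measurableSet_toMeasurable _ _
  have hN0 : μ N = 0 := (measure_toMeasurable _).trans (ae_iff.1 hp)
  have hpre : MeasurableSet {ω : D.Sample S | ω.1.1 t ∈ N} := measurable_envAt t hNm
  have h1 : ∀ᵐ η ∂μ, lawKernel K ν η {ω : D.Sample S | ω.1.1 t ∈ N} = 0 := by
    have hpm : MeasurableSet {ξ : D.Path | ξ.1 t ∈ N} := measurable_pathAt t hNm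
    have h2 : ∫⁻ η, K η {ξ | ξ.1 t ∈ N} ∂μ = 0 := by
      rw [← Measure.bind_apply hpm K.measurable.aemeasurable]
      have := congrArg (fun m => m N) (hμ.equilibrium t)
      rw [Measure.map_apply (measurable_pathAt t) hNm] at this
      exact this.trans hN0
    rw [lintegral_eq_zero_iff (Kernel.measurable_coe _ hpm)] at h2
    filter_upwards [h2] with η hη
    rw [lawKernel_apply, lawFrom]
    have : {ω : D.Sample S | ω.1.1 t ∈ N} = {ξ : D.Path | ξ.1 t ∈ N} ×ˢ Set.univ := by
      ext ω; simp
    rw [this, Measure.prod_prod]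
    simp only [Pi.zero_apply] at hη
    rw [hη, zero_mul]
  have h3 : lawMix K ν (muBar K ν q μ) {ω | ω.1.1 t ∈ N} = 0 :=
    (lawMix_eq_zero_iff hpre).2 ((muBar_absolutelyContinuous hK hμ).ae_le h1)
  refine measure_mono_null (fun ω hω => ?_) h3
  exact subset_toMeasurable μ _ hω

lemma preJumpSigma_le (hZ : ∀ t, Measurable (Z t)) (n : ℕ) :
    preJumpSigma Z n ≤ (inferInstance : MeasurableSpace (D.Sample S)) :=
  sup_le (envSigma_le _) (iSup₂_le fun s _ => (hZ s).comap_le)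

/-- Under `ℙ_μ̄`, the configuration seen from the walk at time `n` is absolutely continuous with
respect to `μ̄`. -/
lemma ae_initial_fromWalk (hK : IsMarkovFamily K) [IsProbabilityMeasure μ]
    (hμ : IsTranslationInvariantEquilibrium K μ)
    (hZ : IsWalkFunctional (lawMix K ν (muBar K ν q μ)) Z)
    (hA3 : A3 (lawMix K ν (muBar K ν q μ)) q Z) {N : Set (Config d E)} (hN : MeasurableSet N)
    (hN0 : muBar K ν q μ N = 0) (n : ℕ) :
    ∀ᵐ ω ∂(lawMix K ν (muBar K ν q μ)), initial (fromWalk Z n ω) ∉ N := by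
  have hZm : ∀ t, Measurable (Z t) := fun t => (hZ.adapted t).mono (histSigma_le t) le_rfl
  set P := lawMix K ν (muBar K ν q μ) with hP
  rcases Nat.eq_zero_or_pos n with rfl | hn
  · have h1 : ∀ᵐ ω ∂P, initial ω ∉ N := by
      have h2 : P (initial ⁻¹' N) = 0 := by
        rw [hP, lawMix_eq_zero_iff (measurable_initial' hN)]
        filter_upwards [measure_eq_zero_iff_ae_notMem.1 hN0] with η hη
        rw [measure_eq_zero_iff_ae_notMem]
        filter_upwards [lawKernel_start (ν := ν) hK η] with ω hω hmem
        rw [Set.mem_preimage, hω] at hmem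
        exact hη hmem
      exact measure_eq_zero_iff_ae_notMem.1 h2
    filter_upwards [h1, hZ.zero] with ω h2 h3
    rw [initial_fromWalk]
    simp only [Nat.cast_zero, h3, shiftConfig_zero]
    exact h2
  · have hle := preJumpSigma_le hZm n
    -- That `N` is null for `μ̄` means that, from `μ`-almost every configuration, `q` gives no mass
    -- to the shifts leading into `N`. Homogeneity of jumps will forbid the same shifts to the jump
    -- at time `n`.
    have hqN : ∀ᵐ η ∂μ, ∀ x, shiftConfig x η ∈ N → q η {x} = 0 := by
      have hind : Measurable (N.indicator (1 : Config d E → ℝ≥0∞)) := measurable_one.indicator hN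
      have hind' : Measurable fun η =>
          ∫⁻ x, N.indicator (1 : Config d E → ℝ≥0∞) (shiftConfig x η) ∂(q η) :=
        (hind.comp measurable_shiftConfig_prod).lintegral_kernel_prod_right'
      rw [← lintegral_indicator_one hN, lintegral_muBar hK hind,
        lintegral_eq_zero_iff hind'] at hN0
      filter_upwards [hN0] with η hη x hx
      simp only [Pi.zero_apply] at hη
      rw [lintegral_eq_zero_iff (measurable_of_countable _)] at hη
      refine measure_mono_null ?_ (ae_iff.1 hη)
      rintro y rfl
      simp [hx]
    have hqN' : ∀ᵐ ω ∂P, ∀ y x, shiftConfig x (shiftConfig y (ω.1.1 n)) ∈ N →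
        q (shiftConfig y (ω.1.1 n)) {x} = 0 := by
      rw [ae_all_iff]
      intro y
      have h1 : ∀ᵐ η ∂μ, ∀ x, shiftConfig x (shiftConfig y η) ∈ N →
          q (shiftConfig y η) {x} = 0 := by
        rw [← hμ.translation y] at hqN
        exact ae_of_ae_map (measurable_shiftConfig y).aemeasurable hqN
      exact ae_envAt_of_ae hK hμ n h1
    have hnull : ∀ x y, ∀ᵐ ω ∂P, ω ∈ leftEvent Z n y →
        shiftConfig x (shiftConfig y (ω.1.1 n)) ∈ N → Z n ω - leftVal Z n ω ≠ x := by
      intro x y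
      set J : Set (D.Sample S) := {ω | Z n ω - leftVal Z n ω = x} with hJ
      -- A measurable version of `J`, since `leftVal` is tied to measurable events only almost
      -- surely.
      set J' : Set (D.Sample S) := ⋃ y, leftEvent Z n y ∩ {ω | Z n ω - y = x} with hJ'
      have hJ'm : MeasurableSet J' := MeasurableSet.iUnion fun y =>
        (hle _ (measurableSet_leftEvent hn y)).inter
          ((hZm n) (MeasurableSet.of_discrete (s := {z | z - y = x})))
      have hJJ' : J =ᵐ[P] J' := by
        filter_upwards [hZ.cadlag] with ω hω
        refine propext ?_
        constructor
        · intro h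
          exact Set.mem_iUnion.2 ⟨leftVal Z n ω, (mem_leftEvent_iff hn hω _).2 rfl, h⟩
        · intro h
          obtain ⟨y, h1, h2⟩ := Set.mem_iUnion.1 h
          rw [mem_leftEvent_iff hn hω] at h1
          show Z n ω - leftVal Z n ω = x
          rw [h1]; exact h2
      have hJint : Integrable (J.indicator fun _ => (1 : ℝ)) P := by
        have : Integrable (J'.indicator fun _ => (1 : ℝ)) P := (integrable_const 1).indicator hJ'm
        exact this.congr (indicator_ae_eq_of_ae_eq_set hJJ'.symm)
      set B : Set (D.Sample S) := leftEvent Z n y ∩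
        {ω | shiftConfig x (shiftConfig y (ω.1.1 n)) ∈ N} with hB
      have hBm : MeasurableSet[preJumpSigma Z n] B := by
        refine MeasurableSet.inter (m := preJumpSigma Z n) (measurableSet_leftEvent hn y) ?_
        have h1 : Measurable[preJumpSigma Z n] fun ω : D.Sample S => ω.1.1 (n : ℝ≥0) := by
          refine Measurable.mono (comap_measurable _) ?_ le_rfl
          exact (le_iSup₂ (f := fun u (_ : u ≤ (n : ℝ≥0)) => MeasurableSpace.comap
            (fun ω : D.Sample S => ω.1.1 u) inferInstance) (n : ℝ≥0) le_rfl).trans le_sup_left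
        exact h1 (measurable_shiftConfig y (measurable_shiftConfig x hN))
      have h1 : ∫ ω in B, (J.indicator fun _ => (1 : ℝ)) ω ∂P = 0 := by
        rw [← setIntegral_condExp hle hJint hBm]
        refine integral_eq_zero_of_ae ?_
        rw [EventuallyEq, ae_restrict_iff' (hle _ hBm)]
        filter_upwards [hA3 n hn x, hqN', hZ.cadlag] with ω h2 h3 h4 h5
        rw [h2, (mem_leftEvent_iff hn h4 y).1 h5.1, Measure.real, h3 y x h5.2]
        rfl
      have h2 : P (B ∩ J') = 0 := by
        have h3 : ∫ ω in B, (J'.indicator fun _ => (1 : ℝ)) ω ∂P = 0 := by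
          rw [← h1]
          exact integral_congr_ae (ae_restrict_of_ae (indicator_ae_eq_of_ae_eq_set hJJ'.symm))
        rw [setIntegral_indicator hJ'm, setIntegral_const, smul_eq_mul, mul_one,
          measureReal_eq_zero_iff] at h3
        exact h3
      filter_upwards [measure_eq_zero_iff_ae_notMem.1 h2, hJJ'] with ω h3 h4 h5 h6 h7
      exact h3 ⟨⟨h5, h6⟩, h4.mp h7⟩
    have hall : ∀ᵐ ω ∂P, ∀ x y, ω ∈ leftEvent Z n y →
        shiftConfig x (shiftConfig y (ω.1.1 n)) ∈ N → Z n ω - leftVal Z n ω ≠ x :=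
      ae_all_iff.2 fun x => ae_all_iff.2 fun y => hnull x y
    filter_upwards [hall, hZ.cadlag] with ω h1 h2 h3
    refine h1 (Z n ω - leftVal Z n ω) (leftVal Z n ω) ((mem_leftEvent_iff hn h2 _).2 rfl) ?_ rfl
    rw [shiftConfig_shiftConfig, add_sub_cancel, ← initial_fromWalk]
    exact h3

/-- Almost sure properties hold for a set of configurations that the walk never leaves. -/
lemma exists_closed_good (hK : IsMarkovFamily K) (hKtrans : IsTranslationInvariantFamily K)
    [IsProbabilityMeasure μ] (hμ : IsTranslationInvariantEquilibrium K μ)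
    (hZ : IsWalkFunctional (lawMix K ν (muBar K ν q μ)) Z)
    (hA3 : A3 (lawMix K ν (muBar K ν q μ)) q Z) {p : Config d E → Prop}
    (hp : ∀ᵐ η ∂(muBar K ν q μ), p η) {r : D.Sample S → Prop}
    (hr : ∀ᵐ ω ∂(lawMix K ν (muBar K ν q μ)), r ω) :
    ∃ good : Set (Config d E), (∀ᵐ η ∂(muBar K ν q μ), η ∈ good) ∧ ∀ η ∈ good, p η ∧
      ∀ᵐ ω ∂(lawKernel K ν η), r ω ∧ ∀ n, r (fromWalk Z n ω) ∧ initial (fromWalk Z n ω) ∈ good := by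
  have hZm : ∀ t, Measurable (Z t) := fun t => (hZ.adapted t).mono (histSigma_le t) le_rfl
  set P := lawMix K ν (muBar K ν q μ) with hP
  -- Neither `r` nor `p` is assumed measurable, so their exceptional sets are replaced by measurable
  -- hulls of measure zero.
  set M := toMeasurable P {ω | ¬ r ω} with hM
  have hMm : MeasurableSet M := measurableSet_toMeasurable _ _
  have hM0 : ∀ᵐ η ∂(muBar K ν q μ), lawKernel K ν η M = 0 := by
    rw [← lawMix_eq_zero_iff hMm, hM, measure_toMeasurable]
    exact ae_iff.1 hr
  set N₀ := toMeasurable (muBar K ν q μ) {η | ¬ (p η ∧ lawKernel K ν η M = 0)} with hN₀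
  have hN₀0 : muBar K ν q μ N₀ = 0 := by
    rw [hN₀, measure_toMeasurable]; exact ae_iff.1 (hp.and hM0)
  have hinit : ∀ n, Measurable fun ω : D.Sample S => initial (fromWalk Z n ω) := fun n =>
    measurable_initial'.comp (measurable_fromWalk hZm n)
  -- the bad sets, enlarged step by step
  let bad : ℕ → Set (Config d E) := fun k => Nat.rec N₀ (fun _ A => A ∪
    ⋃ n, {η | lawKernel K ν η ((fun ω => initial (fromWalk Z n ω)) ⁻¹' A) ≠ 0}) k
  have hbad_succ : ∀ k, bad (k + 1) = bad k ∪
    ⋃ n, {η | lawKernel K ν η ((fun ω => initial (fromWalk Z n ω)) ⁻¹' bad k) ≠ 0} := fun k => rfl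
  have hbad : ∀ k, MeasurableSet (bad k) ∧ muBar K ν q μ (bad k) = 0 := by
    intro k
    induction k with
    | zero => exact ⟨measurableSet_toMeasurable _ _, hN₀0⟩
    | succ k ih =>
      rw [hbad_succ]
      refine ⟨ih.1.union (MeasurableSet.iUnion fun n => ?_), ?_⟩
      · exact (measurableSet_eq_fun (Kernel.measurable_coe _ (hinit n ih.1))
          measurable_const).compl
      · refine measure_union_null ih.2 (measure_iUnion_null fun n => ?_)
        have h1 := ae_initial_fromWalk hK hμ hZ hA3 ih.1 ih.2 n
        have h2 : P ((fun ω => initial (fromWalk Z n ω)) ⁻¹' bad k) = 0 :=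
          measure_eq_zero_iff_ae_notMem.2 h1
        exact ae_iff.1 ((lawMix_eq_zero_iff (hinit n ih.1)).1 h2)
  -- A state outside `bad (k + 1)` almost surely never leads to `bad k`; being outside all of them
  -- is therefore preserved along the walk.
  refine ⟨(⋃ k, bad k)ᶜ, ?_, ?_⟩
  · exact measure_eq_zero_iff_ae_notMem.1 (measure_iUnion_null fun k => (hbad k).2)
  · intro η hη
    have hη' : ∀ k, η ∉ bad k := fun k h => hη (Set.mem_iUnion.2 ⟨k, h⟩)
    have hbase : ∀ η' ∉ bad 0, p η' ∧ lawKernel K ν η' M = 0 := by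
      intro η' h
      by_contra hcon
      exact h (subset_toMeasurable _ _ hcon)
    have hstay : ∀ᵐ ω ∂(lawKernel K ν η), ∀ n, initial (fromWalk Z n ω) ∈ (⋃ k, bad k)ᶜ := by
      rw [ae_all_iff]
      intro n
      have : ∀ᵐ ω ∂(lawKernel K ν η), ∀ k, initial (fromWalk Z n ω) ∉ bad k := by
        rw [ae_all_iff]
        intro k
        have h1 := hη' (k + 1)
        rw [hbad_succ] at h1
        have h2 : lawKernel K ν η ((fun ω => initial (fromWalk Z n ω)) ⁻¹' bad k) = 0 := by
          by_contra hcon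
          exact h1 (Or.inr (Set.mem_iUnion.2 ⟨n, hcon⟩))
        exact measure_eq_zero_iff_ae_notMem.1 h2
      filter_upwards [this] with ω hω h
      obtain ⟨k, hk⟩ := Set.mem_iUnion.1 h
      exact hω k hk
    have hr0 : ∀ᵐ ω ∂(lawKernel K ν η), ω ∉ M :=
      measure_eq_zero_iff_ae_notMem.1 (hbase η (hη' 0)).2
    -- The Markov property reduces this to the laws of the later states, for which `M` is null
    -- because those states have stayed good.
    have hrn : ∀ᵐ ω ∂(lawKernel K ν η), ∀ n, fromWalk Z n ω ∉ M := by
      rw [ae_all_iff]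
      intro n
      have h1 := lawKernel_markov_fromWalk (ν := ν) hK hKtrans hZ.adapted η n (B := Set.univ)
        MeasurableSet.univ hMm
      rw [Set.univ_inter] at h1
      refine measure_eq_zero_iff_ae_notMem.1 (h1.trans ?_)
      have h2 : Measurable fun ω => lawKernel K ν (initial (fromWalk Z n ω)) M :=
        (Kernel.measurable_coe _ hMm).comp (hinit n)
      rw [setLIntegral_univ, lintegral_eq_zero_iff h2]
      filter_upwards [hstay] with ω hω
      exact (hbase _ fun h => hω n (Set.mem_iUnion.2 ⟨0, h⟩)).2
    have hMr : ∀ ω ∉ M, r ω := fun ω h => by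
      by_contra hcon
      exact h (subset_toMeasurable P _ hcon)
    refine ⟨(hbase η (hη' 0)).1, ?_⟩
    filter_upwards [hr0, hrn, hstay] with ω h1 h2 h3
    exact ⟨hMr ω h1, fun n => ⟨hMr _ (h2 n), h3 n⟩⟩

end RWDRE
end

/-! ### Measurability in the cone and conditional cone mixing -/

noncomputable section

namespace RWDRE

lemma l1norm_add_le {d : ℕ} (x y : Site d) : l1norm (x + y) ≤ l1norm x + l1norm y := by
  unfold l1norm
  rw [← Finset.sum_add_distrib]
  refine Finset.sum_le_sum fun i _ => ?_
  simp only [Pi.add_apply, Int.cast_add]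
  exact abs_add_le _ _

@[simp] lemma l1norm_zero {d : ℕ} : l1norm (0 : Site d) = 0 := by simp [l1norm]

lemma abs_apply_le_l1norm {d : ℕ} (x : Site d) (i : Fin d) : |(x i : ℝ)| ≤ l1norm x :=
  Finset.single_le_sum (f := fun i => |(x i : ℝ)|) (fun _ _ => abs_nonneg _) (Finset.mem_univ i)

/-- Evaluating a measurable process at a countable-valued random index. -/
lemma measurable_eval_at {Ω β : Type*} [MeasurableSpace Ω] [MeasurableSpace β] {V : ℕ → Ω → β}
    (hV : ∀ n, Measurable (V n)) {N : Ω → ℕ} (hN : Measurable N) :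
    Measurable fun ω => V (N ω) ω := by
  have : Measurable fun p : Ω × ℕ => V p.2 p.1 := measurable_from_prod_countable_left hV
  exact this.comp (measurable_id.prodMk hN)

variable {d : ℕ} {E S : Type*} [MeasurableSpace E] [MeasurableSpace S] {D : PathSpace d E}

/-- `𝒞_{R,∞}(m) ∨ 𝒴_∞`. -/
abbrev coneNoise (D : PathSpace d E) (S : Type*) [MeasurableSpace S] (R : ℕ) (m : ℝ) :
    MeasurableSpace (D.Sample S) :=
  coneSigmaInf D S R m ⊔ noiseSigmaInf D S

variable {R : ℕ} {m : ℝ}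

lemma measurable_coneNoise_env {x : Site d} {u : ℝ≥0} (h : (x, u) ∈ cone d R m) :
    Measurable[coneNoise D S R m] fun ω : D.Sample S => ω.1.1 u x := by
  refine Measurable.mono (comap_measurable _) ?_ le_rfl
  refine le_trans ?_ le_sup_left
  exact le_iSup_of_le x (le_iSup_of_le u (le_iSup_of_le h le_rfl))

lemma measurable_coneNoise_noise (k : ℕ) :
    Measurable[coneNoise D S R m] fun ω : D.Sample S => ω.2 k := by
  refine Measurable.mono (comap_measurable _) ?_ le_rfl
  refine le_trans ?_ le_sup_right
  exact le_iSup_of_le k le_rfl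

lemma measurable_envAt_apply (u : ℝ≥0) (x : Site d) :
    Measurable fun ω : D.Sample S => ω.1.1 u x :=
  (measurable_pi_apply x).comp (measurable_envAt u)

lemma coneNoise_le : coneNoise D S R m ≤ (inferInstance : MeasurableSpace (D.Sample S)) :=
  sup_le (iSup_le fun x => iSup_le fun u => iSup_le fun _ => (measurable_envAt_apply u x).comap_le)
    (iSup_le fun k => ((measurable_pi_apply k).comp measurable_snd).comap_le)

lemma coneSigma_sup_noise_le (t : ℝ≥0) (n : ℕ) :
    coneSigma D S R m t ⊔ noiseSigma D S n ≤ coneNoise D S R m :=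
  sup_le (iSup_le fun _ => iSup_le fun _ => iSup_le fun h =>
    (measurable_coneNoise_env h.1).comap_le)
    (iSup_le fun k => iSup_le fun _ => (measurable_coneNoise_noise k).comap_le)

lemma coneSigma_sup_noise_le_hist (n : ℕ) :
    coneSigma D S R m (n : ℝ≥0) ⊔ noiseSigma D S n ≤ histSigma D S (n : ℝ≥0) := by
  refine sup_le (iSup_le fun x => iSup_le fun u => iSup_le fun h => ?_)
    (iSup_le fun k => iSup_le fun hk => (measurable_noiseAt_hist hk).comap_le)
  have h1 : Measurable[histSigma D S (n : ℝ≥0)] fun ω : D.Sample S => ω.1.1 u x :=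
    (measurable_pi_apply x).comp (measurable_envAt_hist h.2)
  exact h1.comap_le

/-- A shifted cone with apex inside a cone stays inside it. -/
lemma measurable_coneNoise_shift {x : Site d} {n : ℕ} (hx : l1norm x ≤ m * n) :
    Measurable[coneNoise D S R m, coneNoise D S R m]
      fun ω : D.Sample S => spaceShift x (timeShift (n : ℝ≥0) ω) := by
  rw [measurable_iff_comap_le, MeasurableSpace.comap_sup]
  simp only [MeasurableSpace.comap_iSup, MeasurableSpace.comap_comp]
  refine sup_le (iSup_le fun y => iSup_le fun u => iSup_le fun h => ?_) (iSup_le fun k => ?_)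
  · have hc : (x + y, (n : ℝ≥0) + u) ∈ cone d R m := by
      have h1 : l1norm y ≤ m * (u : ℝ) + R := h
      have h2 := l1norm_add_le x y
      show l1norm (x + y) ≤ m * (((n : ℝ≥0) + u : ℝ≥0) : ℝ) + R
      push_cast
      linarith
    exact (measurable_coneNoise_env (S := S) hc).comap_le
  · exact (measurable_coneNoise_noise (⌊(n : ℝ≥0)⌋₊ + k)).comap_le

lemma measurable_hist_shift (x : Site d) (j k : ℕ) :
    Measurable[histSigma D S ((j + k : ℕ) : ℝ≥0), histSigma D S (k : ℝ≥0)]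
      fun ω : D.Sample S => spaceShift x (timeShift (j : ℝ≥0) ω) := by
  rw [measurable_iff_comap_le, MeasurableSpace.comap_sup]
  simp only [MeasurableSpace.comap_iSup, MeasurableSpace.comap_comp]
  refine sup_le (iSup_le fun u => iSup_le fun hu => ?_) (iSup_le fun i => iSup_le fun hi => ?_)
  · have h1 : Measurable[histSigma D S ((j + k : ℕ) : ℝ≥0)]
        fun ω : D.Sample S => shiftConfig x (ω.1.1 ((j : ℝ≥0) + u)) := by
      refine (measurable_shiftConfig x).comp (measurable_envAt_hist ?_)
      push_cast
      gcongr
    exact h1.comap_le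
  · rw [Nat.ceil_natCast] at hi
    have h1 : ⌊(j : ℝ≥0)⌋₊ + i < j + k := by rw [Nat.floor_natCast]; omega
    exact (measurable_noiseAt_hist h1).comap_le

variable {Z : ℝ≥0 → D.Sample S → Site d}

lemma measurable_fromWalk_hist (hZ : ∀ t, Measurable[histSigma D S t] (Z t)) (j k : ℕ) :
    Measurable[histSigma D S ((j + k : ℕ) : ℝ≥0), histSigma D S (k : ℝ≥0)] (fromWalk Z j) := by
  intro A hA
  have h1 : fromWalk Z j ⁻¹' A = ⋃ x, {ω | Z j ω = x} ∩
      (fun ω : D.Sample S => spaceShift x (timeShift (j : ℝ≥0) ω)) ⁻¹' A := by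
    ext ω
    simp [fromWalk]
  rw [h1]
  refine MeasurableSet.iUnion (m := histSigma D S ((j + k : ℕ) : ℝ≥0)) fun x =>
    MeasurableSet.inter (m := histSigma D S ((j + k : ℕ) : ℝ≥0)) ?_
      (measurable_hist_shift x j k hA)
  have hle : histSigma D S (j : ℝ≥0) ≤ histSigma D S ((j + k : ℕ) : ℝ≥0) :=
    histSigma_mono (by push_cast; exact le_self_add)
  exact hle _ (hZ j (measurableSet_singleton x))

lemma measurableSet_coneEvent_inter (hA2 : A2 Z R) (hm : 0 < m) (t : ℝ≥0) (y : Site d) :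
    MeasurableSet[coneNoise D S R m] (coneEvent Z m ∩ {ω | Z t ω = y}) := by
  have h1 : coneEvent Z m ∩ {ω | Z t ω = y}
      = coneEvent Z m ∩ (coneEvent Z m).indicator (Z t) ⁻¹' {y} := by
    ext ω
    refine and_congr_right fun h => ?_
    simp [Set.indicator_of_mem h]
  rw [h1]
  exact MeasurableSet.inter (m := coneNoise D S R m) (hA2 m hm).1
    ((hA2 m hm).2 t (measurableSet_singleton y))

/-- On `coneEvent` the position at time `n` is within distance `m * n`, so the cone seen from there
lies inside the original one. Summing over these positions keeps the event observable in the cone.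
-/
lemma measurableSet_coneEvent_fromWalk (hA2 : A2 Z R) (hm : 0 < m) (n : ℕ)
    {A : Set (D.Sample S)} (hA : MeasurableSet[coneNoise D S R m] A) :
    MeasurableSet[coneNoise D S R m] (coneEvent Z m ∩ fromWalk Z n ⁻¹' A) := by
  have h1 : coneEvent Z m ∩ fromWalk Z n ⁻¹' A = ⋃ y, ⋃ _ : l1norm y ≤ m * n,
      (coneEvent Z m ∩ {ω | Z n ω = y}) ∩
        (fun ω : D.Sample S => spaceShift y (timeShift (n : ℝ≥0) ω)) ⁻¹' A := by
    ext ω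
    simp only [Set.mem_inter_iff, Set.mem_preimage, Set.mem_iUnion, Set.mem_ofPred_eq,
      exists_prop, fromWalk]
    constructor
    · rintro ⟨h1, h2⟩
      exact ⟨Z n ω, by simpa using h1 n, ⟨h1, rfl⟩, h2⟩
    · rintro ⟨y, -, ⟨h1, rfl⟩, h2⟩
      exact ⟨h1, h2⟩
  rw [h1]
  refine MeasurableSet.iUnion (m := coneNoise D S R m) fun y =>
    MeasurableSet.iUnion (m := coneNoise D S R m) fun hy =>
    MeasurableSet.inter (m := coneNoise D S R m) (measurableSet_coneEvent_inter hA2 hm n y)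
      (measurable_coneNoise_shift hy hA)

lemma measurable_integral_right {α β : Type*} [MeasurableSpace α] [MeasurableSpace β]
    (N : Measure β) [SFinite N] {g : α × β → ℝ} (hg : Measurable g) :
    Measurable fun x => ∫ y, g (x, y) ∂N :=
  (hg.stronglyMeasurable.integral_prod_right').measurable

/-- Cone observables, averaged over the noise, only depend on the environment in the cone. -/
lemma measurable_coneSigmaInf_integral (N : Measure (ℕ → S)) [SFinite N] {g : D.Sample S → ℝ}
    (hg : Measurable[coneNoise D S R m] g) :
    Measurable[coneSigmaInf D S R m] fun ω : D.Sample S => ∫ y, g (ω.1, y) ∂N := by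
  let pathCone : MeasurableSpace D.Path := ⨆ (x : Site d) (u : ℝ≥0) (_ : (x, u) ∈ cone d R m),
    MeasurableSpace.comap (fun ξ : D.Path => ξ.1 u x) inferInstance
  have h1 : coneNoise D S R m = @Prod.instMeasurableSpace _ _ pathCone MeasurableSpace.pi := by
    unfold Prod.instMeasurableSpace MeasurableSpace.prod MeasurableSpace.pi
    simp only [pathCone, MeasurableSpace.comap_iSup, MeasurableSpace.comap_comp]
    rfl
  have h2 : coneSigmaInf D S R m = MeasurableSpace.comap Prod.fst pathCone := by
    simp only [pathCone, MeasurableSpace.comap_iSup, MeasurableSpace.comap_comp]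
    rfl
  rw [h1] at hg
  rw [h2]
  have h4 : Measurable[pathCone] fun ξ : D.Path => ∫ y, g (ξ, y) ∂N :=
    @measurable_integral_right D.Path (ℕ → S) pathCone _ N _ g hg
  exact h4.comp (comap_measurable (m := pathCone) Prod.fst)

variable {K : Kernel (Config d E) D.Path} [IsMarkovKernel K] {ν : Measure S}
  [IsProbabilityMeasure ν]

lemma lintegral_timeShift (hK : IsMarkovFamily K) (η : Config d E) (n : ℕ) {B : Set (D.Sample S)}
    (hB : MeasurableSet[histSigma D S (n : ℝ≥0)] B) {f : D.Sample S → ℝ≥0∞} (hf : Measurable f) :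
    ∫⁻ ω in B, f (timeShift (n : ℝ≥0) ω) ∂(lawKernel K ν η)
      = ∫⁻ ω in B, ∫⁻ ω', f ω' ∂(lawKernel K ν (ω.1.1 n)) ∂(lawKernel K ν η) := by
  have hker : Measurable fun ω : D.Sample S => lawKernel K ν (ω.1.1 n) :=
    (lawKernel K ν).measurable.comp (measurable_envAt _)
  have key : ((lawKernel K ν η).restrict B).map (timeShift (n : ℝ≥0))
      = ((lawKernel K ν η).restrict B).bind (fun ω => lawKernel K ν (ω.1.1 n)) := by
    ext C hC
    rw [Measure.map_apply (measurable_timeShift _) hC, Measure.bind_apply hC hker.aemeasurable,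
      Measure.restrict_apply (measurable_timeShift _ hC), Set.inter_comm,
      lawKernel_markov hK η n hB hC]
  rw [← lintegral_map hf (measurable_timeShift _), key,
    Measure.lintegral_bind hker.aemeasurable hf.aemeasurable]

/-- Given the history at time `n`, the later noise is independent of the later environment and can
be integrated out. This is needed because the mixing hypothesis tests functions of the environment
only, while rewards also involve noise. -/
lemma setIntegral_timeShift_average (hK : IsMarkovFamily K) (η : Config d E) (n : ℕ)
    {B : Set (D.Sample S)} (hB : MeasurableSet[histSigma D S (n : ℝ≥0)] B) {g : D.Sample S → ℝ}
    (hg : Measurable g) (hg0 : ∀ ω, 0 ≤ g ω) {b : ℝ} (hgb : ∀ ω, g ω ≤ b) :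
    ∫ ω in B, g (timeShift (n : ℝ≥0) ω) ∂(lawKernel K ν η)
      = ∫ ω in B, (fun ω' : D.Sample S => ∫ y, g (ω'.1, y) ∂(Measure.infinitePi fun _ : ℕ => ν))
          (timeShift (n : ℝ≥0) ω) ∂(lawKernel K ν η) := by
  set N := Measure.infinitePi fun _ : ℕ => ν with hN
  have hfm : Measurable fun ω' : D.Sample S => ∫ y, g (ω'.1, y) ∂N :=
    (hg.stronglyMeasurable.integral_prod_right').measurable.comp measurable_fst
  have hf0 : ∀ ω' : D.Sample S, 0 ≤ ∫ y, g (ω'.1, y) ∂N := fun ω' =>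
    integral_nonneg fun y => hg0 _
  rw [integral_eq_lintegral_of_nonneg_ae (Eventually.of_forall fun ω => hg0 _)
      (hg.comp (measurable_timeShift _)).aestronglyMeasurable,
    integral_eq_lintegral_of_nonneg_ae (Eventually.of_forall fun ω => hf0 _)
      (hfm.comp (measurable_timeShift _)).aestronglyMeasurable,
    lintegral_timeShift hK η n hB (f := fun ω => ENNReal.ofReal (g ω)) hg.ennreal_ofReal,
    lintegral_timeShift hK η n hB (f := fun ω' => ENNReal.ofReal (∫ y, g (ω'.1, y) ∂N))
      hfm.ennreal_ofReal]
  congr 1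
  refine lintegral_congr fun ω => ?_
  rw [lawKernel_apply, lawFrom, lintegral_prod _ hg.ennreal_ofReal.aemeasurable,
    lintegral_prod _ hfm.ennreal_ofReal.aemeasurable]
  refine lintegral_congr fun ξ => ?_
  simp only [lintegral_const, measure_univ, mul_one]
  rw [ofReal_integral_eq_lintegral_ofReal]
  · refine Integrable.of_bound (hg.comp measurable_prodMk_left).aestronglyMeasurable b
      (Eventually.of_forall fun y => ?_)
    rw [Real.norm_of_nonneg (hg0 _)]
    exact hgb _
  · exact Eventually.of_forall fun y => hg0 _

/-- The conditional mean of `g` after time `L`, given the event `B`. -/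
def condMean (K : Kernel (Config d E) D.Path) [IsMarkovKernel K] (ν : Measure S)
    [IsProbabilityMeasure ν] (B : Set (D.Sample S)) (L : ℕ) (g : D.Sample S → ℝ)
    (η : Config d E) : ℝ :=
  (∫ ω in B, g (timeShift (L : ℝ≥0) ω) ∂(lawKernel K ν η)) / (lawKernel K ν η).real B

lemma integral_cond_eq {Ω : Type*} [MeasurableSpace Ω] (P : Measure Ω) (B : Set Ω) (f : Ω → ℝ) :
    ∫ ω, f ω ∂(ProbabilityTheory.cond P B) = (∫ ω in B, f ω ∂P) / P.real B := by
  rw [ProbabilityTheory.cond, integral_smul_measure, smul_eq_mul, ENNReal.toReal_inv, inv_mul_eq_div]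
  rfl

/-- Conditional cone mixing for observables of the cone and the noise. -/
lemma condMean_sub_le (hK : IsMarkovFamily K) {B : Set (D.Sample S)} {L : ℕ}
    (hB : MeasurableSet[histSigma D S (L : ℝ≥0)] B) {Φ : ℝ} {c : (D.Sample S → ℝ) → ℝ}
    (hΦ : 0 ≤ Φ) {good : Set (Config d E)}
    (hmix : ∀ η ∈ good, ∀ f : D.Sample S → ℝ, Measurable[coneSigmaInf D S R m] f →
      (∀ ω, 0 ≤ f ω) → BddAbove (Set.range f) →
      |∫ ω, f (timeShift (L : ℝ≥0) ω) ∂(ProbabilityTheory.cond (lawFrom K ν η) B) - c f| ≤ Φ * ⨆ ω, f ω)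
    {g : D.Sample S → ℝ} (hg : Measurable[coneNoise D S R m] g) (hg0 : ∀ ω, 0 ≤ g ω) {b : ℝ}
    (hb : 0 ≤ b) (hgb : ∀ ω, g ω ≤ b) {η η' : Config d E} (hη : η ∈ good) (hη' : η' ∈ good) :
    |condMean K ν B L g η - condMean K ν B L g η'| ≤ 2 * Φ * b := by
  set N := Measure.infinitePi fun _ : ℕ => ν with hN
  set f : D.Sample S → ℝ := fun ω => ∫ y, g (ω.1, y) ∂N with hf
  have hgm : Measurable g := hg.mono coneNoise_le le_rfl
  have hf0 : ∀ ω, 0 ≤ f ω := fun ω => integral_nonneg fun y => hg0 _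
  have hfb : ∀ ω, f ω ≤ b := by
    intro ω
    have h1 : f ω ≤ ∫ _y, b ∂N := by
      refine integral_mono_of_nonneg (Eventually.of_forall fun y => hg0 _) (integrable_const _)
        (Eventually.of_forall fun y => hgb _)
    simpa using h1
  have hbdd : BddAbove (Set.range f) := ⟨b, by rintro _ ⟨ω, rfl⟩; exact hfb ω⟩
  have hsup : ⨆ ω, f ω ≤ b := Real.iSup_le hfb hb
  -- The reference value `c f` is common to all good states and otherwise irrelevant; comparing two
  -- states with it doubles the error.
  have key : ∀ η ∈ good, |condMean K ν B L g η - c f| ≤ Φ * b := by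
    intro η hη
    have h1 := hmix η hη f (measurable_coneSigmaInf_integral N hg) hf0 hbdd
    rw [integral_cond_eq, ← lawKernel_apply] at h1
    rw [condMean, setIntegral_timeShift_average hK η L hB hgm hg0 hgb]
    exact h1.trans (mul_le_mul_of_nonneg_left hsup hΦ)
  have h1 := abs_le.1 (key η hη)
  have h2 := abs_le.1 (key η' hη')
  exact abs_le.2 ⟨by linarith, by linarith⟩

end RWDRE
end

/-! ### Pathwise description of a trial -/

noncomputable section

namespace RWDRE

/-- A right-continuous integer-valued path takes each of its values at rational times that lie
arbitrarily closely to the right. -/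
lemma exists_nnrat_right {d : ℕ} {z : ℝ≥0 → Site d} {t : ℝ≥0}
    (hz : ContinuousWithinAt z (Set.Ici t) t) {p : ℝ≥0 → Prop} (hp : ∀ᶠ s in 𝓝[>] t, p s) :
    ∃ s : ℚ≥0, t < (s : ℝ≥0) ∧ z s = z t ∧ p s := by
  have h1 : ∀ᶠ s in 𝓝[>] t, z s = z t := by
    have h2 : ∀ᶠ s in 𝓝[≥] t, z s ∈ ({z t} : Set (Site d)) :=
      hz.eventually (IsOpen.mem_nhds (isOpen_discrete _) rfl)
    exact h2.filter_mono (nhdsWithin_mono _ Set.Ioi_subset_Ici_self)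
  obtain ⟨u, hu, hsub⟩ := (mem_nhdsGT_iff_exists_Ioo_subset).1 (h1.and hp)
  obtain ⟨s, hs0, hs1, hs2⟩ := (NNReal.lt_iff_exists_rat_btwn t u).1 hu
  lift s to ℚ≥0 using hs0
  have hs : Real.toNNReal (((s : ℚ) : ℝ)) = (s : ℝ≥0) := by
    apply NNReal.eq
    rw [Real.coe_toNNReal _ (by positivity)]
    simp
    rfl
  rw [hs] at hs1 hs2
  exact ⟨s, hs1, hsub ⟨hs1, hs2⟩⟩

variable {d : ℕ} {E S : Type*}

section Paths

variable {D : PathSpace d E}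

/-- The almost sure properties of the walk: the path is càdlàg and starts at the origin, it is
additive at integer times, and it stands still up to time `L` on the event `G`. -/
structure RegularSample (Z : ℝ≥0 → D.Sample S → Site d) (G : Set (D.Sample S)) (L : ℕ)
    (ω : D.Sample S) : Prop where
  cadlag : IsCadlag fun t => Z t ω
  zero : Z 0 ω = 0
  add : ∀ (n : ℕ) (t : ℝ≥0), Z (t + n) ω = Z n ω + Z t (fromWalk Z n ω)
  still : ω ∈ G → ∀ t : ℝ≥0, t ≤ L → Z t ω = 0

/-- The event that the trial succeeds: `G` occurs, and after time `L` the walk stays in the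
cone. -/
def successEvent (Z : ℝ≥0 → D.Sample S → Site d) (m : ℝ) (G : Set (D.Sample S)) (L : ℕ) :
    Set (D.Sample S) :=
  G ∩ timeShift (L : ℝ≥0) ⁻¹' coneEvent Z m

/-- The event that the trial has not failed until time `n * L`. -/
def intactEvent (Z : ℝ≥0 → D.Sample S → Site d) (m : ℝ) (G : Set (D.Sample S)) (L n : ℕ) :
    Set (D.Sample S) :=
  G ∩ ⋂ (s : ℚ≥0) (_ : (s : ℝ≥0) ≤ ((n - 1) * L : ℕ)),
    {ω | l1norm (Z ((s : ℝ≥0) + L) ω) ≤ m * ((s : ℝ≥0) : ℝ)}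

variable {Z : ℝ≥0 → D.Sample S → Site d} {m : ℝ} {G : Set (D.Sample S)} {L : ℕ} {ω : D.Sample S}

namespace RegularSample

/-- Additivity makes successive displacements add up to the displacement at `j + k`, so the space
shifts compose to the right one. -/
lemma fromWalk_fromWalk (h : RegularSample Z G L ω) (j k : ℕ) :
    fromWalk Z k (fromWalk Z j ω) = fromWalk Z (j + k) ω := by
  have h1 := h.add j k
  rw [fromWalk, fromWalk, timeShift_spaceShift, timeShift_natCast_timeShift, spaceShift_spaceShift,
    fromWalk, ← fromWalk, ← h1]
  push_cast
  rw [add_comm (k : ℝ≥0)]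

lemma fromWalk_zero (h : RegularSample Z G L ω) : fromWalk Z 0 ω = ω := by
  rw [fromWalk, Nat.cast_zero, h.zero, spaceShift_zero, timeShift_zero]

lemma fromWalk_of_mem (h : RegularSample Z G L ω) (hω : ω ∈ G) :
    fromWalk Z L ω = timeShift (L : ℝ≥0) ω := by
  rw [fromWalk, h.still hω L le_rfl, spaceShift_zero]

lemma apply_timeShift (h : RegularSample Z G L ω) (hω : ω ∈ G) (t : ℝ≥0) :
    Z t (timeShift (L : ℝ≥0) ω) = Z (t + L) ω := by
  rw [h.add, h.still hω L le_rfl, h.fromWalk_of_mem hω, zero_add]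

lemma mem_success_iff (h : RegularSample Z G L ω) :
    ω ∈ successEvent Z m G L ↔ ω ∈ G ∧ ∀ t : ℝ≥0, l1norm (Z (t + L) ω) ≤ m * t := by
  refine and_congr_right fun hω => forall_congr' fun t => ?_
  rw [h.apply_timeShift hω]

/-- A violation at a real time persists, by right-continuity, at rational times slightly later. -/
lemma mem_intact_iff (h : RegularSample Z G L ω) (n : ℕ) :
    ω ∈ intactEvent Z m G L n ↔ ω ∈ G ∧ ∀ t : ℝ≥0, t ≤ ((n - 1) * L : ℕ) →
      l1norm (Z (t + L) ω) ≤ m * t := by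
  refine and_congr_right fun hω => ?_
  simp only [Set.mem_iInter, Set.mem_ofPred_eq]
  refine ⟨fun hs t ht => ?_, fun hs s hs' => hs _ hs'⟩
  -- At the right endpoint there is no room for a later rational time within the window, but the
  -- endpoint is itself a natural number.
  rcases ht.eq_or_lt with rfl | ht
  · have key : ((((n - 1) * L : ℕ) : ℚ≥0) : ℝ≥0) = (((n - 1) * L : ℕ) : ℝ≥0) :=
      NNRat.cast_natCast _
    have := hs _ key.le
    rwa [key] at this
  by_contra hlt
  push Not at hlt
  have hc : ContinuousWithinAt (fun s => Z (s + L) ω) (Set.Ici t) t := by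
    refine (h.cadlag (t + L)).1.comp (f := fun s => s + (L : ℝ≥0))
      (continuous_add_const _).continuousWithinAt fun s hs => ?_
    exact add_le_add_left (Set.mem_Ici.1 hs) _
  have hp : ∀ᶠ s : ℝ≥0 in 𝓝[>] t, s ≤ ((n - 1) * L : ℕ) ∧ m * s < l1norm (Z (t + L) ω) := by
    refine Eventually.filter_mono nhdsWithin_le_nhds (Eventually.and ?_ ?_)
    · exact (eventually_lt_nhds ht).mono fun s hs => hs.le
    · have : Continuous fun s : ℝ≥0 => m * (s : ℝ) := by fun_prop
      exact this.continuousAt.eventually_lt continuousAt_const hlt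
  obtain ⟨s, -, h1, h2, h3⟩ := exists_nnrat_right hc hp
  have := hs s h2
  rw [h1] at this
  linarith

lemma l1norm_le_of_success (h : RegularSample Z G L ω) (hm : 0 ≤ m)
    (hω : ω ∈ successEvent Z m G L) (t : ℝ≥0) : l1norm (Z t ω) ≤ m * t := by
  rw [h.mem_success_iff] at hω
  rcases le_total t L with ht | ht
  · rw [h.still hω.1 t ht, l1norm_zero]; positivity
  · have h1 := hω.2 (t - L)
    rw [tsub_add_cancel_of_le ht] at h1
    refine h1.trans (mul_le_mul_of_nonneg_left ?_ hm)
    exact_mod_cast tsub_le_self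

lemma success_iff (h : RegularSample Z G L ω) (hL : 1 ≤ L) :
    ω ∈ successEvent Z m G L ↔ ∀ n, 1 ≤ n → ω ∈ intactEvent Z m G L n := by
  rw [h.mem_success_iff]
  simp_rw [h.mem_intact_iff]
  refine ⟨fun hω n _ => ⟨hω.1, fun t _ => hω.2 t⟩, fun hω => ⟨(hω 1 le_rfl).1, fun t => ?_⟩⟩
  obtain ⟨n, hn⟩ := exists_nat_ge t
  refine (hω (n + 1) (by omega)).2 t (hn.trans ?_)
  rw [Nat.add_sub_cancel]
  exact_mod_cast Nat.le_mul_of_pos_right n hL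

/-- Being intact bounds the position at time `L * n` by `m * ((n - 1) * L)`, and the successful
trial there bounds every later displacement by `m` times the elapsed time. By the triangle
inequality the walk stays in the cone with apex at time `L`. -/
lemma glue (h : RegularSample Z G L ω) (hm : 0 ≤ m) {n : ℕ} (hn : 1 ≤ n)
    (h' : RegularSample Z G L (fromWalk Z (L * n) ω))
    (hs : fromWalk Z (L * n) ω ∈ successEvent Z m G L) :
    ω ∈ successEvent Z m G L ↔ ω ∈ intactEvent Z m G L n := by
  rw [h.mem_success_iff, h.mem_intact_iff]
  refine ⟨fun hω => ⟨hω.1, fun t _ => hω.2 t⟩, fun hω => ⟨hω.1, fun t => ?_⟩⟩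
  rcases le_total t ((n - 1) * L : ℕ) with ht | ht
  · exact hω.2 t ht
  · obtain ⟨u, rfl⟩ := exists_add_of_le ht
    have h1 := hω.2 _ le_rfl
    have h2 := h'.l1norm_le_of_success hm hs u
    have hcast : (((n - 1) * L : ℕ) : ℝ≥0) + L = ((L * n : ℕ) : ℝ≥0) := by
      rw [← Nat.cast_add]
      congr 1
      obtain ⟨k, rfl⟩ := Nat.exists_eq_add_of_le hn
      rw [Nat.add_sub_cancel_left]; ring
    rw [hcast] at h1
    have h3 : (((n - 1) * L : ℕ) : ℝ≥0) + u + L = u + ((L * n : ℕ) : ℝ≥0) := by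
      rw [← hcast]; ring
    rw [h3, h.add]
    refine (l1norm_add_le _ _).trans ?_
    push_cast at h1 ⊢
    linarith

lemma exitTime_eq_top_iff (h : RegularSample Z G L ω) (hω : ω ∈ G) :
    exitTime Z m (timeShift (L : ℝ≥0) ω) = ∞ ↔ ω ∈ successEvent Z m G L := by
  simp only [exitTime, iInf_eq_top, ENNReal.coe_ne_top, imp_false, not_and, not_lt, successEvent,
    Set.mem_inter_iff, hω, true_and, Set.mem_preimage, coneEvent, Set.mem_ofPred_eq]
  refine ⟨fun h1 t => ?_, fun h1 t _ => h1 t⟩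
  -- The exit time ignores `t = 0`, where the walk is still at the origin.
  rcases eq_or_ne t 0 with rfl | ht
  · rw [h.apply_timeShift hω, zero_add, h.still hω L le_rfl]; simp
  · exact h1 t (pos_iff_ne_zero.2 ht)

/-- At index `j + 1` the cone condition has been checked up to `j * L` after the first `L` units, so
a failure seen only at the next index forces an exit no earlier than `j * L`. -/
lemma exitTime_of_fail (h : RegularSample Z G L ω) {j : ℕ} (h1 : ω ∈ intactEvent Z m G L (j + 1))
    (h2 : ω ∉ intactEvent Z m G L (j + 2)) :
    exitTime Z m (timeShift (L : ℝ≥0) ω) < ∞ ∧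
      ((j * L : ℕ) : ℝ≥0∞) ≤ exitTime Z m (timeShift (L : ℝ≥0) ω) := by
  rw [h.mem_intact_iff] at h1 h2
  push Not at h2
  obtain ⟨t, -, ht⟩ := h2 h1.1
  constructor
  · rw [lt_top_iff_ne_top, Ne, h.exitTime_eq_top_iff h1.1, h.mem_success_iff]
    exact fun hs => absurd (hs.2 t) (not_le.2 ht)
  · refine le_iInf₂ fun s hs => ?_
    rw [h.apply_timeShift h1.1] at hs
    by_contra hlt
    push Not at hlt
    have h3 : s < ((j * L : ℕ) : ℝ≥0) := by exact_mod_cast hlt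
    exact absurd (h1.2 s (by simpa using h3.le)) (not_le.2 hs.2)

end RegularSample

end Paths

end RWDRE
end

/-! ### The regeneration assumptions as a trial system -/

noncomputable section

namespace RWDRE

variable {d : ℕ} {E S : Type*} [MeasurableSpace E] [MeasurableSpace S] {D : PathSpace d E}

/-- The regeneration assumptions for a fixed trial length `L`, with the almost sure statements
made sure on a set `good` of initial configurations that the walk never leaves. -/
structure TrialModel (K : Kernel (Config d E) D.Path) [IsMarkovKernel K] (ν : Measure S)
    [IsProbabilityMeasure ν] (Z : ℝ≥0 → D.Sample S → Site d) (R : ℕ) (m : ℝ)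
    (G : Set (D.Sample S)) (L : ℕ) (good : Set (Config d E)) (a γ κ ψ Φ : ℝ) : Prop where
  markovFamily : IsMarkovFamily K
  translationInvariant : IsTranslationInvariantFamily K
  adapted : ∀ t, Measurable[histSigma D S t] (Z t)
  local_cone : A2 Z R
  m_pos : 0 < m
  one_le : 1 ≤ L
  measurableSet_event : MeasurableSet[coneSigma D S R m (L : ℝ≥0) ⊔ noiseSigma D S L] G
  one_lt : 1 < a
  γ_pos : 0 < γ
  κ_pos : 0 < κ
  ψ_nonneg : 0 ≤ ψ
  Φ_nonneg : 0 ≤ Φ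
  event_prob : ∀ η ∈ good, γ ≤ (lawFrom K ν η).real G
  stay : ∀ η ∈ good, κ ≤ (ProbabilityTheory.cond (lawFrom K ν η) G).real
    {ω | exitTime Z m (timeShift (L : ℝ≥0) ω) = ∞}
  moment : ∀ η ∈ good, ∫⁻ ω, {ω' | exitTime Z m (timeShift (L : ℝ≥0) ω') < ∞}.indicator
      (fun ω' => exitTime Z m (timeShift (L : ℝ≥0) ω') ^ a) ω
      ∂(ProbabilityTheory.cond (lawFrom K ν η) G) ≤ ENNReal.ofReal (ψ ^ a)
  mixing : ∃ c : (D.Sample S → ℝ) → ℝ, ∀ η ∈ good, ∀ f : D.Sample S → ℝ,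
    Measurable[coneSigmaInf D S R m] f → (∀ ω, 0 ≤ f ω) → BddAbove (Set.range f) →
      |∫ ω, f (timeShift (L : ℝ≥0) ω) ∂(ProbabilityTheory.cond (lawFrom K ν η) G) - c f|
        ≤ Φ * ⨆ ω, f ω
  regular : ∀ η ∈ good, ∀ᵐ ω ∂(lawKernel K ν η), RegularSample Z G L ω ∧
    ∀ n, RegularSample Z G L (fromWalk Z n ω) ∧ initial (fromWalk Z n ω) ∈ good

lemma measurableSet_successEvent {Z : ℝ≥0 → D.Sample S → Site d} {R : ℕ} {m : ℝ} (hm : 0 < m)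
    {G : Set (D.Sample S)} {L : ℕ} (hA2 : A2 Z R)
    (hG : MeasurableSet[coneSigma D S R m (L : ℝ≥0) ⊔ noiseSigma D S L] G) :
    MeasurableSet (successEvent Z m G L) :=
  (((coneSigma_sup_noise_le _ _).trans coneNoise_le) _ hG).inter
    (measurable_timeShift _ (coneNoise_le _ (hA2 m hm).1))

lemma measurableSet_intactEvent {Z : ℝ≥0 → D.Sample S → Site d}
    (hZ : ∀ t, Measurable[histSigma D S t] (Z t)) {R : ℕ} {m : ℝ}
    {G : Set (D.Sample S)} {L : ℕ}
    (hG : MeasurableSet[coneSigma D S R m (L : ℝ≥0) ⊔ noiseSigma D S L] G) {n : ℕ} (hn : 1 ≤ n) :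
    MeasurableSet[histSigma D S ((L * n : ℕ) : ℝ≥0)] (intactEvent Z m G L n) := by
  refine MeasurableSet.inter (m := histSigma D S ((L * n : ℕ) : ℝ≥0)) ?_
    (MeasurableSet.iInter (m := histSigma D S ((L * n : ℕ) : ℝ≥0)) fun s =>
      MeasurableSet.iInter (m := histSigma D S ((L * n : ℕ) : ℝ≥0)) fun hs => ?_)
  · have h1 : (L : ℝ≥0) ≤ ((L * n : ℕ) : ℝ≥0) := by exact_mod_cast Nat.le_mul_of_pos_right L hn
    exact histSigma_mono h1 _ (coneSigma_sup_noise_le_hist L _ hG)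
  · have h1 : (s : ℝ≥0) + L ≤ ((L * n : ℕ) : ℝ≥0) := by
      have hcast : (((n - 1) * L : ℕ) : ℝ≥0) + L = ((L * n : ℕ) : ℝ≥0) := by
        rw [← Nat.cast_add]
        congr 1
        obtain ⟨k, rfl⟩ := Nat.exists_eq_add_of_le hn
        rw [Nat.add_sub_cancel_left]; ring
      rw [← hcast]
      gcongr
    exact histSigma_mono h1 _ (hZ _ (MeasurableSet.of_discrete
      (s := {x : Site d | l1norm x ≤ m * ((s : ℝ≥0) : ℝ)})))

namespace TrialModel

variable {K : Kernel (Config d E) D.Path} [IsMarkovKernel K] {ν : Measure S}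
  [IsProbabilityMeasure ν] {Z : ℝ≥0 → D.Sample S → Site d} {R : ℕ} {m : ℝ} {G : Set (D.Sample S)}
  {L : ℕ} {good : Set (Config d E)} {a γ κ ψ Φ : ℝ}

section

variable (h : TrialModel K ν Z R m G L good a γ κ ψ Φ)
include h

lemma measurable (t : ℝ≥0) : Measurable (Z t) := (h.adapted t).mono (histSigma_le t) le_rfl

lemma measurableSet_event' : MeasurableSet G :=
  ((coneSigma_sup_noise_le _ _).trans coneNoise_le) _ h.measurableSet_event

lemma measurableSet_success : MeasurableSet (successEvent Z m G L) :=
  measurableSet_successEvent h.m_pos h.local_cone h.measurableSet_event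

lemma event_prob_pos {η : Config d E} (hη : η ∈ good) : 0 < (lawKernel K ν η).real G := by
  rw [lawKernel_apply]
  exact h.γ_pos.trans_le (h.event_prob η hη)

/-- Given `G`, the trial succeeds with probability at least `κ`. -/
lemma κ_le {η : Config d E} (hη : η ∈ good) :
    κ * (lawKernel K ν η).real G ≤ (lawKernel K ν η).real (successEvent Z m G L) := by
  have h1 := h.stay η hη
  have hpos := h.event_prob_pos hη
  have h2 : (ProbabilityTheory.cond (lawFrom K ν η) G).real
      {ω | exitTime Z m (timeShift (L : ℝ≥0) ω) = ∞}
      = ((lawKernel K ν η).real G)⁻¹ * (lawKernel K ν η).real (successEvent Z m G L) := by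
    rw [measureReal_def, cond_apply h.measurableSet_event', ← lawKernel_apply, ENNReal.toReal_mul,
      ENNReal.toReal_inv, ← measureReal_def, ← measureReal_def]
    congr 1
    refine measureReal_congr ?_
    filter_upwards [h.regular η hη] with ω hω
    refine propext ?_
    constructor
    · rintro ⟨h3, h4⟩
      exact (hω.1.exitTime_eq_top_iff h3).1 h4
    · intro h3
      exact ⟨h3.1, (hω.1.exitTime_eq_top_iff h3.1).2 h3⟩
  rw [h2] at h1
  rwa [inv_mul_eq_div, le_div_iff₀ hpos] at h1

lemma prob_le {η : Config d E} (hη : η ∈ good) :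
    κ * γ ≤ (lawKernel K ν η).real (successEvent Z m G L) := by
  refine (mul_le_mul_of_nonneg_left ?_ h.κ_pos.le).trans (h.κ_le hη)
  rw [lawKernel_apply]
  exact h.event_prob η hη

lemma setLIntegral_exitTime_le {η : Config d E} (hη : η ∈ good) :
    ∫⁻ ω in G, {ω' | exitTime Z m (timeShift (L : ℝ≥0) ω') < ∞}.indicator
      (fun ω' => exitTime Z m (timeShift (L : ℝ≥0) ω') ^ a) ω ∂(lawKernel K ν η)
      ≤ ENNReal.ofReal (ψ ^ a) := by
  have h1 := h.moment η hη
  rw [ProbabilityTheory.cond, lintegral_smul_measure, ← lawKernel_apply, smul_eq_mul] at h1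
  refine le_trans ?_ h1
  have h2 : 1 ≤ (lawKernel K ν η G)⁻¹ := ENNReal.one_le_inv.2 prob_le_one
  exact le_mul_of_one_le_left (zero_le) h2

/-- At most one detection event occurs. Detection at index `1` costs `1`, even if `G` itself fails;
detection at index `j + 2` forces the exit time to be at least `j * L ≥ j`, so `j + 2` is at most
twice the maximum of `2` and the exit time. The assumed moment thus controls the sum, with `min a 2`
serving as exponent because trial systems require one at most `2`. -/
lemma sum_fail_le {η : Config d E} (hη : η ∈ good) :
    ∑' j : ℕ, ((j : ℝ≥0∞) + 1) ^ (min a 2) * lawKernel K ν η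
      ((⋂ i < j, intactEvent Z m G L (i + 1)) \ intactEvent Z m G L (j + 1))
      ≤ ENNReal.ofReal (2 ^ a * (2 ^ a + ψ ^ a)) := by
  set fail : ℕ → Set (D.Sample S) := fun j =>
    (⋂ i < j, intactEvent Z m G L (i + 1)) \ intactEvent Z m G L (j + 1) with hfail
  have ha0 : 0 ≤ a := by linarith [h.one_lt]
  have hint : ∀ n, MeasurableSet (intactEvent Z m G L (n + 1)) := fun n =>
    histSigma_le _ _ (measurableSet_intactEvent h.adapted h.measurableSet_event (by omega))
  have hfm : ∀ j, MeasurableSet (fail j) := fun j =>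
    (MeasurableSet.iInter fun i => MeasurableSet.iInter fun _ => hint i).diff (hint j)
  set τ : D.Sample S → ℝ≥0∞ := fun ω => exitTime Z m (timeShift (L : ℝ≥0) ω) with hτ
  set F : D.Sample S → ℝ≥0∞ := fun ω => {ω' | τ ω' < ∞}.indicator (fun ω' => τ ω' ^ a) ω with hF
  have hpt : ∀ᵐ ω ∂(lawKernel K ν η),
      ∑' j : ℕ, (fail j).indicator (fun _ => ((j : ℝ≥0∞) + 1) ^ (min a 2)) ω
        ≤ 2 ^ a * (2 ^ a + G.indicator F ω) := by
    filter_upwards [h.regular η hη] with ω hω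
    by_cases hex : ∃ j, ω ∈ fail j
    · obtain ⟨j, hj⟩ := hex
      have huniq : ∀ i, i ≠ j → ω ∉ fail i := by
        intro i hij hi
        rcases lt_or_gt_of_ne hij with hlt | hlt
        · exact hi.2 (Set.mem_iInter₂.1 hj.1 i hlt)
        · exact hj.2 (Set.mem_iInter₂.1 hi.1 j hlt)
      rw [tsum_eq_single j fun i hij => Set.indicator_of_notMem (huniq i hij) _,
        Set.indicator_of_mem hj]
      have hle : ((j : ℝ≥0∞) + 1) ^ (min a 2) ≤ ((j : ℝ≥0∞) + 1) ^ a :=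
        ENNReal.rpow_le_rpow_of_exponent_le le_add_self (min_le_left _ _)
      refine hle.trans ?_
      have h2a : (1 : ℝ≥0∞) ≤ 2 ^ a := ENNReal.one_le_rpow (by norm_num) (by linarith [h.one_lt])
      rcases j with _ | j
      · simp only [Nat.cast_zero, zero_add, ENNReal.one_rpow]
        calc (1 : ℝ≥0∞) ≤ 2 ^ a := h2a
          _ ≤ 2 ^ a * (2 ^ a + G.indicator F ω) :=
            le_mul_of_one_le_right (zero_le) (h2a.trans le_self_add)
      · have hin := Set.mem_iInter₂.1 hj.1 j (by omega)
        obtain ⟨h1, h2⟩ := hω.1.exitTime_of_fail hin hj.2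
        have hG : G.indicator F ω = τ ω ^ a := by
          rw [Set.indicator_of_mem hin.1, hF]
          exact Set.indicator_of_mem (s := {ω' | τ ω' < ∞}) h1 _
        rw [hG]
        have hjτ : (j : ℝ≥0∞) ≤ τ ω :=
          le_trans (by exact_mod_cast Nat.le_mul_of_pos_right j h.one_le) h2
        have h3 : (((j + 1 : ℕ) : ℝ≥0∞) + 1) ≤ 2 * max 2 (τ ω) := by
          push_cast
          calc (j : ℝ≥0∞) + 1 + 1 = j + 2 := by rw [add_assoc, one_add_one_eq_two]
            _ ≤ max 2 (τ ω) + max 2 (τ ω) :=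
              add_le_add (hjτ.trans (le_max_right _ _)) (le_max_left _ _)
            _ = _ := (two_mul _).symm
        refine (ENNReal.rpow_le_rpow h3 ha0).trans ?_
        rw [ENNReal.mul_rpow_of_nonneg _ _ ha0]
        gcongr
        rcases max_cases 2 (τ ω) with ⟨h4, -⟩ | ⟨h4, -⟩ <;> rw [h4]
        · exact le_self_add
        · exact le_add_self
    · push Not at hex
      simp [Set.indicator_of_notMem (hex _)]
  calc ∑' j : ℕ, ((j : ℝ≥0∞) + 1) ^ (min a 2) * lawKernel K ν η (fail j)
      = ∑' j : ℕ, ∫⁻ ω, (fail j).indicator (fun _ => ((j : ℝ≥0∞) + 1) ^ (min a 2)) ω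
          ∂(lawKernel K ν η) := by
        refine tsum_congr fun j => ?_
        rw [lintegral_indicator_const (hfm j)]
    _ = ∫⁻ ω, ∑' j : ℕ, (fail j).indicator (fun _ => ((j : ℝ≥0∞) + 1) ^ (min a 2)) ω
          ∂(lawKernel K ν η) :=
        (lintegral_tsum fun j => (measurable_const.indicator (hfm j)).aemeasurable).symm
    _ ≤ ∫⁻ ω, 2 ^ a * (2 ^ a + G.indicator F ω) ∂(lawKernel K ν η) := lintegral_mono_ae hpt
    _ = 2 ^ a * (2 ^ a + ∫⁻ ω in G, F ω ∂(lawKernel K ν η)) := by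
        rw [lintegral_const_mul' _ _ (ENNReal.rpow_ne_top_of_nonneg ha0 (by norm_num)),
          lintegral_add_left measurable_const, lintegral_indicator h.measurableSet_event']
        simp
    _ ≤ 2 ^ a * (2 ^ a + ENNReal.ofReal (ψ ^ a)) := by
        gcongr
        exact h.setLIntegral_exitTime_le hη
    _ = ENNReal.ofReal (2 ^ a * (2 ^ a + ψ ^ a)) := by
        have h2 : (2 : ℝ≥0∞) ^ a = ENNReal.ofReal (2 ^ a) := by
          rw [← ENNReal.ofReal_rpow_of_pos (by norm_num)]; norm_num
        have := Real.rpow_nonneg h.ψ_nonneg a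
        rw [h2, ← ENNReal.ofReal_add (by positivity) this, ← ENNReal.ofReal_mul (by positivity)]

end

/-- The trials as an abstract trial system. -/
def system (h : TrialModel K ν Z R m G L good a γ κ ψ Φ) :
    TrialSystem (Config d E) (D.Sample S) where
  law := lawKernel K ν
  law_markov := inferInstance
  hist n := histSigma D S ((L * n : ℕ) : ℝ≥0)
  hist_le n := histSigma_le _
  hist_mono j k hjk := histSigma_mono (by exact_mod_cast Nat.mul_le_mul_left L hjk)
  step n := fromWalk Z (L * n)
  measurable_step n := measurable_fromWalk h.measurable _
  measurable_step_hist j k := by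
    have := measurable_fromWalk_hist h.adapted (L * j) (L * k)
    rwa [← mul_add] at this
  state := initial
  measurable_state := measurable_envAt_hist (by simp)
  good := good
  reg := {ω | RegularSample Z G L ω ∧ ∀ n, RegularSample Z G L (fromWalk Z n ω)}
  ae_state η _ := lawKernel_start h.markovFamily η
  ae_reg η hη := by
    filter_upwards [h.regular η hη] with ω hω
    refine ⟨⟨hω.1, fun n => (hω.2 n).1⟩, fun n => ⟨⟨(hω.2 _).1, fun k => ?_⟩, (hω.2 _).2⟩⟩
    rw [hω.1.fromWalk_fromWalk]
    exact (hω.2 _).1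
  step_step ω hω j k := by rw [hω.1.fromWalk_fromWalk, mul_add]
  step_zero ω hω := by rw [mul_zero, hω.1.fromWalk_zero]
  markov η _ n B hB C hC :=
    lawKernel_markov_fromWalk h.markovFamily h.translationInvariant h.adapted η (L * n) hB hC
  success := successEvent Z m G L
  measurableSet_success := h.measurableSet_success
  intact n := intactEvent Z m G L n
  measurableSet_intact n hn := measurableSet_intactEvent h.adapted h.measurableSet_event hn
  glue ω hω n hn hs := hω.1.glue h.m_pos.le hn (hω.2 _) hs
  success_iff ω hω := hω.1.success_iff h.one_le
  prob := κ * γ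
  prob_pos := mul_pos h.κ_pos h.γ_pos
  prob_le η hη := h.prob_le hη
  expo := min a 2
  one_lt_expo := lt_min h.one_lt (by norm_num)
  expo_le_two := min_le_right _ _
  bound := 2 ^ a * (2 ^ a + ψ ^ a)
  moment η hη := h.sum_fail_le hη

end TrialModel

end RWDRE
end

/-! ### Oscillation of the conditional mean rewards -/

noncomputable section

namespace RWDRE

/-- Write the difference as `((A - A') + (A' / H') * (H' - H)) / H`, with `A' / H'` bounded by `b`
and `H` bounded below by `κ`. -/
lemma abs_ratio_sub_le {A A' H H' κ b δ : ℝ} (hκ : 0 < κ) (hH : κ ≤ H) (hH' : κ ≤ H')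
    (hA0 : 0 ≤ A') (hA1 : A' ≤ b * H') (hA : |A - A'| ≤ b * δ) (hHH : |H - H'| ≤ δ) :
    |A / H - A' / H'| ≤ 2 * b * δ / κ := by
  have hHp : 0 < H := hκ.trans_le hH
  have hHp' : 0 < H' := hκ.trans_le hH'
  have h1 : A / H - A' / H' = ((A - A') + (A' / H') * (H' - H)) / H := by
    field_simp
    ring
  have h2 : |A' / H'| ≤ b := by
    rw [abs_of_nonneg (div_nonneg hA0 hHp'.le)]
    exact (div_le_iff₀ hHp').2 hA1
  have hb : 0 ≤ b := (abs_nonneg _).trans h2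
  have hδ : 0 ≤ δ := (abs_nonneg _).trans hHH
  have h3 : |(A - A') + (A' / H') * (H' - H)| ≤ 2 * b * δ := by
    refine (abs_add_le _ _).trans ?_
    rw [abs_mul, abs_sub_comm H' H]
    have := mul_le_mul h2 hHH (abs_nonneg _) hb
    linarith
  rw [h1, abs_div, abs_of_pos hHp]
  exact div_le_div₀ (by positivity) h3 hκ hH

variable {d : ℕ} {E S : Type*} [MeasurableSpace E] [MeasurableSpace S] {D : PathSpace d E}

/-- The first successful trial at or after `k₀`, as seen by a walk that stays in the cone. -/
def coneNext (Z : ℝ≥0 → D.Sample S → Site d) (m : ℝ) (G : Set (D.Sample S)) (L k₀ : ℕ)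
    (ω : D.Sample S) : ℕ :=
  sInf {k | k₀ - 1 ≤ k ∧ ω ∈ coneEvent Z m ∩ fromWalk Z (L * k) ⁻¹' successEvent Z m G L}

/-- The reward of a successful trial, as a function of the sample after the trial. -/
def coneReward (Z : ℝ≥0 → D.Sample S → Site d) (m : ℝ) (G : Set (D.Sample S)) (L k₀ : ℕ)
    (i : Fin d) (ω : D.Sample S) : ℝ :=
  if coneNext Z m G L k₀ ω + 1 ≤ 2 * k₀ then
    clamp (2 * m) (((coneEvent Z m).indicator (Z ((L * coneNext Z m G L k₀ ω : ℕ) : ℝ≥0)) ω i : ℝ)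
      / (k₀ * L))
  else 0

namespace TrialModel

variable {K : Kernel (Config d E) D.Path} [IsMarkovKernel K] {ν : Measure S}
  [IsProbabilityMeasure ν] {Z : ℝ≥0 → D.Sample S → Site d} {R : ℕ} {m : ℝ} {G : Set (D.Sample S)}
  {L : ℕ} {good : Set (Config d E)} {a γ κ ψ Φ : ℝ}
  (h : TrialModel K ν Z R m G L good a γ κ ψ Φ)
include h

lemma measurableSet_coneNoise_success :
    MeasurableSet[coneNoise D S R m] (successEvent Z m G L) := by
  refine MeasurableSet.inter (m := coneNoise D S R m)
    (coneSigma_sup_noise_le _ _ _ h.measurableSet_event) ?_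
  have h1 := measurable_coneNoise_shift (D := D) (S := S) (R := R) (m := m) (x := 0) (n := L)
    (by rw [l1norm_zero]; have := h.m_pos; positivity)
  have h2 := h1 (h.local_cone m h.m_pos).1
  simp only [spaceShift_zero] at h2
  exact h2

lemma measurable_coneNext (k₀ : ℕ) :
    Measurable[coneNoise D S R m] (coneNext Z m G L k₀) := by
  refine @measurable_natInf _ (coneNoise D S R m) _ fun k => ?_
  refine MeasurableSet.inter (m := coneNoise D S R m) (s₁ := {_ω | k₀ - 1 ≤ k})
    (@MeasurableSet.const _ (coneNoise D S R m) _) ?_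
  exact measurableSet_coneEvent_fromWalk h.local_cone h.m_pos _ h.measurableSet_coneNoise_success

lemma measurable_coneReward (k₀ : ℕ) (i : Fin d) :
    Measurable[coneNoise D S R m] (coneReward Z m G L k₀ i) := by
  have hN := h.measurable_coneNext k₀
  have h1 : Measurable[coneNoise D S R m] fun ω =>
      (coneEvent Z m).indicator (Z ((L * coneNext Z m G L k₀ ω : ℕ) : ℝ≥0)) ω :=
    @measurable_eval_at _ _ (coneNoise D S R m) _
      (fun n => (coneEvent Z m).indicator (Z ((L * n : ℕ) : ℝ≥0)))
      (fun n => (h.local_cone m h.m_pos).2 _) _ hN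
  have h2 : Measurable fun x : Site d => clamp (2 * m) ((x i : ℝ) / (k₀ * L)) :=
    measurable_of_countable _
  have h3 : Measurable[coneNoise D S R m] fun ω =>
      clamp (2 * m) (((coneEvent Z m).indicator
        (Z ((L * coneNext Z m G L k₀ ω : ℕ) : ℝ≥0)) ω i : ℝ) / (k₀ * L)) := h2.comp h1
  refine Measurable.ite (m := coneNoise D S R m) ?_ h3
    (@measurable_const _ _ _ (coneNoise D S R m) _)
  exact hN (MeasurableSet.of_discrete (s := {n | n + 1 ≤ 2 * k₀}))

lemma abs_coneReward_le (k₀ : ℕ) (i : Fin d) (ω : D.Sample S) :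
    |coneReward Z m G L k₀ i ω| ≤ 2 * m := by
  have hm := h.m_pos
  unfold coneReward
  split_ifs
  · exact abs_clamp_le (by positivity) _
  · rw [abs_zero]; positivity

/-- During a successful trial the walk stands still up to time `L`, so its later path can be read
off the time-shifted sample alone. That sample lies in `coneEvent`, so the restrictions to this
event that make `coneReward` observable in the cone cost nothing. -/
lemma reward_eq {k₀ : ℕ} (hk : 1 ≤ k₀) (i : Fin d) {ω : D.Sample S}
    (hω : h.system.Recurrent ω) (hs : ω ∈ successEvent Z m G L) :
    h.system.reward (fun t ω => (Z t ω i : ℝ)) L k₀ m ω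
      = coneReward Z m G L k₀ i (timeShift (L : ℝ≥0) ω) := by
  have hreg : RegularSample Z G L ω := hω.1.1.1
  have hstep : ∀ k, fromWalk Z (L * k) (timeShift (L : ℝ≥0) ω) = fromWalk Z (L * (k + 1)) ω := by
    intro k
    rw [← hreg.fromWalk_of_mem hs.1, hreg.fromWalk_fromWalk]
    congr 1
    ring
  -- The sample after time `L` has used up one trial length, so trial indices drop by one; hence the
  -- threshold `k₀ - 1` in `coneNext`.
  have hnext : h.system.next k₀ ω = coneNext Z m G L k₀ (timeShift (L : ℝ≥0) ω) + 1 := by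
    obtain ⟨h1, h2⟩ := hω.next_spec k₀
    set n := h.system.next k₀ ω with hn
    have h3 : n - 1 ∈ {k | k₀ - 1 ≤ k ∧ timeShift (L : ℝ≥0) ω ∈
        coneEvent Z m ∩ fromWalk Z (L * k) ⁻¹' successEvent Z m G L} := by
      refine ⟨by omega, hs.2, ?_⟩
      rw [Set.mem_preimage, hstep, Nat.sub_add_cancel (by omega)]
      exact h2
    refine le_antisymm ?_ ?_
    · obtain ⟨h4, -, h5⟩ := Nat.sInf_mem ⟨_, h3⟩
      rw [Set.mem_preimage, hstep] at h5
      exact Nat.sInf_le (s := {k | k₀ ≤ k ∧ h.system.step k ω ∈ h.system.success})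
        ⟨Nat.sub_le_iff_le_add.1 h4, h5⟩
    · have : coneNext Z m G L k₀ (timeShift (L : ℝ≥0) ω) ≤ n - 1 := Nat.sInf_le h3
      omega
  unfold TrialSystem.reward coneReward
  rw [hnext, Set.indicator_of_mem (show timeShift (L : ℝ≥0) ω ∈ coneEvent Z m from hs.2),
    hreg.apply_timeShift hs.1]
  congr 5
  push_cast
  ring

/-- The conditional mean reward, in terms of conditional means of cone observables. -/
lemma mean_reward_eq {k₀ : ℕ} (hk : 1 ≤ k₀) (i : Fin d) {η : Config d E} (hη : η ∈ good) :
    h.system.mean (h.system.reward (fun t ω => (Z t ω i : ℝ)) L k₀ m) η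
      = condMean K ν G L ((coneEvent Z m).indicator fun ω => coneReward Z m G L k₀ i ω + 2 * m) η
        / condMean K ν G L ((coneEvent Z m).indicator fun _ => 1) η - 2 * m := by
  have hGm := h.measurableSet_event'
  have hDm : MeasurableSet (timeShift (L : ℝ≥0) ⁻¹' coneEvent Z m : Set (D.Sample S)) :=
    measurable_timeShift _ (coneNoise_le _ (h.local_cone m h.m_pos).1)
  have hPG := h.event_prob_pos hη
  have hPS : 0 < (lawKernel K ν η).real (successEvent Z m G L) :=
    (mul_pos h.κ_pos h.γ_pos).trans_le (h.prob_le hη)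
  -- Success is `G` together with the cone event after time `L`. A mean given success is therefore a
  -- quotient of two means given `G`, to which mixing applies.
  have hset : ∀ f : D.Sample S → ℝ,
      ∫ ω in G, (coneEvent Z m).indicator f (timeShift (L : ℝ≥0) ω) ∂(lawKernel K ν η)
        = ∫ ω in successEvent Z m G L, f (timeShift (L : ℝ≥0) ω) ∂(lawKernel K ν η) := by
    intro f
    rw [successEvent, ← setIntegral_indicator hDm]
    rfl
  have hcr : Measurable (coneReward Z m G L k₀ i) :=
    (h.measurable_coneReward k₀ i).mono coneNoise_le le_rfl
  have hint : IntegrableOn (fun ω => coneReward Z m G L k₀ i (timeShift (L : ℝ≥0) ω))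
      (successEvent Z m G L) (lawKernel K ν η) :=
    Integrable.of_bound (hcr.comp (measurable_timeShift _)).aestronglyMeasurable (2 * m)
      (Eventually.of_forall fun ω => h.abs_coneReward_le k₀ i _)
  have hrew : ∫ ω in successEvent Z m G L,
      h.system.reward (fun t ω => (Z t ω i : ℝ)) L k₀ m ω ∂(lawKernel K ν η)
      = ∫ ω in successEvent Z m G L, coneReward Z m G L k₀ i (timeShift (L : ℝ≥0) ω)
          ∂(lawKernel K ν η) := by
    refine setIntegral_congr_ae h.measurableSet_success ?_
    filter_upwards [h.system.ae_recurrent (η := η) hη] with ω hω hs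
    exact h.reward_eq hk i hω hs
  have hmean : h.system.mean (h.system.reward (fun t ω => (Z t ω i : ℝ)) L k₀ m) η
      = (∫ ω in successEvent Z m G L, h.system.reward (fun t ω => (Z t ω i : ℝ)) L k₀ m ω
          ∂(lawKernel K ν η)) / (lawKernel K ν η).real (successEvent Z m G L) := rfl
  rw [hmean, hrew, condMean, condMean, hset, hset, div_div_div_cancel_right₀ hPG.ne',
    integral_add hint (integrable_const _)]
  simp only [setIntegral_const, smul_eq_mul, mul_one]
  field_simp
  ring

lemma κ_le_condMean {η : Config d E} (hη : η ∈ good) :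
    κ ≤ condMean K ν G L ((coneEvent Z m).indicator fun _ => 1) η := by
  have hDm : MeasurableSet (timeShift (L : ℝ≥0) ⁻¹' coneEvent Z m : Set (D.Sample S)) :=
    measurable_timeShift _ (coneNoise_le _ (h.local_cone m h.m_pos).1)
  have h1 : ∫ ω in G, (coneEvent Z m).indicator (fun _ => (1 : ℝ)) (timeShift (L : ℝ≥0) ω)
      ∂(lawKernel K ν η) = (lawKernel K ν η).real (successEvent Z m G L) := by
    have h2 : ∫ ω in successEvent Z m G L, (1 : ℝ) ∂(lawKernel K ν η)
        = (lawKernel K ν η).real (successEvent Z m G L) := by simp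
    rw [← h2, successEvent, ← setIntegral_indicator hDm]
    rfl
  rw [condMean, h1, le_div_iff₀ (h.event_prob_pos hη)]
  exact h.κ_le hη

/-- Mixing is assumed for nonnegative functions, so the reward is raised by `2 * m` to lie in `[0, 4
* m]`. Numerator and denominator then vary by at most `4 * m * (2 * Φ)` and `2 * Φ`, while the
denominator is at least `κ`; the quotient bound is `2 * (4 * m) * (2 * Φ) / κ`. -/
lemma abs_mean_reward_sub_le {k₀ : ℕ} (hk : 1 ≤ k₀) (i : Fin d) {η η' : Config d E}
    (hη : η ∈ good) (hη' : η' ∈ good) :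
    |h.system.mean (h.system.reward (fun t ω => (Z t ω i : ℝ)) L k₀ m) η
      - h.system.mean (h.system.reward (fun t ω => (Z t ω i : ℝ)) L k₀ m) η'|
      ≤ 16 * m * Φ / κ := by
  have hm := h.m_pos
  have hDm := (h.local_cone m h.m_pos).1
  have hb : ∀ ω, 0 ≤ coneReward Z m G L k₀ i ω + 2 * m ∧
      coneReward Z m G L k₀ i ω + 2 * m ≤ 4 * m := fun ω => by
    have := abs_le.1 (h.abs_coneReward_le k₀ i ω)
    constructor <;> linarith
  have hg0 : ∀ ω, 0 ≤ (coneEvent Z m).indicator (fun ω => coneReward Z m G L k₀ i ω + 2 * m) ω :=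
    fun ω => Set.indicator_nonneg (fun ω _ => (hb ω).1) ω
  have hg1 : ∀ ω, (coneEvent Z m).indicator (fun ω => coneReward Z m G L k₀ i ω + 2 * m) ω
      ≤ 4 * m := fun ω => Set.indicator_le' (fun ω _ => (hb ω).2) (fun ω _ => by positivity) ω
  have hgm : Measurable[coneNoise D S R m]
      ((coneEvent Z m).indicator fun ω => coneReward Z m G L k₀ i ω + 2 * m) := by
    have h1 : Measurable[coneNoise D S R m] fun ω => coneReward Z m G L k₀ i ω + 2 * m :=
      (measurable_add_const (2 * m)).comp (h.measurable_coneReward k₀ i)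
    exact Measurable.indicator (m := coneNoise D S R m) h1 hDm
  have h1m : Measurable[coneNoise D S R m] ((coneEvent Z m).indicator fun _ => (1 : ℝ)) :=
    Measurable.indicator (m := coneNoise D S R m)
      (@measurable_const _ _ _ (coneNoise D S R m) _) hDm
  have hG := coneSigma_sup_noise_le_hist L _ h.measurableSet_event
  obtain ⟨c, hc⟩ := h.mixing
  rw [h.mean_reward_eq hk i hη, h.mean_reward_eq hk i hη', sub_sub_sub_cancel_right]
  refine (abs_ratio_sub_le (b := 4 * m) (δ := 2 * Φ) h.κ_pos (h.κ_le_condMean hη)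
    (h.κ_le_condMean hη') ?_ ?_ ?_ ?_).trans (le_of_eq (by ring))
  · exact div_nonneg (integral_nonneg fun ω => hg0 _) measureReal_nonneg
  · have hPG := h.event_prob_pos hη'
    rw [condMean, condMean, ← mul_div_assoc, ← integral_const_mul]
    refine div_le_div_of_nonneg_right (integral_mono_of_nonneg (Eventually.of_forall fun ω => hg0 _)
      ?_ (Eventually.of_forall fun ω => ?_)) hPG.le
    · refine Integrable.const_mul (Integrable.of_bound (((h1m.mono coneNoise_le le_rfl).comp
        (measurable_timeShift _)).aestronglyMeasurable) 1 (Eventually.of_forall fun ω => ?_)) _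
      by_cases hω : timeShift (L : ℝ≥0) ω ∈ coneEvent Z m <;> simp [hω]
    · by_cases hω : timeShift (L : ℝ≥0) ω ∈ coneEvent Z m
      · simpa [hω] using (hb (timeShift (L : ℝ≥0) ω)).2
      · simp [hω]
  · have := condMean_sub_le h.markovFamily hG h.Φ_nonneg hc hgm hg0 (b := 4 * m) (by positivity)
      hg1 hη hη'
    linarith
  · have := condMean_sub_le h.markovFamily hG h.Φ_nonneg hc h1m
      (fun ω => Set.indicator_nonneg (fun _ _ => zero_le_one) ω) (b := 1) zero_le_one
      (fun ω => Set.indicator_le' (fun _ _ => le_rfl) (fun _ _ => zero_le_one) ω) hη hη'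
    linarith

/-- The walk has an approximate speed. -/
theorem exists_speed {η₀ : Config d E} (hη₀ : η₀ ∈ good) (i : Fin d) {ε : ℝ}
    (hε : 16 * m * Φ / κ < ε) :
    ∃ c : ℝ, ∀ η ∈ good, ∀ᵐ ω ∂(lawKernel K ν η), ∀ᶠ t : ℝ≥0 in atTop,
      |(Z t ω i : ℝ) - c * t| ≤ ε * t := by
  have hm := h.m_pos
  set T := h.system with hT
  -- Half of the slack pays for the delays, by the choice of `k`, and half for the error `δ` in
  -- `ae_speed`.
  set δ := (ε - 16 * m * Φ / κ) / 2 with hδ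
  have hδ0 : 0 < δ := by rw [hδ]; linarith
  set B := 10 * m * (T.waitBound / T.prob + 1) with hB
  obtain ⟨k₀, hk₀⟩ := exists_nat_ge (B / δ)
  set k := k₀ + 1 with hk
  have hk0 : (0 : ℝ) < k := by positivity
  have hBk : B / k ≤ δ := by
    rw [div_le_iff₀ hk0]
    rw [div_le_iff₀ hδ0] at hk₀
    have : (k : ℝ) = k₀ + 1 := by simp [hk]
    rw [this]
    linarith
  -- The conditional mean at one fixed state serves as the speed for all good states, since the
  -- oscillation bound is part of the allowed error.
  refine ⟨T.mean (T.reward (fun t ω => (Z t ω i : ℝ)) L k m) η₀, fun η hη => ?_⟩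
  have hXm : ∀ t, Measurable fun ω => (Z t ω i : ℝ) := fun t =>
    (measurable_of_countable fun x : Site d => (x i : ℝ)).comp (h.measurable t)
  have key := T.ae_speed (X := fun t ω => (Z t ω i : ℝ)) (len := L) (k₀ := k) (m := m) hη h.one_le
    (by omega) hm.le (fun n => hXm n)
    (fun n => (measurable_of_countable fun x : Site d => (x i : ℝ)).comp (h.adapted _))
    (fun ω hω n t => by
      have := hω.1.add (L * n) t
      rw [add_comm]
      rw [this]
      simp only [Pi.add_apply, Int.cast_add]
      rfl)
    (fun ω hω hs t => (abs_apply_le_l1norm _ i).trans (hω.1.l1norm_le_of_success hm.le hs t))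
    (c := T.mean (T.reward (fun t ω => (Z t ω i : ℝ)) L k m) η₀) (ε := 16 * m * Φ / κ)
    (T.abs_mean_le (fun ω => T.abs_reward_le hm.le ω) η₀)
    (by have := h.Φ_nonneg; have := h.κ_pos; positivity)
    (fun η' hη' => h.abs_mean_reward_sub_le (by omega) i hη' hη₀) hδ0
  filter_upwards [key] with ω hω
  filter_upwards [hω] with t ht
  refine ht.trans (mul_le_mul_of_nonneg_right ?_ t.2)
  have : 16 * m * Φ / κ + δ + δ = ε := by rw [hδ]; ring
  linarith

end TrialModel

end RWDRE
end

/-! ### From approximate speeds to the speed -/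

noncomputable section

namespace RWDRE

lemma abs_sub_le_of_nnrat {d : ℕ} {z : ℝ≥0 → Site d}
    (hz : ∀ t, ContinuousWithinAt z (Set.Ici t) t) {i : Fin d} {c ε : ℝ} {N : ℝ≥0}
    (h : ∀ s : ℚ≥0, N ≤ (s : ℝ≥0) → |(z s i : ℝ) - c * (s : ℝ≥0)| ≤ ε * (s : ℝ≥0))
    {t : ℝ≥0} (ht : N ≤ t) : |(z t i : ℝ) - c * t| ≤ ε * t := by
  by_contra hlt
  push Not at hlt
  have hp : ∀ᶠ s : ℝ≥0 in 𝓝[>] t, ε * s < |(z t i : ℝ) - c * s| := by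
    refine Eventually.filter_mono nhdsWithin_le_nhds ?_
    have h1 : Continuous fun s : ℝ≥0 => ε * (s : ℝ) := by fun_prop
    have h2 : Continuous fun s : ℝ≥0 => |(z t i : ℝ) - c * (s : ℝ)| := by fun_prop
    exact h1.continuousAt.eventually_lt h2.continuousAt hlt
  obtain ⟨s, h1, h2, h3⟩ := exists_nnrat_right (hz t) hp
  have := h s (ht.trans h1.le)
  rw [h2] at this
  linarith

/-- A path with arbitrarily precise approximate speeds has a speed. -/
lemma tendsto_of_approx_speed {c : ℕ → ℝ} {z : ℝ≥0 → ℝ} {w : ℝ} (hc : Tendsto c atTop (𝓝 w))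
    (h : ∀ n : ℕ, ∀ᶠ t : ℝ≥0 in atTop, |z t - c n * t| ≤ 1 / ((n : ℝ) + 1) * t) :
    Tendsto (fun t : ℝ≥0 => (t : ℝ)⁻¹ * z t) atTop (𝓝 w) := by
  rw [Metric.tendsto_nhds]
  intro ε hε
  have h1 : ∀ᶠ n : ℕ in atTop, dist (c n) w < ε / 2 := Metric.tendsto_nhds.1 hc _ (by positivity)
  have h2 : ∀ᶠ n : ℕ in atTop, 1 / ((n : ℝ) + 1) < ε / 2 :=
    tendsto_one_div_add_atTop_nhds_zero_nat.eventually_lt_const (by positivity)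
  obtain ⟨n, hn1, hn2⟩ := (h1.and h2).exists
  filter_upwards [h n, eventually_gt_atTop 0] with t ht ht0
  have ht0' : (0 : ℝ) < t := ht0
  rw [Real.dist_eq] at hn1 ⊢
  have h3 : (t : ℝ)⁻¹ * z t - w = (t : ℝ)⁻¹ * (z t - c n * t) + (c n - w) := by
    field_simp
    ring
  have h4 : |(t : ℝ)⁻¹ * (z t - c n * t)| ≤ 1 / ((n : ℝ) + 1) := by
    rw [abs_mul, abs_of_pos (inv_pos.2 ht0'), inv_mul_le_iff₀ ht0']
    linarith
  rw [h3]
  refine (abs_add_le _ _).trans_lt ?_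
  linarith

/-- Any two approximate speeds can be compared along the same path at a single large time. -/
lemma cauchySeq_of_approx_speed {c : ℕ → ℝ} {z : ℝ≥0 → ℝ}
    (h : ∀ n : ℕ, ∀ᶠ t : ℝ≥0 in atTop, |z t - c n * t| ≤ 1 / ((n : ℝ) + 1) * t) :
    CauchySeq c := by
  have hdist : ∀ j k, dist (c j) (c k) ≤ 1 / ((j : ℝ) + 1) + 1 / ((k : ℝ) + 1) := by
    intro j k
    obtain ⟨t, h1, h2, ht⟩ := ((h j).and ((h k).and (eventually_gt_atTop 0))).exists
    have ht0 : (0 : ℝ) < t := ht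
    rw [Real.dist_eq, ← mul_le_mul_iff_left₀ ht0, ← abs_of_pos ht0, ← abs_mul, abs_of_pos ht0]
    have h3 : (c j - c k) * t = (z t - c k * t) - (z t - c j * t) := by ring
    rw [h3]
    refine (abs_sub _ _).trans ?_
    linarith
  refine cauchySeq_of_le_tendsto_0 (fun N : ℕ => 2 * (1 / ((N : ℝ) + 1))) (fun j k N hj hk => ?_) ?_
  · refine (hdist j k).trans ?_
    have h1 : 1 / ((j : ℝ) + 1) ≤ 1 / ((N : ℝ) + 1) := Nat.one_div_le_one_div hj
    have h2 : 1 / ((k : ℝ) + 1) ≤ 1 / ((N : ℝ) + 1) := Nat.one_div_le_one_div hk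
    linarith
  · simpa using (tendsto_one_div_add_atTop_nhds_zero_nat (𝕜 := ℝ)).const_mul 2

variable {d : ℕ} {E S : Type*} [MeasurableSpace E] [MeasurableSpace S] {D : PathSpace d E}
  {K : Kernel (Config d E) D.Path} [IsMarkovKernel K] {ν : Measure S} [IsProbabilityMeasure ν]
  {Z : ℝ≥0 → D.Sample S → Site d}

/-- Quenched approximate speeds give annealed ones. -/
lemma ae_lawMix_speed (hZ : ∀ t, Measurable (Z t)) {ρ : Measure (Config d E)}
    (hc : ∀ᵐ ω ∂(lawMix K ν ρ), IsCadlag fun t => Z t ω) {i : Fin d} {c ε : ℝ}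
    (h : ∀ᵐ η ∂ρ, ∀ᵐ ω ∂(lawKernel K ν η), ∀ᶠ t : ℝ≥0 in atTop, |(Z t ω i : ℝ) - c * t| ≤ ε * t) :
    ∀ᵐ ω ∂(lawMix K ν ρ), ∀ᶠ t : ℝ≥0 in atTop, |(Z t ω i : ℝ) - c * t| ≤ ε * t := by
  -- Rational times give a measurable event, so that null sets pass from the laws of single
  -- configurations to their mixture; right-continuity restores all real times.
  set A : Set (D.Sample S) := ⋃ N : ℕ, ⋂ (s : ℚ≥0) (_ : (N : ℝ≥0) ≤ (s : ℝ≥0)),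
    {ω | |(Z s ω i : ℝ) - c * (s : ℝ≥0)| ≤ ε * (s : ℝ≥0)} with hA
  have hAm : MeasurableSet A := by
    refine MeasurableSet.iUnion fun N => MeasurableSet.iInter fun s =>
      MeasurableSet.iInter fun _ => ?_
    exact hZ _ (MeasurableSet.of_discrete
      (s := {x : Site d | |(x i : ℝ) - c * (s : ℝ≥0)| ≤ ε * (s : ℝ≥0)}))
  have h0 : lawMix K ν ρ Aᶜ = 0 := by
    rw [lawMix_eq_zero_iff hAm.compl]
    filter_upwards [h] with η hη
    change ∀ᵐ ω ∂(lawKernel K ν η), ω ∈ A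
    filter_upwards [hη] with ω hω
    obtain ⟨t, ht⟩ := eventually_atTop.1 hω
    obtain ⟨N, hN⟩ := exists_nat_ge t
    exact Set.mem_iUnion.2 ⟨N, Set.mem_iInter₂.2 fun s hs => ht _ (hN.trans hs)⟩
  have h0' : ∀ᵐ ω ∂(lawMix K ν ρ), ω ∈ A := h0
  filter_upwards [h0', hc] with ω hω hcad
  obtain ⟨N, hN⟩ := Set.mem_iUnion.1 hω
  filter_upwards [eventually_ge_atTop (N : ℝ≥0)] with t ht
  exact abs_sub_le_of_nnrat (z := fun t => Z t ω) (fun t => (hcad t).1)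
    (fun s hs => Set.mem_iInter₂.1 hN s hs) ht

section

variable {μ : Measure (Config d E)} [IsProbabilityMeasure μ] {q : Kernel (Config d E) (Site d)}
  [IsMarkovKernel q]

/-- Some `L` meets all the eventual hypotheses with `Φ L / κ L` below `ε / (16 * m)`; the almost
sure conditions for this `L` then hold on a closed set of good configurations. -/
lemma exists_approx_speed (hK : IsMarkovFamily K) (hKtrans : IsTranslationInvariantFamily K)
    (hμ : IsTranslationInvariantEquilibrium K μ)
    (hZ : IsWalkFunctional (lawMix K ν (muBar K ν q μ)) Z)
    {R : ℕ} (hA1 : A1 (lawMix K ν (muBar K ν q μ)) Z) (hA2 : A2 Z R)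
    (hA3 : A3 (lawMix K ν (muBar K ν q μ)) q Z)
    {m : ℝ} (hm : 0 < m) {Γ : ℕ → Set (D.Sample S)} (hΓ : IsLocalEvents Γ R m)
    {a : ℝ} {κ ψ Φ : ℕ → ℝ} (hH1 : H1 (lawMix K ν (muBar K ν q μ)) Z Γ)
    (hH2 : H2 (lawFrom K ν) (muBar K ν q μ) Γ)
    (hH3 : H3 (lawFrom K ν) (muBar K ν q μ) Z Γ m a κ ψ)
    (hH4 : H4 (lawFrom K ν) (muBar K ν q μ) (lawMix K ν (muBar K ν q μ)) Γ R m κ Φ)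
    (i : Fin d) {ε : ℝ} (hε : 0 < ε) :
    ∃ c : ℝ, ∀ᵐ ω ∂(lawMix K ν (muBar K ν q μ)), ∀ᶠ t : ℝ≥0 in atTop,
      |(Z t ω i : ℝ) - c * t| ≤ ε * t := by
  have hsmall : ∀ᶠ L : ℕ in atTop, (κ L)⁻¹ * Φ L < ε / (16 * m) :=
    hH4.phi_small.eventually_lt_const (by positivity)
  obtain ⟨L, hL, ⟨γ, hγ, hγ'⟩, hstay, hmom, hmix, hΦ⟩ := ((eventually_ge_atTop 1).and
    (hH2.and (hH3.stay.and (hH3.moment.and (hH4.mixing.and hsmall))))).exists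
  have hκ := (hH3.kappa_mem L hL).1
  have hr : ∀ᵐ ω ∂(lawMix K ν (muBar K ν q μ)), RegularSample Z (Γ L) L ω := by
    have hA1' := ae_all_iff.2 fun n : ℕ => hA1 (n + 1) (by omega)
    filter_upwards [hZ.cadlag, hZ.zero, hA1', hH1 L hL] with ω h1 h2 h3 h4
    refine ⟨h1, h2, fun n t => ?_, h4⟩
    rcases n with _ | n
    · rw [fromWalk, Nat.cast_zero, h2, spaceShift_zero, timeShift_zero, add_zero, zero_add]
    · rw [fromWalk, ← h3 n t]
      abel
  obtain ⟨good, hgood, hgood'⟩ := exists_closed_good hK hKtrans hμ hZ hA3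
    (hγ'.and (hstay.and (hmom.and hmix))) hr
  have model : TrialModel K ν Z R m (Γ L) L good a γ (κ L) (ψ L) (Φ L) :=
    { markovFamily := hK
      translationInvariant := hKtrans
      adapted := hZ.adapted
      local_cone := hA2
      m_pos := hm
      one_le := hL
      measurableSet_event := hΓ L hL
      one_lt := hH3.one_lt
      γ_pos := hγ
      κ_pos := hκ
      ψ_nonneg := hH3.psi_nonneg L hL
      Φ_nonneg := hH4.phi_nonneg L hL
      event_prob := fun η hη => (hgood' η hη).1.1
      stay := fun η hη => (hgood' η hη).1.2.1
      moment := fun η hη => (hgood' η hη).1.2.2.1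
      mixing := ⟨_, fun η hη => (hgood' η hη).1.2.2.2⟩
      regular := fun η hη => (hgood' η hη).2 }
  obtain ⟨η₀, hη₀⟩ := hgood.exists
  have hε' : 16 * m * Φ L / κ L < ε := by
    rw [lt_div_iff₀ (by positivity)] at hΦ
    rw [div_eq_mul_inv]
    linarith
  obtain ⟨c, hc⟩ := model.exists_speed hη₀ i hε'
  exact ⟨c, ae_lawMix_speed (fun t => (hZ.adapted t).mono (histSigma_le t) le_rfl) hZ.cadlag
    (hgood.mono hc)⟩

end

end RWDRE
end

theorem theorem1 {d : ℕ} (hd : 1 ≤ d)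
    {E : Type*} [TopologicalSpace E] [PolishSpace E] [MeasurableSpace E] [BorelSpace E]
    {S : Type*} [MeasurableSpace S]
    -- the environment, the noise, and the equilibrium
    (D : PathSpace d E)
    (K : Kernel (Config d E) D.Path) [IsMarkovKernel K]
    (hK : IsMarkovFamily K) (hKtrans : IsTranslationInvariantFamily K)
    (ν : Measure S) [IsProbabilityMeasure ν]
    (μ : Measure (Config d E)) [IsProbabilityMeasure μ]
    (hμ : IsTranslationInvariantEquilibrium K μ)
    -- the law of the starting point, and the walk started from the origin
    (q : Kernel (Config d E) (Site d)) [IsMarkovKernel q]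
    (Z : ℝ≥0 → D.Sample S → Site d)
    (hZ : IsWalkFunctional (lawMix K ν (muBar K ν q μ)) Z)
    -- structural assumptions
    (R : ℕ)
    (hA1 : A1 (lawMix K ν (muBar K ν q μ)) Z)
    (hA2 : A2 Z R)
    (hA3 : A3 (lawMix K ν (muBar K ν q μ)) q Z)
    -- regeneration-inducing events
    (m : ℝ) (hm : 0 < m) (Γ : ℕ → Set (D.Sample S)) (hΓ : IsLocalEvents Γ R m)
    (a : ℝ) (κ ψ Φ : ℕ → ℝ)
    (hH1 : H1 (lawMix K ν (muBar K ν q μ)) Z Γ)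
    (hH2 : H2 (lawFrom K ν) (muBar K ν q μ) Γ)
    (hH3 : H3 (lawFrom K ν) (muBar K ν q μ) Z Γ m a κ ψ)
    (hH4 : H4 (lawFrom K ν) (muBar K ν q μ) (lawMix K ν (muBar K ν q μ)) Γ R m κ Φ) :
    ∃ w : Fin d → ℝ, ∀ᵐ p ∂(lawWithStart K ν q μ),
      Tendsto (fun t : ℝ≥0 => (t : ℝ)⁻¹ • (fun i => (walk Z t p i : ℝ))) atTop (𝓝 w) := by
  set P := lawMix K ν (muBar K ν q μ) with hP
  have hspeed : ∀ i : Fin d, ∃ w : ℝ, ∀ᵐ ω ∂P,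
      Tendsto (fun t : ℝ≥0 => (t : ℝ)⁻¹ * (Z t ω i : ℝ)) atTop (𝓝 w) := by
    intro i
    have h1 : ∀ n : ℕ, ∃ c : ℝ, ∀ᵐ ω ∂P, ∀ᶠ t : ℝ≥0 in atTop,
        |(Z t ω i : ℝ) - c * t| ≤ 1 / ((n : ℝ) + 1) * t := fun n =>
      exists_approx_speed hK hKtrans hμ hZ hA1 hA2 hA3 hm hΓ hH1 hH2 hH3 hH4 i (by positivity)
    choose c hc using h1
    have h2 := ae_all_iff.2 hc
    -- The constants `c n` are deterministic, so a single sample on which all approximations hold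
    -- suffices to see that they converge.
    obtain ⟨ω₀, hω₀⟩ := h2.exists
    obtain ⟨w, hw⟩ := cauchySeq_tendsto_of_complete
      (cauchySeq_of_approx_speed (z := fun t => (Z t ω₀ i : ℝ)) hω₀)
    exact ⟨w, h2.mono fun ω hω => tendsto_of_approx_speed (z := fun t => (Z t ω i : ℝ)) hw hω⟩
  choose w hw using hspeed
  have hall := ae_all_iff.2 hw
  -- Seen from `W_0`, the sample has the law `P`, under which the speed is known; the starting point
  -- itself disappears after division by `t`.
  rw [hP, ← lawWithStart_map_spaceShift hK hKtrans] at hall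
  refine ⟨w, ?_⟩
  filter_upwards [ae_of_ae_map measurable_spaceShift_prod.aemeasurable hall] with p hp
  refine tendsto_pi_nhds.2 fun i => ?_
  have h0 : Tendsto (fun t : ℝ≥0 => (t : ℝ)⁻¹ * (p.2 i : ℝ)) atTop (𝓝 0) := by
    have : Tendsto (fun t : ℝ≥0 => (t : ℝ)⁻¹) atTop (𝓝 0) :=
      tendsto_inv_atTop_zero.comp (NNReal.tendsto_coe_atTop.2 tendsto_id)
    simpa using this.mul_const (p.2 i : ℝ)
  have h1 := h0.add (hp i)
  rw [zero_add] at h1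
  refine h1.congr fun t => ?_
  simp only [walk, Pi.smul_apply, Pi.add_apply, Int.cast_add, smul_eq_mul]
  ring
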